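/- Let $m\ge 0$, $h(r)=1-\frac{2m}{r}$, $r_*=r+2m\log\left|\frac{r}{2m}-1\right|$ ($r_*=r$ if $m=0$), and let $$g=-h\,dt^2+h^{-1}dr^2+r^2\sigma$$ be the Schwarzschild metric on $\{r=|\mathbf x|>2m\}$ (Minkowski if $m=0$), where $\sigma$ is the standard metric of the unit sphere $\mathbb S^2$. Put $s=r^{-1}$ and $\bar v=t-r_*$; then $\bar g=s^2g=\sigma+2\,d\bar v\,ds-s^2(1-2ms)\,d\bar v^2$ extends to $s=0$ (future null infinity). Let $\widetilde\nabla,\widetilde\Delta$ be the gradient and Laplacian of $(\mathbb S^2,\sigma)$. Let $U\subset\mathbb S^2$ be open, $s_0>0$ with $2ms_0\le 1$, and let $P=P(\mathbf y,s)$ be a function on $U\times[0,s_0)$ that is $C^4$ up to $s=0$, such that the graph $\Sigma=\{\bar v=-P(\mathbf y,s)\}$, i.e. $t=r_*-P(\mathbf x/r,1/r)$, over $U\times(0,s_0)$ is spacelike. Let $H$, a function of $(\mathbf y,s)$, $s>0$, be its mean curvature (one third of the trace of the second fundamental form) with respect to $g$ and the future directed unit normal, and for $F=\bar v+P$ let $$L=-\langle\nabla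 F,\nabla F\rangle_{\bar g}=-\left(2P_s+s^2(1-2ms)P_s^2+|\widetilde\nabla P|^2\right).$$ For $0\le n\le\infty$ say that $\phi=\mathcal O_n(s^k)$ if $s^{-k}\phi$ extends to a function on $U\times[0,s_0)$ that is $C^n$ up to $s=0$. Let $H_0>0$ be a constant and $f=P|_{s=0}$. Define functions on $U$ by $$\begin{aligned} p_1&=-\tfrac12\left(H_0^{-2}+|\widetilde\nabla f|^2\right),\qquad \ell_1=-H_0^{-2}\widetilde\Delta f,\\ p_2&=\tfrac12\langle\widetilde\nabla|\widetilde\nabla f|^2,\widetilde\nabla f\rangle+\tfrac12H_0^{-2}\widetilde\Delta f,\\ \ell_2&=-\tfrac12H_0^{-2}(\widetilde\Delta f)^2+2H_0^{-2}\widetilde\Delta|\widetilde\nabla f|^2-2H_0^{-2}\langle\widetilde\nabla\widetilde\Delta f,\widetilde\nabla f\rangle-2H_0^{-2}\left(H_0^{-2}+|\widetilde\nabla f|^2\right),\\ p_3&=\tfrac14H_0^{-2}(\widetilde\Delta f)^2-H_0^{-2}\widetilde\Delta|\widetilde\nabla f|^2+H_0^{-2}\langle\widetilde\nabla\widetilde\Delta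 f,\widetilde\nabla f\rangle+H_0^{-2}\left(H_0^{-2}+|\widetilde\nabla f|^2\right)\\ &\qquad-\langle\widetilde\nabla p_2,\widetilde\nabla f\rangle-|\widetilde\nabla p_1|^2-p_1^2 . \end{aligned}$$ (a) If $H=H_0+\mathcal O_0(s^3)$, then at $s=0$, on all of $U$, $L=H_0^{-2}$ and $$P_s=p_1,\quad L_s=\ell_1,\quad P_{ss}=p_2,\quad L_{ss}=\ell_2,\quad P_{sss}=p_3.\tag{$*$}$$ If moreover $H=H_0+\mathcal O_0(s^4)$, then $f$ satisfies on $U$ the compatibility condition $$0=\tfrac52\,\ell_2\widetilde\Delta f+\tfrac34H_0^4\ell_1^3-4\ell_1\widetilde\Delta p_1-2H_0^{-2}\widetilde\Delta p_2+6\ell_1p_1+\langle\widetilde\nabla\ell_2,\widetilde\nabla f\rangle+2\langle\widetilde\nabla\ell_1,\widetilde\nabla p_1\rangle .$$ (b) Conversely, if $(*)$ holds on $U$ at $s=0$ and $H\to H_0$ as $s\to0^+$ for every $\mathbf y\in U$, then $H=H_0+\mathcal O_0(s^3)$; more generally, if in addition $P$ is $C^{n+4}$ up to $s=0$, $0\le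 n\le\infty$, then $H=H_0+\mathcal O_n(s^3)$ (so the extension is smooth if $P$ is smooth). -/

import Mathlib

open Set Filter Topology
open scoped Manifold ContDiff

noncomputable section

/-! ### Semi-Riemannian geometry in one coordinate system -/

namespace CoordGeometry

variable {ι : Type} [Fintype ι] [DecidableEq ι]

/-- The coordinate derivative `∂_a F` at `p`. -/
def pderiv (F : (ι → ℝ) → ℝ) (a : ι) (p : ι → ℝ) : ℝ :=
  fderiv ℝ F p (Pi.single a 1)

/-- The gradient `(∇F)^a = g^{ab} ∂_b F` for the metric with matrix `g` in the coordinates. -/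
def grad (g : (ι → ℝ) → Matrix ι ι ℝ) (F : (ι → ℝ) → ℝ) (p : ι → ℝ) (a : ι) : ℝ :=
  ∑ b, (g p)⁻¹ a b * pderiv F b p

/-- `⟨∇F, ∇F⟩ = g^{ab} ∂_a F ∂_b F`. -/
def gradSq (g : (ι → ℝ) → Matrix ι ι ℝ) (F : (ι → ℝ) → ℝ) (p : ι → ℝ) : ℝ :=
  ∑ a, ∑ b, (g p)⁻¹ a b * pderiv F a p * pderiv F b p

/-- The divergence `div X = |det g|^{-1/2} ∂_a (|det g|^{1/2} X^a)` of a vector field. -/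
def divergence (g : (ι → ℝ) → Matrix ι ι ℝ) (X : (ι → ℝ) → ι → ℝ) (p : ι → ℝ) : ℝ :=
  (Real.sqrt |(g p).det|)⁻¹ *
    ∑ a, pderiv (fun q => Real.sqrt |(g q).det| * X q a) a p

/-- The unit normal `(-⟨∇F, ∇F⟩)^{-1/2} ∇F` of the level sets of a function `F` with timelike
gradient. -/
def timelikeNormal (g : (ι → ℝ) → Matrix ι ι ℝ) (F : (ι → ℝ) → ℝ) (p : ι → ℝ) (a : ι) : ℝ :=
  (Real.sqrt (-gradSq g F p))⁻¹ * grad g F p a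

/-- The mean curvature, at `p`, of the (three-dimensional) level set of `F` through `p`:
one third of the trace of the second fundamental form with respect to the unit normal in the
direction of `∇F`, i.e. one third of the divergence of that normal. -/
def levelMeanCurvature (g : (ι → ℝ) → Matrix ι ι ℝ) (F : (ι → ℝ) → ℝ) (p : ι → ℝ) : ℝ :=
  (1 / 3) * divergence g (timelikeNormal g F) p

end CoordGeometry

/-! ### The unit sphere and its calculus -/

/-- Euclidean three-space. -/
abbrev E3 : Type := EuclideanSpace ℝ (Fin 3)

/-- The unit sphere in Euclidean three-space, with its standard smooth structure. -/
abbrev S2 : Type := Metric.sphere (0 : E3) 1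

/-- The radial projection `x ↦ x / |x|` onto the sphere (its value at `0` is irrelevant). -/
def radialProj (x : E3) : S2 :=
  if hx : x = 0 then ⟨EuclideanSpace.single 0 1, by simp⟩
  else ⟨‖x‖⁻¹ • x, by simp [norm_smul, hx]⟩

/-- The extension of a function on the sphere that is constant along rays from the origin. -/
def radialExt (f : S2 → ℝ) (x : E3) : ℝ := f (radialProj x)

/-- The gradient of a function on the round unit sphere, as a tangent vector of the sphere in
`ℝ³`. The extension constant along rays has no radial derivative, so its Euclidean gradient at a
point of the sphere is the gradient on the sphere. -/
def sphGrad (f : S2 → ℝ) (y : S2) : E3 := gradient (radialExt f) (y : E3)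

/-- The Laplacian of the round unit sphere: at a point of the sphere it is the Euclidean Laplacian
of the extension that is constant along rays. -/
def sphLap (f : S2 → ℝ) (y : S2) : ℝ := Laplacian.laplacian (radialExt f) (y : E3)

/-- The inner product `⟨∇f, ∇k⟩` on the round unit sphere. -/
def sphInner (f k : S2 → ℝ) (y : S2) : ℝ := inner ℝ (sphGrad f y) (sphGrad k y)

/-- `|∇f|²` on the round unit sphere. -/
def sphGradSq (f : S2 → ℝ) (y : S2) : ℝ := sphInner f f y

/-- The `k`-th derivative in `s` of a function of `(y, s)`, one-sided at `s = 0`. -/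
def sDeriv (k : ℕ) (φ : S2 → ℝ → ℝ) (y : S2) (s : ℝ) : ℝ :=
  iteratedDerivWithin k (φ y) (Ici 0) s

/-- `φ` is of class `C^n` on `U × [0, s₀)`, up to and including `s = 0`. -/
def SmoothUpToBoundary (n : WithTop ℕ∞) (U : Set S2) (s₀ : ℝ) (φ : S2 → ℝ → ℝ) : Prop :=
  ContMDiffOn ((𝓡 2).prod 𝓘(ℝ, ℝ)) 𝓘(ℝ, ℝ) n (fun z : S2 × ℝ => φ z.1 z.2) (U ×ˢ Ico 0 s₀)

/-- `φ = 𝒪(s^k)` for a function `φ` on `U × (0, s₀)`: the function `s^{-k} φ` extends to a function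
that is `C^n` up to `s = 0`. -/
def IsBoundaryO (n : WithTop ℕ∞) (k : ℕ) (U : Set S2) (s₀ : ℝ) (φ : S2 → ℝ → ℝ) : Prop :=
  ∃ ψ : S2 → ℝ → ℝ, SmoothUpToBoundary n U s₀ ψ ∧
    ∀ y ∈ U, ∀ s ∈ Ioo 0 s₀, φ y s = s ^ k * ψ y s

/-! ### The Schwarzschild exterior and graphs near future null infinity -/

namespace Schwarzschild

/-- The index type of the coordinates `(t, x¹, x², x³)`. -/
abbrev Idx : Type := Unit ⊕ Fin 3

/-- The point with coordinates `(t, x)`. -/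
def point (t : ℝ) (x : E3) : Idx → ℝ := Sum.elim (fun _ => t) (fun i => x i)

/-- The time coordinate of a point. -/
def time (p : Idx → ℝ) : ℝ := p (Sum.inl ())

/-- The spatial coordinates of a point. -/
def space (p : Idx → ℝ) : E3 := WithLp.toLp 2 (fun i => p (Sum.inr i))

/-- `h(r) = 1 - 2m/r`. -/
def lapse (m r : ℝ) : ℝ := 1 - 2 * m / r

/-- The Schwarzschild metric `-h dt² + h⁻¹ dr² + r² σ` in the coordinates `(t, x)`, `r = |x|`,
where `dr = r⁻¹ xᵢ dxⁱ` and `r² σ = |dx|² - dr²`. -/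
def metric (m : ℝ) (p : Idx → ℝ) : Matrix Idx Idx ℝ :=
  Matrix.fromBlocks
    (Matrix.of fun _ _ => -lapse m ‖space p‖) 0 0
    (Matrix.of fun i j => (if i = j then 1 else 0) +
      ((lapse m ‖space p‖)⁻¹ - 1) * (space p i / ‖space p‖) * (space p j / ‖space p‖))

/-- `r_* = r + 2m log |r/(2m) - 1|`, equal to `r` for `m = 0`. -/
def tortoise (m r : ℝ) : ℝ := r + 2 * m * Real.log |r / (2 * m) - 1|

/-- The height function `u = r_* - P(x/r, 1/r)`; its graph `t = u(x)` is `{v̄ + P = 0}` where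
`v̄ = t - r_*` is the retarded time and `s = 1/r`. -/
def height (m : ℝ) (P : S2 → ℝ → ℝ) (x : E3) : ℝ :=
  tortoise m ‖x‖ - P (radialProj x) ‖x‖⁻¹

/-- The defining function `u - t = -(v̄ + P)` of the graph; its gradient is future directed. -/
def definingFun (m : ℝ) (P : S2 → ℝ → ℝ) (p : Idx → ℝ) : ℝ :=
  height m P (space p) - time p

/-- The spatial position of the point of the surface with coordinates `(y, s)`. -/
def position (y : S2) (s : ℝ) : E3 := s⁻¹ • (y : E3)

/-- The point of the graph of `P` with coordinates `(y, s)`. -/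
def graphPoint (m : ℝ) (P : S2 → ℝ → ℝ) (y : S2) (s : ℝ) : Idx → ℝ :=
  point (height m P (position y s)) (position y s)

/-- The part of the graph of `P` over `U × (0, s₀)` is spacelike: the metric is positive on its
nonzero tangent vectors `(du(w), w)`. -/
def IsSpacelikeGraph (m : ℝ) (U : Set S2) (s₀ : ℝ) (P : S2 → ℝ → ℝ) : Prop :=
  ∀ y ∈ U, ∀ s ∈ Ioo 0 s₀, ∀ w : E3, w ≠ 0 →
    0 < point (fderiv ℝ (height m P) (position y s) w) w ⬝ᵥ
      (metric m (graphPoint m P y s)).mulVec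
        (point (fderiv ℝ (height m P) (position y s) w) w)

/-- The mean curvature, with respect to the future directed unit normal and the Schwarzschild
metric, of the graph of `P`, as a function of `(y, s)`, `s > 0`. -/
def meanCurv (m : ℝ) (P : S2 → ℝ → ℝ) (y : S2) (s : ℝ) : ℝ :=
  CoordGeometry.levelMeanCurvature (metric m) (definingFun m P) (graphPoint m P y s)

/-- The `(s, v̄)` block of the unphysical metric `s² g = σ - s²(1 - 2ms) dv̄² + 2 dv̄ ds`. -/
def unphysicalBlock (m s : ℝ) : Matrix (Fin 2) (Fin 2) ℝ :=
  !![0, 1; 1, -(s ^ 2 * (1 - 2 * m * s))]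

/-- `L = -⟨∇F, ∇F⟩` for `F = v̄ + P` and the unphysical metric, up to and including `s = 0`. -/
def L (m : ℝ) (P : S2 → ℝ → ℝ) (y : S2) (s : ℝ) : ℝ :=
  -(sphGradSq (fun z => P z s) y +
    ![sDeriv 1 P y s, 1] ⬝ᵥ (unphysicalBlock m s)⁻¹.mulVec ![sDeriv 1 P y s, 1])

theorem L_eq (m : ℝ) (P : S2 → ℝ → ℝ) (y : S2) (s : ℝ) :
    L m P y s = -(2 * sDeriv 1 P y s + s ^ 2 * (1 - 2 * m * s) * sDeriv 1 P y s ^ 2 +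
      sphGradSq (fun z => P z s) y) := by
  have h : (unphysicalBlock m s)⁻¹ = !![s ^ 2 * (1 - 2 * m * s), 1; 1, 0] := by
    apply Matrix.inv_eq_right_inv
    ext i j
    fin_cases i <;> fin_cases j <;> simp [unphysicalBlock, Matrix.mul_apply, Fin.sum_univ_two]
  rw [L, h]
  simp [Matrix.mulVec, dotProduct, Fin.sum_univ_two]
  ring

/-! ### The boundary expressions, in terms of the boundary value `f = P|_{s=0}` -/

/-- The boundary value prescribed for `P_s`. -/
def bdP1 (H₀ : ℝ) (f : S2 → ℝ) (y : S2) : ℝ :=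
  -(1 / 2) * ((H₀ ^ 2)⁻¹ + sphGradSq f y)

/-- The boundary value prescribed for `L_s`. -/
def bdL1 (H₀ : ℝ) (f : S2 → ℝ) (y : S2) : ℝ :=
  -(H₀ ^ 2)⁻¹ * sphLap f y

/-- The boundary value prescribed for `P_ss`. -/
def bdP2 (H₀ : ℝ) (f : S2 → ℝ) (y : S2) : ℝ :=
  (1 / 2) * sphInner (sphGradSq f) f y + (1 / 2) * (H₀ ^ 2)⁻¹ * sphLap f y

/-- The boundary value prescribed for `L_ss`. -/
def bdL2 (H₀ : ℝ) (f : S2 → ℝ) (y : S2) : ℝ :=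
  -(1 / 2) * (H₀ ^ 2)⁻¹ * sphLap f y ^ 2 + 2 * (H₀ ^ 2)⁻¹ * sphLap (sphGradSq f) y
    - 2 * (H₀ ^ 2)⁻¹ * sphInner (sphLap f) f y
    - 2 * (H₀ ^ 2)⁻¹ * ((H₀ ^ 2)⁻¹ + sphGradSq f y)

/-- The boundary value prescribed for `P_sss`. -/
def bdP3 (H₀ : ℝ) (f : S2 → ℝ) (y : S2) : ℝ :=
  (1 / 4) * (H₀ ^ 2)⁻¹ * sphLap f y ^ 2 - (H₀ ^ 2)⁻¹ * sphLap (sphGradSq f) y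
    + (H₀ ^ 2)⁻¹ * sphInner (sphLap f) f y
    + (H₀ ^ 2)⁻¹ * ((H₀ ^ 2)⁻¹ + sphGradSq f y)
    - sphInner (bdP2 H₀ f) f y - sphGradSq (bdP1 H₀ f) y - bdP1 H₀ f y ^ 2

/-- The five formulas for `P_s, L_s, P_ss, L_ss, P_sss` at the boundary point `(y, 0)`. -/
def BoundaryFormulas (m H₀ : ℝ) (P : S2 → ℝ → ℝ) (y : S2) : Prop :=
  sDeriv 1 P y 0 = bdP1 H₀ (fun z => P z 0) y ∧
  sDeriv 1 (L m P) y 0 = bdL1 H₀ (fun z => P z 0) y ∧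
  sDeriv 2 P y 0 = bdP2 H₀ (fun z => P z 0) y ∧
  sDeriv 2 (L m P) y 0 = bdL2 H₀ (fun z => P z 0) y ∧
  sDeriv 3 P y 0 = bdP3 H₀ (fun z => P z 0) y

/-- The compatibility condition on the boundary value `f` at the point `y`. -/
def Compatible (H₀ : ℝ) (f : S2 → ℝ) (y : S2) : Prop :=
  0 = (5 / 2) * bdL2 H₀ f y * sphLap f y + (3 / 4) * H₀ ^ 4 * bdL1 H₀ f y ^ 3
    - 4 * bdL1 H₀ f y * sphLap (bdP1 H₀ f) y - 2 * (H₀ ^ 2)⁻¹ * sphLap (bdP2 H₀ f) y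
    + 6 * bdL1 H₀ f y * bdP1 H₀ f y
    + sphInner (bdL2 H₀ f) f y + 2 * sphInner (bdL1 H₀ f) (bdP1 H₀ f) y

end Schwarzschild

end

/-!
The surface is studied through the function `L` near `s = 0`. In the coordinates `(t, x)` the
Schwarzschild volume element is the Euclidean one and the unit normal does not depend on `t`, so
three times the mean curvature is a Euclidean divergence. Splitting the normal into its radial and
tangential parts gives, with `A = 1 + s² (1 - 2ms) P_s`
(`Schwarzschild.meanCurv_formula`),
`6 H L^{3/2} = 6 A L - 2 s L ((s² (1 - 2ms) P_s)_s + ΔP) + s (A L_s + ⟨∇P, ∇L⟩)`,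
an equation all of whose terms make sense up to `s = 0`. Spacelike means `L > 0` for `s > 0`
(`Schwarzschild.L_pos`).

The equation degenerates where `L` vanishes, so for the direct part it must be shown that `L > 0`
at `s = 0` as well. This is a maximum principle (`Schwarzschild.L_pos_boundary`): if
`L(y₀, 0) = 0`, the product of `s L` with a suitable cut-off near `(y₀, 0)` has an interior
maximum, and there the equation contradicts the first order conditions.

Once `L > 0` up to the boundary, everything is a comparison of Taylor coefficients in `s`. The
coefficient of order zero gives `L = H₀⁻²`. Given this, `Schwarzschild.jet3_defect` expands the
equation to third order; the third derivative of `L` cancels, and so does the mass. The coefficients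
of `s` and `s²` determine `L_s` and `L_ss`, the definition of `L` then gives `P_ss` and `P_sss`
(`Schwarzschild.sDeriv_L`), and the coefficient of `s³` is half of the expression in the
compatibility condition.

Conversely, the boundary formulas make the coefficients of order at most two vanish. Hadamard's
lemma up to the boundary (`contDiffOn_hadamardQuotient`), applied three times to the terms of class
`C^{n+3}` and twice to those of class `C^{n+2}`, which carry a factor `s`, shows that the quotient of
the equation by `s³` is of class `C^n` up to `s = 0`.

Functions on `U × [0, s₀)` are handled through their extensions to `ℝ³ × ℝ` that are constant along
rays of `ℝ³`.
-/

noncomputable section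

/-! ### Radial projection and extension along rays -/

theorem radialProj_coe (y : S2) : radialProj (y : E3) = y := by
  have hy : ‖(y : E3)‖ = 1 := by simp
  have h0 : (y : E3) ≠ 0 := by
    intro h; rw [h] at hy; simp at hy
  ext1
  simp [radialProj, h0, hy]

theorem coe_radialProj {x : E3} (hx : x ≠ 0) : (radialProj x : E3) = ‖x‖⁻¹ • x := by
  simp [radialProj, hx]

theorem radialProj_smul {c : ℝ} (hc : 0 < c) (x : E3) : radialProj (c • x) = radialProj x := by
  by_cases hx : x = 0
  · simp [hx]
  · have hcx : c • x ≠ 0 := smul_ne_zero hc.ne' hx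
    ext1
    rw [coe_radialProj hx, coe_radialProj hcx, norm_smul, Real.norm_of_nonneg hc.le, smul_smul]
    congr 1
    field_simp

theorem norm_coe_S2 (y : S2) : ‖(y : E3)‖ = 1 := by simp

theorem coe_S2_ne_zero (y : S2) : (y : E3) ≠ 0 := by
  intro h
  have := norm_coe_S2 y
  simp [h] at this

theorem contMDiffAt_radialProj {n : WithTop ℕ∞} {x : E3} (hx : x ≠ 0) :
    ContMDiffAt 𝓘(ℝ, E3) (𝓡 2) n radialProj x := by
  have : Fact (Module.finrank ℝ E3 = 2 + 1) := ⟨by simp⟩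
  let V : TopologicalSpace.Opens E3 := ⟨{0}ᶜ, isOpen_compl_singleton⟩
  have hV : ∀ z : V, (z : E3) ≠ 0 := fun z => z.2
  have h1 : ContMDiff 𝓘(ℝ, E3) 𝓘(ℝ, E3) n (fun z : V => ‖(z : E3)‖⁻¹ • (z : E3)) := by
    intro z
    have : ContMDiffAt 𝓘(ℝ, E3) 𝓘(ℝ, E3) n (fun z : E3 => ‖z‖⁻¹ • z) (z : E3) := by
      apply ContDiffAt.contMDiffAt
      exact ((contDiffAt_norm ℝ (hV z)).inv (norm_ne_zero_iff.2 (hV z))).smul contDiffAt_id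
    exact contMDiffAt_subtype_iff.2 this
  have h2 : ∀ z : V, ‖(z : E3)‖⁻¹ • (z : E3) ∈ Metric.sphere (0 : E3) 1 := by
    intro z
    simp [norm_smul, hV z]
  have h3 : ContMDiff 𝓘(ℝ, E3) (𝓡 2) n (Set.codRestrict _ _ h2 : V → Metric.sphere (0 : E3) 1) :=
    ContMDiff.codRestrict_sphere h1 h2
  have h4 := h3 ⟨x, hx⟩
  have h5 : (Set.codRestrict _ _ h2 : V → Metric.sphere (0 : E3) 1) = fun z : V => radialProj z := by
    funext z
    ext1
    rw [coe_radialProj (hV z)]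
    rfl
  rw [h5] at h4
  exact contMDiffAt_subtype_iff.1 h4

/-- The open cone over a subset of the sphere. -/
def cone (U : Set S2) : Set E3 := {x | x ≠ 0 ∧ radialProj x ∈ U}

theorem continuousOn_radialProj : ContinuousOn radialProj {0}ᶜ := fun x hx =>
  (contMDiffAt_radialProj (n := 0) (x := x) hx).continuousAt.continuousWithinAt

theorem isOpen_cone {U : Set S2} (hU : IsOpen U) : IsOpen (cone U) :=
  continuousOn_radialProj.isOpen_inter_preimage isOpen_compl_singleton hU

theorem coe_mem_cone {U : Set S2} {y : S2} (hy : y ∈ U) : (y : E3) ∈ cone U :=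
  ⟨coe_S2_ne_zero y, by rwa [radialProj_coe]⟩

theorem smul_mem_cone {U : Set S2} {x : E3} {c : ℝ} (hc : 0 < c) (hx : x ∈ cone U) :
    c • x ∈ cone U :=
  ⟨smul_ne_zero hc.ne' hx.1, by rw [radialProj_smul hc]; exact hx.2⟩

/-- The extension of a function of `(y, s)` to a function on `(ℝ³ \ {0}) × ℝ` that is constant
along rays. -/
def radialLift (φ : S2 → ℝ → ℝ) (z : E3 × ℝ) : ℝ := φ (radialProj z.1) z.2

theorem SmoothUpToBoundary.contDiffOn {n : WithTop ℕ∞} {U : Set S2} {s₀ : ℝ} {φ : S2 → ℝ → ℝ}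
    (h : SmoothUpToBoundary n U s₀ φ) :
    ContDiffOn ℝ n (radialLift φ) (cone U ×ˢ Ico 0 s₀) := by
  rw [← contMDiffOn_iff_contDiffOn, modelWithCornersSelf_prod, ← chartedSpaceSelf_prod]
  have h1 : ContMDiffOn (𝓘(ℝ, E3).prod 𝓘(ℝ, ℝ)) ((𝓡 2).prod 𝓘(ℝ, ℝ)) n
      (fun z : E3 × ℝ => (radialProj z.1, z.2)) (cone U ×ˢ Ico 0 s₀) := by
    intro z hz
    apply ContMDiffAt.contMDiffWithinAt
    exact ((contMDiffAt_radialProj hz.1.1).comp z contMDiffAt_fst).prodMk contMDiffAt_snd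
  exact ContMDiffOn.comp (t := U ×ˢ Ico 0 s₀) h h1 (fun z hz => ⟨hz.1.2, hz.2⟩)

theorem smoothUpToBoundary_of_contDiffOn {n : WithTop ℕ∞} {U : Set S2} {s₀ : ℝ} {Ψ : E3 × ℝ → ℝ}
    (h : ContDiffOn ℝ n Ψ (cone U ×ˢ Ico 0 s₀)) :
    SmoothUpToBoundary n U s₀ (fun y s => Ψ (y, s)) := by
  have : Fact (Module.finrank ℝ E3 = 2 + 1) := ⟨by simp⟩
  have h1 : ContMDiff ((𝓡 2).prod 𝓘(ℝ, ℝ)) 𝓘(ℝ, E3 × ℝ) n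
      (fun z : S2 × ℝ => ((z.1 : E3), z.2)) :=
    (contMDiff_coe_sphere.comp contMDiff_fst).prodMk_space contMDiff_snd
  exact ContMDiffOn.comp h.contMDiffOn h1.contMDiffOn (fun z hz => ⟨coe_mem_cone hz.1, hz.2⟩)

theorem smoothUpToBoundary_iff {n : WithTop ℕ∞} {U : Set S2} {s₀ : ℝ} {φ : S2 → ℝ → ℝ} :
    SmoothUpToBoundary n U s₀ φ ↔ ContDiffOn ℝ n (radialLift φ) (cone U ×ˢ Ico 0 s₀) := by
  refine ⟨fun h => h.contDiffOn, fun h => ?_⟩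
  simpa [radialLift, radialProj_coe] using smoothUpToBoundary_of_contDiffOn h

theorem SmoothUpToBoundary.congr {n : WithTop ℕ∞} {U : Set S2} {s₀ : ℝ} {φ ψ : S2 → ℝ → ℝ}
    (h : SmoothUpToBoundary n U s₀ φ) (hψ : ∀ y ∈ U, ∀ s ∈ Ico 0 s₀, ψ y s = φ y s) :
    SmoothUpToBoundary n U s₀ ψ :=
  ContMDiffOn.congr h fun z hz => hψ z.1 hz.1 z.2 hz.2

/-! ### Parameter integrals and Hadamard's lemma up to the boundary -/

theorem intervalIntegrable_of_continuousOn_prod {H F : Type} [TopologicalSpace H]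
    [NormedAddCommGroup F] {C : Set H} {G : H → ℝ → F}
    (hG : ContinuousOn G.uncurry (C ×ˢ Icc 0 1)) {z : H} (hz : z ∈ C) :
    IntervalIntegrable (G z) MeasureTheory.volume 0 1 := by
  apply ContinuousOn.intervalIntegrable
  rw [uIcc_of_le zero_le_one]
  exact hG.comp (f := fun t => (z, t)) (by fun_prop) fun t ht => ⟨hz, ht⟩

theorem continuousOn_integral_of_continuousOn_prod {H F : Type} [TopologicalSpace H]
    [NormedAddCommGroup F] [NormedSpace ℝ F] {C : Set H} {G : H → ℝ → F}
    (hG : ContinuousOn G.uncurry (C ×ˢ Icc 0 1)) :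
    ContinuousOn (fun z => ∫ t in (0 : ℝ)..1, G z t) C := by
  intro z hz
  rw [ContinuousWithinAt, Metric.tendsto_nhds]
  intro ε hε
  obtain ⟨v, hv, h⟩ := isCompact_Icc.mem_uniformity_of_prod hG hz
    (Metric.dist_mem_uniformity (half_pos hε))
  filter_upwards [hv, self_mem_nhdsWithin] with w hw hwC
  rw [dist_eq_norm, ← intervalIntegral.integral_sub
    (intervalIntegrable_of_continuousOn_prod hG hwC)
    (intervalIntegrable_of_continuousOn_prod hG hz)]
  have := intervalIntegral.norm_integral_le_of_norm_le_const (a := (0 : ℝ)) (b := 1)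
    (f := fun t => G w t - G z t) (C := ε / 2) (by
      intro t ht
      rw [uIoc_of_le zero_le_one] at ht
      have := h w hw t (Ioc_subset_Icc_self ht)
      rw [← dist_eq_norm]
      exact le_of_lt this)
  calc _ ≤ _ := this
    _ < ε := by norm_num; linarith

/-- Differentiation under the integral sign within a convex set, which need not be open. -/
theorem hasFDerivWithinAt_integral_of_continuousOn_prod {H F : Type} [NormedAddCommGroup H]
    [NormedSpace ℝ H] [NormedAddCommGroup F] [NormedSpace ℝ F] [CompleteSpace F] {C : Set H}
    (hC : Convex ℝ C) {G : H → ℝ → F} {G' : H → ℝ → H →L[ℝ] F}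
    (hG : ContinuousOn G.uncurry (C ×ˢ Icc 0 1)) (hG' : ContinuousOn G'.uncurry (C ×ˢ Icc 0 1))
    (hd : ∀ t ∈ Icc (0 : ℝ) 1, ∀ z ∈ C, HasFDerivWithinAt (fun z => G z t) (G' z t) C z)
    {z : H} (hz : z ∈ C) :
    HasFDerivWithinAt (fun z => ∫ t in (0 : ℝ)..1, G z t) (∫ t in (0 : ℝ)..1, G' z t) C z := by
  rw [hasFDerivWithinAt_iff_isLittleO, Asymptotics.isLittleO_iff]
  intro ε hε
  obtain ⟨v, hv, h⟩ := isCompact_Icc.mem_uniformity_of_prod hG' hz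
    (Metric.dist_mem_uniformity hε)
  obtain ⟨δ, hδ, hδv⟩ := Metric.mem_nhdsWithin_iff.1 hv
  have hball : Metric.ball z δ ∩ C ∈ 𝓝[C] z :=
    Filter.inter_mem (mem_nhdsWithin_of_mem_nhds (Metric.ball_mem_nhds _ hδ)) self_mem_nhdsWithin
  filter_upwards [hball] with w hw
  have hwC := hw.2
  have h1 := intervalIntegrable_of_continuousOn_prod hG hwC
  have h2 := intervalIntegrable_of_continuousOn_prod hG hz
  have h3 := intervalIntegrable_of_continuousOn_prod hG' hz
  have h4 : IntervalIntegrable (fun t => G' z t (w - z)) MeasureTheory.volume 0 1 :=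
    intervalIntegrable_of_continuousOn_prod (G := fun x t => G' x t (w - z))
      (hG'.clm_apply continuousOn_const) hz
  rw [ContinuousLinearMap.intervalIntegral_apply h3, ← intervalIntegral.integral_sub h1 h2,
    ← intervalIntegral.integral_sub (h1.sub h2) h4]
  have := intervalIntegral.norm_integral_le_of_norm_le_const (a := (0 : ℝ)) (b := 1)
    (f := fun t => G w t - G z t - G' z t (w - z)) (C := ε * ‖w - z‖) (by
      intro t ht
      rw [uIoc_of_le zero_le_one] at ht
      have ht' := Ioc_subset_Icc_self ht
      apply (((convex_ball z δ).inter hC)).norm_image_sub_le_of_norm_hasFDerivWithin_le'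
        (f := fun z => G z t) (f' := fun z => G' z t)
        (fun x hx => (hd t ht' x hx.2).mono inter_subset_right) _
        ⟨Metric.mem_ball_self hδ, hz⟩ hw
      intro x hx
      rw [← dist_eq_norm]
      exact le_of_lt (h x (hδv hx) t ht'))
  simpa using this

section Hadamard

variable {E : Type} [NormedAddCommGroup E] [NormedSpace ℝ E]

/-- The rescaling `(x, s) ↦ (x, t s)` of the half space. -/
def scaleSnd (E : Type) [NormedAddCommGroup E] [NormedSpace ℝ E] (t : ℝ) : E × ℝ →L[ℝ] E × ℝ :=
  (ContinuousLinearMap.fst ℝ E ℝ).prod (t • ContinuousLinearMap.snd ℝ E ℝ)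

theorem scaleSnd_apply (t : ℝ) (z : E × ℝ) : scaleSnd E t z = (z.1, t * z.2) := rfl

theorem scaleSnd_mem {V : Set E} {s₀ : ℝ} {t : ℝ} (ht : t ∈ Icc (0 : ℝ) 1) {z : E × ℝ}
    (hz : z ∈ V ×ˢ Ico 0 s₀) : scaleSnd E t z ∈ V ×ˢ Ico 0 s₀ := by
  obtain ⟨h1, h2, h3⟩ := hz
  refine ⟨h1, mul_nonneg ht.1 h2, ?_⟩
  exact lt_of_le_of_lt (mul_le_of_le_one_left h2 ht.2) h3

theorem continuousOn_scaled {F : Type} [NormedAddCommGroup F]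
    {V : Set E} {s₀ : ℝ} {g : E × ℝ → F} (hg : ContinuousOn g (V ×ˢ Ico 0 s₀)) :
    ContinuousOn (fun p : (E × ℝ) × ℝ => g (scaleSnd E p.2 p.1))
      ((V ×ˢ Ico 0 s₀) ×ˢ Icc 0 1) := by
  apply hg.comp (f := fun p : (E × ℝ) × ℝ => scaleSnd E p.2 p.1)
  · simp only [scaleSnd_apply]
    fun_prop
  · exact fun p hp => scaleSnd_mem hp.2 hp.1

/-- The weight `t ^ k` is needed for the induction on `n`: each derivative in the last variable
produces one more factor `t`. -/
theorem contDiffOn_integral_scaled_of_convex {V : Set E} (hV : Convex ℝ V) (hVo : IsOpen V)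
    {s₀ : ℝ} (n : ℕ) :
    ∀ {F : Type} [NormedAddCommGroup F] [NormedSpace ℝ F] [CompleteSpace F] (g : E × ℝ → F) (k : ℕ),
      ContDiffOn ℝ n g (V ×ˢ Ico 0 s₀) →
      ContDiffOn ℝ n (fun z => ∫ t in (0 : ℝ)..1, t ^ k • g (scaleSnd E t z)) (V ×ˢ Ico 0 s₀) := by
  have hCc : Convex ℝ (V ×ˢ Ico 0 s₀) := hV.prod (convex_Ico 0 s₀)
  have hCu : UniqueDiffOn ℝ (V ×ˢ Ico 0 s₀) := hVo.uniqueDiffOn.prod (uniqueDiffOn_Ico 0 s₀)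
  have hcont : ∀ {F : Type} [NormedAddCommGroup F] [NormedSpace ℝ F] (g : E × ℝ → F) (k : ℕ),
      ContinuousOn g (V ×ˢ Ico 0 s₀) →
      ContinuousOn (Function.uncurry fun z t => t ^ k • g (scaleSnd E t z))
        ((V ×ˢ Ico 0 s₀) ×ˢ Icc 0 1) := by
    intro F _ _ g k hg
    exact ContinuousOn.smul (by fun_prop) (continuousOn_scaled hg)
  induction n with
  | zero =>
    intro F _ _ _ g k hg
    exact contDiffOn_zero.2 (continuousOn_integral_of_continuousOn_prod (hcont g k hg.continuousOn))
  | succ n ih =>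
    intro F _ _ _ g k hg
    push_cast at hg ⊢
    have hg' : ContDiffOn ℝ n (fderivWithin ℝ g (V ×ˢ Ico 0 s₀)) (V ×ˢ Ico 0 s₀) :=
      hg.fderivWithin hCu le_rfl
    set g' := fderivWithin ℝ g (V ×ˢ Ico 0 s₀) with hg'def
    have hgd : ∀ z ∈ V ×ˢ Ico 0 s₀, HasFDerivWithinAt g (g' z) (V ×ˢ Ico 0 s₀) z := fun z hz =>
      ((hg.differentiableOn (by simp)) z hz).hasFDerivWithinAt
    -- the derivative splits into two integrals of the same kind, with `g` replaced by `g'`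
    let p₁ : E × ℝ →L[ℝ] E × ℝ := (ContinuousLinearMap.fst ℝ E ℝ).prod 0
    let p₂ : E × ℝ →L[ℝ] E × ℝ := (0 : E × ℝ →L[ℝ] E).prod (ContinuousLinearMap.snd ℝ E ℝ)
    have hsplit : ∀ t, scaleSnd E t = p₁ + t • p₂ := by
      intro t
      ext <;> simp [scaleSnd, p₁, p₂]
    have i1 := ih (fun z => (g' z).comp p₁) k (hg'.clm_comp contDiffOn_const)
    have i2 := ih (fun z => (g' z).comp p₂) (k + 1) (hg'.clm_comp contDiffOn_const)
    refine (contDiffOn_succ_iff_hasFDerivWithinAt_of_uniqueDiffOn hCu).2 ⟨by simp, _,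
      i1.add i2, fun z hz => ?_⟩
    have c1 := hcont (fun z => (g' z).comp p₁) k
      (hg'.clm_comp contDiffOn_const).continuousOn
    have c2 := hcont (fun z => (g' z).comp p₂) (k + 1)
      (hg'.clm_comp contDiffOn_const).continuousOn
    rw [← intervalIntegral.integral_add (intervalIntegrable_of_continuousOn_prod c1 hz)
      (intervalIntegrable_of_continuousOn_prod c2 hz)]
    refine hasFDerivWithinAt_integral_of_continuousOn_prod hCc (hcont g k hg.continuousOn)
      (G' := fun z t => t ^ k • (g' (scaleSnd E t z)).comp p₁ +
        t ^ (k + 1) • (g' (scaleSnd E t z)).comp p₂) (c1.add c2) ?_ hz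
    intro t ht z hz
    have := ((hgd _ (scaleSnd_mem ht hz)).comp z (scaleSnd E t).hasFDerivWithinAt
      (fun w hw => scaleSnd_mem ht hw)).const_smul (t ^ k)
    convert! this using 1
    rw [hsplit, ContinuousLinearMap.comp_add, smul_add, ContinuousLinearMap.comp_smul, pow_succ,
      mul_smul]

/-- A derivative in the last variable of a function on `O × [0, s₀)`, one-sided at `0`, averaged
over the segment from `(x, 0)` to `(x, s)`. -/
def hadamardQuotient (O : Set E) (s₀ : ℝ) (Φ : E × ℝ → ℝ) (z : E × ℝ) : ℝ :=
  ∫ t in (0 : ℝ)..1, fderivWithin ℝ Φ (O ×ˢ Ico 0 s₀) (scaleSnd E t z) (0, 1)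

theorem contDiffOn_hadamardQuotient {O : Set E} (hO : IsOpen O) {s₀ : ℝ}
    {Φ : E × ℝ → ℝ} {n : ℕ∞} (hΦ : ContDiffOn ℝ (n + 1) Φ (O ×ˢ Ico 0 s₀)) :
    ContDiffOn ℝ n (hadamardQuotient O s₀ Φ) (O ×ˢ Ico 0 s₀) := by
  have hCu : UniqueDiffOn ℝ (O ×ˢ Ico 0 s₀) := hO.uniqueDiffOn.prod (uniqueDiffOn_Ico 0 s₀)
  have key : ∀ k : ℕ, (k : ℕ∞) ≤ n → ContDiffOn ℝ k (hadamardQuotient O s₀ Φ) (O ×ˢ Ico 0 s₀) := by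
    intro k hk z hz
    obtain ⟨ε, hε, hεO⟩ := Metric.isOpen_iff.1 hO z.1 hz.1
    have hg : ContDiffOn ℝ k (fun z => fderivWithin ℝ Φ (O ×ˢ Ico 0 s₀) z (0, 1))
        (O ×ˢ Ico 0 s₀) := by
      refine (hΦ.fderivWithin (m := k) hCu ?_).clm_apply contDiffOn_const
      gcongr
      exact_mod_cast hk
    have h1 := contDiffOn_integral_scaled_of_convex (convex_ball z.1 ε) Metric.isOpen_ball k
      (fun z => fderivWithin ℝ Φ (O ×ˢ Ico 0 s₀) z (0, 1)) 0
      (hg.mono (prod_mono hεO subset_rfl))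
    simp only [pow_zero, one_smul] at h1
    refine (h1 z ⟨Metric.mem_ball_self hε, hz.2⟩).mono_of_mem_nhdsWithin ?_
    have : Metric.ball z.1 ε ×ˢ (univ : Set ℝ) ∈ 𝓝 z :=
      (Metric.isOpen_ball.prod isOpen_univ).mem_nhds ⟨Metric.mem_ball_self hε, mem_univ _⟩
    filter_upwards [mem_nhdsWithin_of_mem_nhds this, self_mem_nhdsWithin] with w hw hw2
    exact ⟨hw.1, hw2.2⟩
  induction n with
  | top => exact contDiffOn_infty.2 fun k => key k le_top
  | coe n => exact key n le_rfl

theorem eq_add_mul_hadamardQuotient {O : Set E} (hO : IsOpen O) {s₀ : ℝ}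
    {Φ : E × ℝ → ℝ} (hΦ : ContDiffOn ℝ 1 Φ (O ×ˢ Ico 0 s₀)) {x : E} {s : ℝ} (hx : x ∈ O)
    (hs : s ∈ Ico 0 s₀) :
    Φ (x, s) = Φ (x, 0) + s * hadamardQuotient O s₀ Φ (x, s) := by
  have hs₀ : 0 < s₀ := hs.1.trans_lt hs.2
  have hCu : UniqueDiffOn ℝ (O ×ˢ Ico 0 s₀) := hO.uniqueDiffOn.prod (uniqueDiffOn_Ico 0 s₀)
  have hz : (x, s) ∈ O ×ˢ Ico 0 s₀ := ⟨hx, hs⟩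
  have hmaps : MapsTo (fun t : ℝ => scaleSnd E t (x, s)) (Icc 0 1) (O ×ˢ Ico 0 s₀) :=
    fun t ht => scaleSnd_mem ht hz
  have hpc : Continuous (fun t : ℝ => scaleSnd E t (x, s)) := by
    simp only [scaleSnd_apply]
    fun_prop
  have hg : ContinuousOn (fun z => fderivWithin ℝ Φ (O ×ˢ Ico 0 s₀) z (0, 1)) (O ×ˢ Ico 0 s₀) :=
    (hΦ.continuousOn_fderivWithin hCu le_rfl).clm_apply continuousOn_const
  have hpd : ∀ t : ℝ, HasDerivAt (fun t : ℝ => scaleSnd E t (x, s)) (s • ((0 : E), (1 : ℝ))) t := by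
    intro t
    have h2 : HasDerivAt (fun t : ℝ => t * s) s t := by
      simpa using (hasDerivAt_id t).mul_const s
    simpa [scaleSnd_apply] using (hasDerivAt_const t x).prodMk h2
  have key := intervalIntegral.integral_eq_sub_of_hasDerivAt_of_le (a := (0 : ℝ)) (b := 1)
    (f := fun t => Φ (scaleSnd E t (x, s)))
    (f' := fun t => s * fderivWithin ℝ Φ (O ×ˢ Ico 0 s₀) (scaleSnd E t (x, s)) (0, 1))
    zero_le_one (hΦ.continuousOn.comp hpc.continuousOn hmaps) (by
      intro t ht
      have h1 := (hΦ.differentiableOn one_ne_zero _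
        (hmaps (Ioo_subset_Icc_self ht))).hasFDerivWithinAt
      have h2 := h1.comp_hasDerivWithinAt t ((hpd t).hasDerivWithinAt (s := Ioo 0 1))
        (fun u hu => hmaps (Ioo_subset_Icc_self hu))
      have h3 := h2.hasDerivAt (Ioo_mem_nhds ht.1 ht.2)
      rw [map_smul] at h3
      exact h3)
    (by
      apply ContinuousOn.intervalIntegrable
      rw [uIcc_of_le zero_le_one]
      exact continuousOn_const.mul (hg.comp hpc.continuousOn hmaps))
  rw [intervalIntegral.integral_const_mul] at key
  rw [hadamardQuotient, key]
  simp [scaleSnd_apply]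

end Hadamard

/-! ### Functions of class `C^n` up to the boundary -/

section XDeriv

variable {E : Type} [NormedAddCommGroup E] [NormedSpace ℝ E]

/-- The derivative in the direction `v` of the first variable. -/
def xDeriv (v : E) (Φ : E × ℝ → ℝ) (z : E × ℝ) : ℝ := fderiv ℝ (fun x => Φ (x, z.2)) z.1 v

theorem hasFDerivAt_slice {O : Set E} (hO : IsOpen O) {I : Set ℝ} {Φ : E × ℝ → ℝ}
    (hΦ : DifferentiableOn ℝ Φ (O ×ˢ I)) {x : E} {s : ℝ} (hx : x ∈ O) (hs : s ∈ I) :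
    HasFDerivAt (fun x => Φ (x, s))
      ((fderivWithin ℝ Φ (O ×ˢ I) (x, s)).comp (ContinuousLinearMap.inl ℝ E ℝ)) x := by
  have h1 := (hΦ (x, s) ⟨hx, hs⟩).hasFDerivWithinAt
  have h2 : HasFDerivWithinAt (fun x : E => (x, s)) (ContinuousLinearMap.inl ℝ E ℝ) O x :=
    (hasFDerivAt_prodMk_left x s).hasFDerivWithinAt
  exact (HasFDerivWithinAt.comp (t := O ×ˢ I) x h1 h2 (fun w hw => ⟨hw, hs⟩)).hasFDerivAt (hO.mem_nhds hx)

theorem contDiffOn_xDeriv {O : Set E} (hO : IsOpen O) {s₀ : ℝ} {Φ : E × ℝ → ℝ}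
    {n : WithTop ℕ∞} (hΦ : ContDiffOn ℝ (n + 1) Φ (O ×ˢ Ico 0 s₀)) (v : E) :
    ContDiffOn ℝ n (xDeriv v Φ) (O ×ˢ Ico 0 s₀) := by
  have hCu : UniqueDiffOn ℝ (O ×ˢ Ico 0 s₀) := hO.uniqueDiffOn.prod (uniqueDiffOn_Ico 0 s₀)
  have h := (hΦ.fderivWithin (m := n) hCu le_rfl).clm_apply
    (contDiffOn_const (c := ((v, 0) : E × ℝ)))
  refine h.congr fun z hz => ?_
  rw [xDeriv, (hasFDerivAt_slice hO (hΦ.differentiableOn (by simp)) hz.1 hz.2).fderiv]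
  simp

theorem contDiffOn_slice {O : Set E} {I : Set ℝ} {Φ : E × ℝ → ℝ}
    {n : WithTop ℕ∞} (hΦ : ContDiffOn ℝ n Φ (O ×ˢ I)) {s : ℝ} (hs : s ∈ I) :
    ContDiffOn ℝ n (fun x => Φ (x, s)) O :=
  hΦ.comp (f := fun x : E => (x, s)) (by fun_prop) fun _ hx => ⟨hx, hs⟩

end XDeriv

variable {n : WithTop ℕ∞} {U : Set S2} {s₀ : ℝ} {φ ψ : S2 → ℝ → ℝ}

namespace SmoothUpToBoundary

theorem of_le {k : WithTop ℕ∞} (h : SmoothUpToBoundary n U s₀ φ) (hk : k ≤ n) :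
    SmoothUpToBoundary k U s₀ φ :=
  ContMDiffOn.of_le h hk

theorem add (h : SmoothUpToBoundary n U s₀ φ) (h' : SmoothUpToBoundary n U s₀ ψ) :
    SmoothUpToBoundary n U s₀ (fun y s => φ y s + ψ y s) :=
  smoothUpToBoundary_iff.2 (h.contDiffOn.add h'.contDiffOn)

theorem sub (h : SmoothUpToBoundary n U s₀ φ) (h' : SmoothUpToBoundary n U s₀ ψ) :
    SmoothUpToBoundary n U s₀ (fun y s => φ y s - ψ y s) :=
  smoothUpToBoundary_iff.2 (h.contDiffOn.sub h'.contDiffOn)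

theorem neg (h : SmoothUpToBoundary n U s₀ φ) :
    SmoothUpToBoundary n U s₀ (fun y s => -φ y s) :=
  smoothUpToBoundary_iff.2 h.contDiffOn.neg

theorem mul (h : SmoothUpToBoundary n U s₀ φ) (h' : SmoothUpToBoundary n U s₀ ψ) :
    SmoothUpToBoundary n U s₀ (fun y s => φ y s * ψ y s) :=
  smoothUpToBoundary_iff.2 (h.contDiffOn.mul h'.contDiffOn)

theorem pow (h : SmoothUpToBoundary n U s₀ φ) (k : ℕ) :
    SmoothUpToBoundary n U s₀ (fun y s => φ y s ^ k) :=
  smoothUpToBoundary_iff.2 (h.contDiffOn.pow k)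

theorem sqrt (h : SmoothUpToBoundary n U s₀ φ) (h0 : ∀ y ∈ U, ∀ s ∈ Ico 0 s₀, φ y s ≠ 0) :
    SmoothUpToBoundary n U s₀ (fun y s => Real.sqrt (φ y s)) :=
  smoothUpToBoundary_iff.2 (h.contDiffOn.sqrt fun _ hz => h0 _ hz.1.2 _ hz.2)

theorem div (h : SmoothUpToBoundary n U s₀ φ) (h' : SmoothUpToBoundary n U s₀ ψ)
    (h0 : ∀ y ∈ U, ∀ s ∈ Ico 0 s₀, ψ y s ≠ 0) :
    SmoothUpToBoundary n U s₀ (fun y s => φ y s / ψ y s) :=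
  smoothUpToBoundary_iff.2 (h.contDiffOn.div h'.contDiffOn fun _ hz => h0 _ hz.1.2 _ hz.2)

theorem sum {ι : Type} {t : Finset ι} {φ : ι → S2 → ℝ → ℝ}
    (h : ∀ i ∈ t, SmoothUpToBoundary n U s₀ (φ i)) :
    SmoothUpToBoundary n U s₀ (fun y s => ∑ i ∈ t, φ i y s) :=
  smoothUpToBoundary_iff.2 (ContDiffOn.sum fun i hi => (h i hi).contDiffOn)

theorem of_contDiff {g : ℝ → ℝ} (hg : ContDiff ℝ n g) :
    SmoothUpToBoundary n U s₀ (fun _ s => g s) :=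
  smoothUpToBoundary_iff.2 (hg.comp contDiff_snd).contDiffOn

theorem const (c : ℝ) : SmoothUpToBoundary n U s₀ (fun _ _ => c) := of_contDiff contDiff_const

/-- The restriction to a level set of `s`, extended constantly along rays. -/
theorem contDiffOn_radialExt (h : SmoothUpToBoundary n U s₀ φ) {s : ℝ} (hs : s ∈ Ico 0 s₀) :
    ContDiffOn ℝ n (radialExt fun y => φ y s) (cone U) :=
  contDiffOn_slice h.contDiffOn hs

theorem contDiffAt_radialExt (hU : IsOpen U) (h : SmoothUpToBoundary n U s₀ φ) {s : ℝ}
    (hs : s ∈ Ico 0 s₀) {y : S2} (hy : y ∈ U) :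
    ContDiffAt ℝ n (radialExt fun y => φ y s) (y : E3) :=
  (h.contDiffOn_radialExt hs).contDiffAt ((isOpen_cone hU).mem_nhds (coe_mem_cone hy))

theorem contDiffOn_fiber (h : SmoothUpToBoundary n U s₀ φ) {y : S2} (hy : y ∈ U) :
    ContDiffOn ℝ n (φ y) (Ico 0 s₀) := by
  have := h.contDiffOn.comp (f := fun s : ℝ => ((y : E3), s)) (s := Ico 0 s₀) (by fun_prop)
    fun s hs => ⟨coe_mem_cone hy, hs⟩
  simpa [Function.comp_def, radialLift, radialProj_coe] using this

end SmoothUpToBoundary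

theorem Ico_eventuallyEq_Ici {s : ℝ} (hs : s < s₀) : (Ico 0 s₀ : Set ℝ) =ᶠ[𝓝 s] Ici 0 := by
  filter_upwards [Iio_mem_nhds hs] with u hu
  apply propext
  exact ⟨fun h => h.1, fun h => ⟨h, hu⟩⟩

theorem sDeriv_one (φ : S2 → ℝ → ℝ) (y : S2) (s : ℝ) :
    sDeriv 1 φ y s = derivWithin (φ y) (Ici 0) s := by
  rw [sDeriv, iteratedDerivWithin_one]

theorem sDeriv_succ (k : ℕ) (φ : S2 → ℝ → ℝ) (y : S2) (s : ℝ) :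
    sDeriv (k + 1) φ y s = sDeriv k (sDeriv 1 φ) y s := by
  have : sDeriv 1 φ y = derivWithin (φ y) (Ici 0) := funext fun s => sDeriv_one φ y s
  rw [sDeriv, iteratedDerivWithin_succ', sDeriv, this]

theorem SmoothUpToBoundary.hasDerivWithinAt (h : SmoothUpToBoundary 1 U s₀ φ) {y : S2} (hy : y ∈ U)
    {s : ℝ} (hs : s ∈ Ico 0 s₀) : HasDerivWithinAt (φ y) (sDeriv 1 φ y s) (Ici 0) s := by
  have h1 := ((h.contDiffOn_fiber hy).differentiableOn one_ne_zero s hs)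
  rw [differentiableWithinAt_congr_set (Ico_eventuallyEq_Ici hs.2)] at h1
  rw [sDeriv_one]
  exact h1.hasDerivWithinAt

theorem SmoothUpToBoundary.hasDerivAt (h : SmoothUpToBoundary 1 U s₀ φ) {y : S2} (hy : y ∈ U)
    {s : ℝ} (hs : s ∈ Ioo 0 s₀) : HasDerivAt (φ y) (sDeriv 1 φ y s) s :=
  (h.hasDerivWithinAt hy (Ioo_subset_Ico_self hs)).hasDerivAt (Ici_mem_nhds hs.1)

theorem SmoothUpToBoundary.sDeriv_one (hU : IsOpen U) (h : SmoothUpToBoundary (n + 1) U s₀ φ) :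
    SmoothUpToBoundary n U s₀ (sDeriv 1 φ) := by
  have hCu : UniqueDiffOn ℝ (cone U ×ˢ Ico 0 s₀) :=
    (isOpen_cone hU).uniqueDiffOn.prod (uniqueDiffOn_Ico 0 s₀)
  have h1 := (h.contDiffOn.fderivWithin (m := n) hCu le_rfl).clm_apply
    (contDiffOn_const (c := ((0, 1) : E3 × ℝ)))
  refine (smoothUpToBoundary_of_contDiffOn h1).congr fun y hy s hs => ?_
  have hz : ((y : E3), s) ∈ cone U ×ˢ Ico 0 s₀ := ⟨coe_mem_cone hy, hs⟩
  have h2 := (h.contDiffOn.differentiableOn (by simp) _ hz).hasFDerivWithinAt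
  have h3 : HasDerivWithinAt (fun s : ℝ => ((y : E3), s)) ((0 : E3), (1 : ℝ)) (Ico 0 s₀) s :=
    (hasDerivWithinAt_const _ _ _).prodMk (hasDerivWithinAt_id _ _)
  have h4 := HasFDerivWithinAt.comp_hasDerivWithinAt (t := cone U ×ˢ Ico 0 s₀) s h2 h3
    (fun u hu => ⟨coe_mem_cone hy, hu⟩)
  have h5 : HasDerivWithinAt (φ y) (sDeriv 1 φ y s) (Ico 0 s₀) s :=
    ((h.of_le (by simp)).hasDerivWithinAt hy hs).mono Ico_subset_Ici_self
  have h6 : radialLift φ ∘ (fun s : ℝ => ((y : E3), s)) = φ y := by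
    funext u
    simp [radialLift, radialProj_coe]
  rw [h6] at h4
  exact (uniqueDiffOn_Ico 0 s₀ s hs).eq_deriv _ h5 h4

/-! ### The gradient and the Laplacian of the sphere -/

/-- The derivative along the `i`-th coordinate of the extension constant along rays. -/
def sphPartial (i : Fin 3) (f : S2 → ℝ) (y : S2) : ℝ :=
  fderiv ℝ (radialExt f) (y : E3) (EuclideanSpace.single i 1)

theorem sphGrad_apply (f : S2 → ℝ) (y : S2) (i : Fin 3) : sphGrad f y i = sphPartial i f y := by
  have h := InnerProductSpace.toDual_symm_apply (𝕜 := ℝ)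
    (x := EuclideanSpace.single i (1 : ℝ)) (y := fderiv ℝ (radialExt f) (y : E3))
  rw [EuclideanSpace.inner_single_right] at h
  simpa [sphGrad, gradient, sphPartial] using h

theorem sphInner_eq_sum (f k : S2 → ℝ) (y : S2) :
    sphInner f k y = ∑ i, sphPartial i f y * sphPartial i k y := by
  simp [sphInner, PiLp.inner_apply, sphGrad_apply, mul_comm]

theorem sphLap_eq_sum {f : S2 → ℝ} {y : S2} (hf : ContDiffAt ℝ 2 (radialExt f) (y : E3)) :
    sphLap f y = ∑ i : Fin 3, fderiv ℝ
      (fun x => fderiv ℝ (radialExt f) x (EuclideanSpace.single i 1)) (y : E3)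
      (EuclideanSpace.single i 1) := by
  rw [sphLap, InnerProductSpace.laplacian_eq_iteratedFDeriv_orthonormalBasis _
    (EuclideanSpace.basisFun (Fin 3) ℝ)]
  refine Finset.sum_congr rfl fun i _ => ?_
  have hd : DifferentiableAt ℝ (fderiv ℝ (radialExt f)) (y : E3) :=
    (hf.fderiv_right (m := 1) (by norm_num)).differentiableAt one_ne_zero
  rw [iteratedFDeriv_two_apply, fderiv_clm_apply hd (differentiableAt_const _)]
  simp

theorem SmoothUpToBoundary.sphPartial (hU : IsOpen U) (h : SmoothUpToBoundary (n + 1) U s₀ φ)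
    (i : Fin 3) : SmoothUpToBoundary n U s₀ (fun y s => sphPartial i (fun z => φ z s) y) :=
  smoothUpToBoundary_of_contDiffOn
    (contDiffOn_xDeriv (isOpen_cone hU) h.contDiffOn (EuclideanSpace.single i 1))

theorem SmoothUpToBoundary.sphInner (hU : IsOpen U) (h : SmoothUpToBoundary (n + 1) U s₀ φ)
    (h' : SmoothUpToBoundary (n + 1) U s₀ ψ) :
    SmoothUpToBoundary n U s₀ (fun y s => sphInner (fun z => φ z s) (fun z => ψ z s) y) := by
  simp only [sphInner_eq_sum]
  exact .sum fun i _ => (h.sphPartial hU i).mul (h'.sphPartial hU i)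

theorem SmoothUpToBoundary.sphGradSq (hU : IsOpen U) (h : SmoothUpToBoundary (n + 1) U s₀ φ) :
    SmoothUpToBoundary n U s₀ (fun y s => sphGradSq (fun z => φ z s) y) :=
  h.sphInner hU h

theorem SmoothUpToBoundary.sphLap (hU : IsOpen U) (h : SmoothUpToBoundary (n + 2) U s₀ φ) :
    SmoothUpToBoundary n U s₀ (fun y s => sphLap (fun z => φ z s) y) := by
  have h' : ContDiffOn ℝ ((n + 1) + 1) (radialLift φ) (cone U ×ˢ Ico 0 s₀) := by
    rw [add_assoc, one_add_one_eq_two]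
    exact h.contDiffOn
  have key : ContDiffOn ℝ n (fun z => ∑ i : Fin 3, xDeriv (EuclideanSpace.single i 1)
      (xDeriv (EuclideanSpace.single i 1) (radialLift φ)) z) (cone U ×ˢ Ico 0 s₀) :=
    ContDiffOn.sum fun i _ => contDiffOn_xDeriv (isOpen_cone hU)
      (contDiffOn_xDeriv (isOpen_cone hU) h' _) _
  refine (smoothUpToBoundary_of_contDiffOn key).congr fun y hy s hs => ?_
  exact sphLap_eq_sum ((h.contDiffAt_radialExt hU hs hy).of_le (by simp))

/-! ### Division by `s` -/

/-- The quotient `(φ(y, s) - φ(y, 0)) / s`, extended to `s = 0` (see `eq_add_mul_sQuot`). -/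
def sQuot (U : Set S2) (s₀ : ℝ) (φ : S2 → ℝ → ℝ) (y : S2) (s : ℝ) : ℝ :=
  hadamardQuotient (cone U) s₀ (radialLift φ) ((y : E3), s)

theorem SmoothUpToBoundary.sQuot (hU : IsOpen U) {n : ℕ∞}
    (h : SmoothUpToBoundary (n + 1) U s₀ φ) : SmoothUpToBoundary n U s₀ (sQuot U s₀ φ) :=
  smoothUpToBoundary_of_contDiffOn (contDiffOn_hadamardQuotient (isOpen_cone hU) h.contDiffOn)

theorem eq_add_mul_sQuot (hU : IsOpen U) (h : SmoothUpToBoundary 1 U s₀ φ) {y : S2} (hy : y ∈ U)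
    {s : ℝ} (hs : s ∈ Ico 0 s₀) : φ y s = φ y 0 + s * sQuot U s₀ φ y s := by
  simpa [radialLift, radialProj_coe, sQuot] using
    eq_add_mul_hadamardQuotient (isOpen_cone hU) h.contDiffOn (coe_mem_cone hy) hs

/-! ### Homogeneity of functions that are constant along rays -/

theorem fderiv_smul_of_homogeneous {F : E3 → ℝ} (hF : ∀ c : ℝ, 0 < c → ∀ x, F (c • x) = F x)
    {c : ℝ} (hc : 0 < c) (x : E3) : fderiv ℝ F (c • x) = c⁻¹ • fderiv ℝ F x := by
  have h1 : (fun x => F (c • x)) = F := funext fun x => hF c hc x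
  have h2 : fderiv ℝ F x = c • fderiv ℝ F (c • x) := by
    conv_lhs => rw [← h1]
    exact fderiv_comp_smul c
  rw [h2, smul_smul, inv_mul_cancel₀ hc.ne', one_smul]

/-- If `F` is not differentiable at `p` this holds because its `fderiv` is then zero. -/
theorem fderiv_apply_eq_zero_of_line {V : Type} [NormedAddCommGroup V] [NormedSpace ℝ V]
    {F : V → ℝ} {p v : V} (h : (fun t : ℝ => F (p + t • v)) =ᶠ[𝓝 0] fun _ => F p) :
    fderiv ℝ F p v = 0 := by
  by_cases hd : DifferentiableAt ℝ F p
  · have h1 : HasDerivAt (fun t : ℝ => F (p + t • v)) (fderiv ℝ F p v) 0 :=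
      hd.hasFDerivAt.hasLineDerivAt v
    have h2 : HasDerivAt (fun t : ℝ => F (p + t • v)) 0 0 :=
      (hasDerivAt_const (0 : ℝ) (F p)).congr_of_eventuallyEq h
    exact h1.unique h2
  · rw [fderiv_zero_of_not_differentiableAt hd]
    rfl

/-- Euler's relation in degree zero. -/
theorem fderiv_self_eq_zero_of_homogeneous {F : E3 → ℝ}
    (hF : ∀ c : ℝ, 0 < c → ∀ x, F (c • x) = F x) (x : E3) : fderiv ℝ F x x = 0 := by
  apply fderiv_apply_eq_zero_of_line
  filter_upwards [Ioi_mem_nhds (show (-1 : ℝ) < 0 by norm_num)] with t ht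
  have ht' : (-1 : ℝ) < t := ht
  have : x + t • x = (1 + t) • x := by rw [add_smul, one_smul]
  rw [this, hF _ (by linarith)]

theorem sum_coord_smul_single (x : E3) :
    ∑ i : Fin 3, x i • (EuclideanSpace.single i (1 : ℝ) : E3) = x := by
  ext j
  fin_cases j <;> simp [Fin.sum_univ_three]

theorem sum_coord_mul_apply (l : E3 →L[ℝ] ℝ) (x : E3) :
    ∑ i : Fin 3, x i * l (EuclideanSpace.single i 1) = l x := by
  conv_rhs => rw [← sum_coord_smul_single x]
  simp [map_sum]

theorem radialLift_smul (φ : S2 → ℝ → ℝ) {c : ℝ} (hc : 0 < c) (x : E3) (s : ℝ) :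
    radialLift φ (c • x, s) = radialLift φ (x, s) := by
  simp [radialLift, radialProj_smul hc]

theorem xDeriv_radialLift_smul (φ : S2 → ℝ → ℝ) (v : E3) {c : ℝ} (hc : 0 < c) (x : E3) (s : ℝ) :
    xDeriv v (radialLift φ) (c • x, s) = c⁻¹ * xDeriv v (radialLift φ) (x, s) := by
  have := fderiv_smul_of_homogeneous (F := fun x => radialLift φ (x, s))
    (fun c hc x => radialLift_smul φ hc x s) hc x
  simp only [xDeriv]
  rw [this]
  simp

theorem xDeriv_xDeriv_radialLift_smul (φ : S2 → ℝ → ℝ) (v w : E3) {c : ℝ} (hc : 0 < c)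
    (x : E3) (s : ℝ) : xDeriv w (xDeriv v (radialLift φ)) (c • x, s) =
      (c ^ 2)⁻¹ * xDeriv w (xDeriv v (radialLift φ)) (x, s) := by
  have h1 : (fun x => xDeriv v (radialLift φ) (c • x, s)) =
      c⁻¹ • fun x => xDeriv v (radialLift φ) (x, s) :=
    funext fun x => xDeriv_radialLift_smul φ v hc x s
  have h2 : fderiv ℝ (fun x => xDeriv v (radialLift φ) (c • x, s)) x =
      c • fderiv ℝ (fun x => xDeriv v (radialLift φ) (x, s)) (c • x) :=
    fderiv_comp_smul (f := fun x => xDeriv v (radialLift φ) (x, s)) c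
  rw [h1, fderiv_const_smul_field] at h2
  have h3 := congrArg (fun l : E3 →L[ℝ] ℝ => l w) h2
  simp only [Pi.smul_apply, _root_.smul_apply, smul_eq_mul] at h3
  change fderiv ℝ (fun x => xDeriv v (radialLift φ) (x, s)) (c • x) w =
    (c ^ 2)⁻¹ * fderiv ℝ (fun x => xDeriv v (radialLift φ) (x, s)) x w
  field_simp at h3 ⊢
  linarith

theorem sphPartial_radialProj (φ : S2 → ℝ → ℝ) (i : Fin 3) {x : E3} (hx : x ≠ 0) (s : ℝ) :
    sphPartial i (fun z => φ z s) (radialProj x) =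
      ‖x‖ * xDeriv (EuclideanSpace.single i 1) (radialLift φ) (x, s) := by
  have hn : 0 < ‖x‖⁻¹ := inv_pos.2 (norm_pos_iff.2 hx)
  have := xDeriv_radialLift_smul φ (EuclideanSpace.single i 1) hn x s
  rw [inv_inv] at this
  rw [← this, ← coe_radialProj hx]
  rfl

theorem sum_coord_mul_xDeriv (φ : S2 → ℝ → ℝ) (x : E3) (s : ℝ) :
    ∑ i : Fin 3, x i * xDeriv (EuclideanSpace.single i 1) (radialLift φ) (x, s) = 0 := by
  simp only [xDeriv]
  rw [sum_coord_mul_apply]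
  exact fderiv_self_eq_zero_of_homogeneous (fun c hc x => radialLift_smul φ hc x s) x

theorem sum_sq_coord (x : E3) : ∑ i : Fin 3, x i * x i = ‖x‖ ^ 2 := by
  rw [EuclideanSpace.norm_sq_eq]
  simp [pow_two]

/-! ### A divergence in Euclidean space -/

theorem hasFDerivAt_norm_of_ne_zero {x : E3} (hx : x ≠ 0) :
    HasFDerivAt (fun x : E3 => ‖x‖) (‖x‖⁻¹ • innerSL ℝ x) x := by
  have h := (hasStrictFDerivAt_norm_sq x).hasFDerivAt.sqrt (by positivity)
  simp only [Real.sqrt_sq (norm_nonneg _)] at h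
  convert! h using 1
  ext v
  have : ‖x‖ ≠ 0 := by positivity
  simp
  field_simp

theorem hasFDerivAt_norm_inv {x : E3} (hx : x ≠ 0) :
    HasFDerivAt (fun x : E3 => ‖x‖⁻¹) (-(‖x‖⁻¹ ^ 3) • innerSL ℝ x) x := by
  have h2 := (hasDerivAt_inv (norm_ne_zero_iff.2 hx)).comp_hasFDerivAt x (hasFDerivAt_norm_of_ne_zero hx)
  convert! h2 using 1
  ext v
  simp
  ring

theorem hasFDerivAt_comp_norm_inv {Φ : E3 × ℝ → ℝ} {x : E3} (hx : x ≠ 0)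
    (hΦ : DifferentiableAt ℝ Φ (x, ‖x‖⁻¹)) :
    HasFDerivAt (fun x => Φ (x, ‖x‖⁻¹))
      ((fderiv ℝ (fun x' => Φ (x', ‖x‖⁻¹)) x) -
        (‖x‖⁻¹ ^ 3 * deriv (fun s => Φ (x, s)) ‖x‖⁻¹) • innerSL ℝ x) x := by
  have h1 : HasFDerivAt (fun x : E3 => (x, ‖x‖⁻¹))
      ((ContinuousLinearMap.id ℝ E3).prod (-(‖x‖⁻¹ ^ 3) • innerSL ℝ x)) x :=
    (hasFDerivAt_id x).prodMk (hasFDerivAt_norm_inv hx)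
  have h2 := hΦ.hasFDerivAt.comp (f := fun x : E3 => (x, ‖x‖⁻¹)) x h1
  have h3 : HasFDerivAt (fun x' => Φ (x', ‖x‖⁻¹))
      ((fderiv ℝ Φ (x, ‖x‖⁻¹)).comp (ContinuousLinearMap.inl ℝ E3 ℝ)) x :=
    hΦ.hasFDerivAt.comp (f := fun x' : E3 => (x', ‖x‖⁻¹)) x (hasFDerivAt_prodMk_left x _)
  have h4 : HasDerivAt (fun s => Φ (x, s)) (fderiv ℝ Φ (x, ‖x‖⁻¹) (0, 1)) ‖x‖⁻¹ :=
    hΦ.hasFDerivAt.comp_hasDerivAt (f := fun s : ℝ => (x, s)) _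
      ((hasDerivAt_const _ x).prodMk (hasDerivAt_id _))
  convert! h2 using 1
  rw [h3.fderiv, h4.deriv]
  ext v
  have : ((v, -(‖x‖⁻¹ ^ 3 * inner ℝ x v)) : E3 × ℝ) =
      (v, 0) + (-(‖x‖⁻¹ ^ 3 * inner ℝ x v)) • ((0 : E3), (1 : ℝ)) := by simp
  simp only [_root_.sub_apply, ContinuousLinearMap.comp_apply,
    ContinuousLinearMap.inl_apply, _root_.smul_apply, innerSL_apply_apply,
    smul_eq_mul, ContinuousLinearMap.prod_apply, ContinuousLinearMap.id_apply, neg_mul]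
  rw [this, map_add, map_smul, smul_eq_mul]
  ring

theorem inner_single (x : E3) (i : Fin 3) : inner ℝ x (EuclideanSpace.single i (1 : ℝ)) = x i := by
  simp [EuclideanSpace.inner_single_right]

/-- The divergence of a vector field written with a radial part `x α` and a part `|x| V` orthogonal
to the position vector, both given as functions of `(x, |x|⁻¹)`. -/
theorem sum_fderiv_radial_sub_tangential {α : E3 × ℝ → ℝ} {V : Fin 3 → E3 × ℝ → ℝ} {x : E3}
    (hx : x ≠ 0) (hα : DifferentiableAt ℝ α (x, ‖x‖⁻¹))
    (hV : ∀ i, DifferentiableAt ℝ (V i) (x, ‖x‖⁻¹))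
    (hα0 : ∀ c : ℝ, 0 < c → ∀ x s, α (c • x, s) = α (x, s))
    (hV0 : ∀ s, ∑ i, x i * V i (x, s) = 0) :
    (∀ i, DifferentiableAt ℝ (fun x => x i * α (x, ‖x‖⁻¹) - ‖x‖ * V i (x, ‖x‖⁻¹)) x) ∧
    ∑ i : Fin 3, fderiv ℝ (fun x => x i * α (x, ‖x‖⁻¹) - ‖x‖ * V i (x, ‖x‖⁻¹)) x
        (EuclideanSpace.single i 1) =
      3 * α (x, ‖x‖⁻¹) - ‖x‖⁻¹ * deriv (fun s => α (x, s)) ‖x‖⁻¹ -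
        ‖x‖ * ∑ i, xDeriv (EuclideanSpace.single i 1) (V i) (x, ‖x‖⁻¹) := by
  have hn : ‖x‖ ≠ 0 := norm_ne_zero_iff.2 hx
  have hcoord : ∀ i : Fin 3, HasFDerivAt (fun x : E3 => x i) (EuclideanSpace.proj i : E3 →L[ℝ] ℝ) x :=
    fun i => (EuclideanSpace.proj i : E3 →L[ℝ] ℝ).hasFDerivAt
  have hd := fun i => ((hcoord i).mul (hasFDerivAt_comp_norm_inv hx hα)).sub
    ((hasFDerivAt_norm_of_ne_zero hx).mul (hasFDerivAt_comp_norm_inv hx (hV i)))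
  refine ⟨fun i => (hd i).differentiableAt, ?_⟩
  have hterm : ∀ i : Fin 3, fderiv ℝ (fun x => x i * α (x, ‖x‖⁻¹) - ‖x‖ * V i (x, ‖x‖⁻¹)) x
        (EuclideanSpace.single i 1) =
      x i * fderiv ℝ (fun x' => α (x', ‖x‖⁻¹)) x (EuclideanSpace.single i 1)
      - ‖x‖⁻¹ ^ 3 * deriv (fun s => α (x, s)) ‖x‖⁻¹ * (x i * x i) + α (x, ‖x‖⁻¹)
      - ‖x‖ * xDeriv (EuclideanSpace.single i 1) (V i) (x, ‖x‖⁻¹)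
      + ‖x‖ * ‖x‖⁻¹ ^ 3 * (x i * deriv (fun s => V i (x, s)) ‖x‖⁻¹)
      - ‖x‖⁻¹ * (x i * V i (x, ‖x‖⁻¹)) := by
    intro i
    have := (hd i).fderiv
    refine (congrArg (fun l : E3 →L[ℝ] ℝ => l (EuclideanSpace.single i 1)) this).trans ?_
    simp only [_root_.sub_apply, _root_.add_apply,
      _root_.smul_apply, innerSL_apply_apply, inner_single, smul_eq_mul, xDeriv]
    simp
    ring
  have hVs : ∑ i, x i * deriv (fun s => V i (x, s)) ‖x‖⁻¹ = 0 := by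
    have h4 : ∀ i, HasDerivAt (fun s => V i (x, s)) (deriv (fun s => V i (x, s)) ‖x‖⁻¹) ‖x‖⁻¹ :=
      fun i => (((hV i).comp (f := fun s : ℝ => (x, s)) ‖x‖⁻¹ (by fun_prop))).hasDerivAt
    have h5 := HasDerivAt.fun_sum (u := Finset.univ) fun i _ => (h4 i).const_mul (x i)
    simp only [hV0] at h5
    exact h5.unique (hasDerivAt_const _ _)
  have hαx : ∑ i : Fin 3, x i * fderiv ℝ (fun x' => α (x', ‖x‖⁻¹)) x (EuclideanSpace.single i 1) = 0 := by
    rw [sum_coord_mul_apply]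
    exact fderiv_self_eq_zero_of_homogeneous (fun c hc x => hα0 c hc x _) x
  simp only [hterm, Finset.sum_add_distrib, Finset.sum_sub_distrib, ← Finset.mul_sum, hVs, hαx,
    hV0, sum_sq_coord]
  simp
  field_simp
  ring

/-! ### The Schwarzschild metric and graphs -/

namespace Schwarzschild

/-- The projection to the spatial coordinates, as a continuous linear map. -/
def spaceCLM : (Idx → ℝ) →L[ℝ] E3 :=
  (EuclideanSpace.equiv (Fin 3) ℝ).symm.toContinuousLinearMap.comp
    (ContinuousLinearMap.pi fun i => ContinuousLinearMap.proj (Sum.inr i))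

theorem spaceCLM_apply (p : Idx → ℝ) : spaceCLM p = space p := rfl

theorem spaceCLM_single_inl : spaceCLM (Pi.single (Sum.inl ()) 1) = 0 := by
  ext i
  simp [spaceCLM_apply, space]

theorem spaceCLM_single_inr (i : Fin 3) :
    spaceCLM (Pi.single (Sum.inr i) 1) = EuclideanSpace.single i 1 := by
  ext j
  simp [spaceCLM_apply, space, Pi.single_apply]

theorem space_point (t : ℝ) (x : E3) : space (point t x) = x := by
  ext i
  simp [space, point]

theorem sum_unit_sq {x : E3} (hx : x ≠ 0) : ∑ i, (x i / ‖x‖) * (x i / ‖x‖) = 1 := by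
  have h := sum_sq_coord x
  have : ‖x‖ ≠ 0 := norm_ne_zero_iff.2 hx
  rw [Fin.sum_univ_three] at h ⊢
  field_simp
  linarith

/-- The inverse metric `-h⁻¹ ∂ₜ² + |∂ₓ|² + (h - 1) ∂ᵣ²`, as a matrix. -/
def inverseMetric (m : ℝ) (p : Idx → ℝ) : Matrix Idx Idx ℝ :=
  Matrix.fromBlocks
    (Matrix.of fun _ _ => -(lapse m ‖space p‖)⁻¹) 0 0
    (Matrix.of fun i j => (if i = j then 1 else 0) +
      (lapse m ‖space p‖ - 1) * (space p i / ‖space p‖) * (space p j / ‖space p‖))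

theorem one_add_smul_mul_one_add_smul {ξ : Fin 3 → ℝ} (hξ : ∑ i, ξ i * ξ i = 1) {h : ℝ}
    (hh : h ≠ 0) :
    (Matrix.of fun i j => (if i = j then (1 : ℝ) else 0) + (h⁻¹ - 1) * ξ i * ξ j) *
      (Matrix.of fun i j => (if i = j then (1 : ℝ) else 0) + (h - 1) * ξ i * ξ j) =
      (1 : Matrix (Fin 3) (Fin 3) ℝ) := by
  have e : (h⁻¹ - 1) + (h - 1) + (h⁻¹ - 1) * (h - 1) = 0 := by field_simp; ring
  ext i j
  have h1 : ∀ k, ((if i = k then (1 : ℝ) else 0) + (h⁻¹ - 1) * ξ i * ξ k) *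
      ((if k = j then (1 : ℝ) else 0) + (h - 1) * ξ k * ξ j) =
      (if i = k then (if k = j then (1 : ℝ) else 0) else 0) +
      (if i = k then (h - 1) * ξ k * ξ j else 0) +
      (if k = j then (h⁻¹ - 1) * ξ i * ξ k else 0) +
      ((h⁻¹ - 1) * (h - 1) * ξ i * ξ j) * (ξ k * ξ k) := by
    intro k
    split_ifs <;> ring
  simp only [Matrix.mul_apply, Matrix.of_apply, h1, Finset.sum_add_distrib, ← Finset.mul_sum, hξ,
    Finset.sum_ite_eq, Finset.sum_ite_eq', Finset.mem_univ, if_true, Matrix.one_apply]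
  linear_combination (ξ i * ξ j) * e

theorem inv_metric {m : ℝ} {p : Idx → ℝ} (hx : space p ≠ 0) (hh : lapse m ‖space p‖ ≠ 0) :
    (metric m p)⁻¹ = inverseMetric m p := by
  apply Matrix.inv_eq_right_inv
  rw [metric, inverseMetric, Matrix.fromBlocks_multiply, ← Matrix.fromBlocks_one]
  congr 1
  · ext i j
    simp [Matrix.mul_apply, hh]
  · simp
  · simp
  · rw [Matrix.zero_mul, zero_add,
      one_add_smul_mul_one_add_smul (ξ := fun i => space p i / ‖space p‖) (sum_unit_sq hx) hh]

theorem det_metric {m : ℝ} {p : Idx → ℝ} (hx : space p ≠ 0) (hh : lapse m ‖space p‖ ≠ 0) :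
    (metric m p).det = -1 := by
  have hu := sum_unit_sq hx
  rw [Fin.sum_univ_three] at hu
  rw [metric, Matrix.det_fromBlocks_zero₂₁, Matrix.det_fin_three]
  simp only [Matrix.det_unique, Matrix.of_apply, Fin.isValue, if_true]
  set h := lapse m ‖space p‖
  set a := space p 0 / ‖space p‖
  set b := space p 1 / ‖space p‖
  set c := space p 2 / ‖space p‖
  have e : h * (h⁻¹ - 1) = 1 - h := by field_simp
  simp
  linear_combination e + (h * (h⁻¹ - 1)) * hu

theorem hasDerivAt_tortoise {m r : ℝ} (hm : 0 ≤ m) (hr : 2 * m < r) :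
    HasDerivAt (tortoise m) (lapse m r)⁻¹ r := by
  have hr0 : 0 < r := by linarith
  rcases hm.eq_or_lt with rfl | hm
  · have : tortoise 0 = fun r => r := by
      funext r
      simp [tortoise]
    rw [this]
    simpa [lapse] using hasDerivAt_id' r
  · have h2m : (2 * m) ≠ 0 := by positivity
    have hlin : HasDerivAt (fun r : ℝ => r / (2 * m) - 1) (1 / (2 * m)) r :=
      ((hasDerivAt_id r).div_const (2 * m)).sub_const 1
    have hpos : 0 < r / (2 * m) - 1 := by
      have : 1 < r / (2 * m) := (one_lt_div (by positivity)).2 hr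
      linarith
    have h1 := (hasDerivAt_id r).add ((hlin.log hpos.ne').const_mul (2 * m))
    have h2 : tortoise m = fun r => r + 2 * m * Real.log (r / (2 * m) - 1) := by
      funext r
      simp [tortoise, Real.log_abs]
    rw [h2]
    convert! h1 using 1
    have h3 : r - 2 * m ≠ 0 := by linarith
    have h4 : r / (2 * m) - 1 = (r - 2 * m) / (2 * m) := by field_simp
    have h5 : lapse m r = (r - 2 * m) / r := by
      rw [lapse]
      field_simp
    rw [h4, h5]
    field_simp
    ring

theorem lapse_pos {m r : ℝ} (hm : 0 ≤ m) (hr : 2 * m < r) : 0 < lapse m r := by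
  have hr0 : 0 < r := by linarith
  rw [lapse, sub_pos, div_lt_one hr0]
  exact hr

/-- The part of space over `U × (0, s₀)`. -/
def exteriorCone (U : Set S2) (s₀ : ℝ) : Set E3 := {x | x ∈ cone U ∧ ‖x‖⁻¹ < s₀}

variable {U : Set S2} {s₀ : ℝ} {m : ℝ} {P : S2 → ℝ → ℝ}

theorem isOpen_exteriorCone (hU : IsOpen U) : IsOpen (exteriorCone U s₀) := by
  rw [isOpen_iff_mem_nhds]
  intro x hx
  have h1 : Tendsto (fun x : E3 => ‖x‖⁻¹) (𝓝 x) (𝓝 ‖x‖⁻¹) :=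
    tendsto_norm.inv₀ (norm_ne_zero_iff.2 hx.1.1)
  filter_upwards [(isOpen_cone hU).mem_nhds hx.1, h1.eventually (gt_mem_nhds hx.2)] with z h2 h3
  exact ⟨h2, h3⟩

theorem norm_inv_mem {x : E3} (hx : x ∈ exteriorCone U s₀) : ‖x‖⁻¹ ∈ Ioo 0 s₀ :=
  ⟨inv_pos.2 (norm_pos_iff.2 hx.1.1), hx.2⟩

theorem two_mul_lt_norm (hm : 0 ≤ m) (hms : 2 * m * s₀ ≤ 1) {x : E3}
    (hx : x ∈ exteriorCone U s₀) : 2 * m < ‖x‖ := by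
  have h1 := norm_inv_mem hx
  have hn : 0 < ‖x‖ := norm_pos_iff.2 hx.1.1
  have h3 : 2 * m * ‖x‖⁻¹ < 1 := by
    rcases hm.eq_or_lt with rfl | hm
    · simp
    · have : 2 * m * ‖x‖⁻¹ < 2 * m * s₀ := by
        apply mul_lt_mul_of_pos_left h1.2 (by positivity)
      linarith
  rw [← div_eq_mul_inv, div_lt_one hn] at h3
  exact h3

theorem lapse_norm_pos (hm : 0 ≤ m) (hms : 2 * m * s₀ ≤ 1) {x : E3}
    (hx : x ∈ exteriorCone U s₀) : 0 < lapse m ‖x‖ :=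
  lapse_pos hm (two_mul_lt_norm hm hms hx)

theorem position_mem {y : S2} (hy : y ∈ U) {s : ℝ} (hs : s ∈ Ioo 0 s₀) :
    position y s ∈ exteriorCone U s₀ := by
  refine ⟨smul_mem_cone (inv_pos.2 hs.1) (coe_mem_cone hy), ?_⟩
  rw [position, norm_smul, norm_coe_S2, mul_one, Real.norm_of_nonneg (inv_pos.2 hs.1).le, inv_inv]
  exact hs.2

theorem norm_position (y : S2) {s : ℝ} (hs : 0 < s) : ‖position y s‖ = s⁻¹ := by
  rw [position, norm_smul, norm_coe_S2, mul_one, Real.norm_of_nonneg (inv_pos.2 hs).le]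

theorem radialProj_position (y : S2) {s : ℝ} (hs : 0 < s) : radialProj (position y s) = y := by
  rw [position, radialProj_smul (inv_pos.2 hs), radialProj_coe]

/-- Smoothness of the lift in the interior. -/
theorem _root_.SmoothUpToBoundary.contDiffAt {n : WithTop ℕ∞} {φ : S2 → ℝ → ℝ}
    (hU : IsOpen U) (h : SmoothUpToBoundary n U s₀ φ) {z : E3 × ℝ} (hz : z.1 ∈ cone U)
    (hs : z.2 ∈ Ioo 0 s₀) : ContDiffAt ℝ n (radialLift φ) z := by
  refine h.contDiffOn.contDiffAt ?_
  refine mem_of_superset (((isOpen_cone hU).prod isOpen_Ioo).mem_nhds ⟨hz, hs⟩) ?_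
  exact prod_mono subset_rfl Ioo_subset_Ico_self

theorem deriv_radialLift (hP : SmoothUpToBoundary 1 U s₀ P) {z : E3 × ℝ} (hz : z.1 ∈ cone U)
    (hs : z.2 ∈ Ioo 0 s₀) :
    deriv (fun s => radialLift P (z.1, s)) z.2 = sDeriv 1 P (radialProj z.1) z.2 :=
  (hP.hasDerivAt hz.2 hs).deriv

theorem hasFDerivAt_height (hm : 0 ≤ m) (hms : 2 * m * s₀ ≤ 1) (hU : IsOpen U)
    (hP : SmoothUpToBoundary 1 U s₀ P) {x : E3} (hx : x ∈ exteriorCone U s₀) :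
    HasFDerivAt (height m P)
      ((‖x‖⁻¹ * ((lapse m ‖x‖)⁻¹ + ‖x‖⁻¹ ^ 2 * sDeriv 1 P (radialProj x) ‖x‖⁻¹)) • innerSL ℝ x -
        fderiv ℝ (fun x' => radialLift P (x', ‖x‖⁻¹)) x) x := by
  have h1 := (hasDerivAt_tortoise hm (two_mul_lt_norm hm hms hx)).comp_hasFDerivAt x
    (hasFDerivAt_norm_of_ne_zero hx.1.1)
  have h2 := hasFDerivAt_comp_norm_inv hx.1.1
    ((hP.contDiffAt hU (z := (x, ‖x‖⁻¹)) hx.1 (norm_inv_mem hx)).differentiableAt one_ne_zero)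
  rw [deriv_radialLift hP (z := (x, ‖x‖⁻¹)) hx.1 (norm_inv_mem hx)] at h2
  have h3 := h1.sub h2
  convert! h3 using 1
  ext v
  simp
  ring

/-- The derivative of the height function in a coordinate direction. -/
theorem fderiv_height_single (hm : 0 ≤ m) (hms : 2 * m * s₀ ≤ 1) (hU : IsOpen U)
    (hP : SmoothUpToBoundary 1 U s₀ P) {x : E3} (hx : x ∈ exteriorCone U s₀) (i : Fin 3) :
    fderiv ℝ (height m P) x (EuclideanSpace.single i 1) =
      (x i / ‖x‖) * ((lapse m ‖x‖)⁻¹ + ‖x‖⁻¹ ^ 2 * sDeriv 1 P (radialProj x) ‖x‖⁻¹) -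
        xDeriv (EuclideanSpace.single i 1) (radialLift P) (x, ‖x‖⁻¹) := by
  rw [(hasFDerivAt_height hm hms hU hP hx).fderiv]
  simp [xDeriv, EuclideanSpace.inner_single_right]
  ring

theorem hasFDerivAt_definingFun (hm : 0 ≤ m) (hms : 2 * m * s₀ ≤ 1) (hU : IsOpen U)
    (hP : SmoothUpToBoundary 1 U s₀ P) {p : Idx → ℝ} (hx : space p ∈ exteriorCone U s₀) :
    HasFDerivAt (definingFun m P)
      ((fderiv ℝ (height m P) (space p)).comp spaceCLM -
        ContinuousLinearMap.proj (Sum.inl ())) p := by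
  have h1 : HasFDerivAt (fun p => height m P (space p))
      ((fderiv ℝ (height m P) (space p)).comp spaceCLM) p :=
    HasFDerivAt.comp (g := height m P) p
      (hasFDerivAt_height hm hms hU hP hx).differentiableAt.hasFDerivAt spaceCLM.hasFDerivAt
  exact h1.sub (ContinuousLinearMap.proj (R := ℝ) (φ := fun _ : Idx => ℝ)
    (Sum.inl ())).hasFDerivAt

theorem pderiv_definingFun_inl (hm : 0 ≤ m) (hms : 2 * m * s₀ ≤ 1) (hU : IsOpen U)
    (hP : SmoothUpToBoundary 1 U s₀ P) {p : Idx → ℝ} (hx : space p ∈ exteriorCone U s₀) :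
    CoordGeometry.pderiv (definingFun m P) (Sum.inl ()) p = -1 := by
  rw [CoordGeometry.pderiv, (hasFDerivAt_definingFun hm hms hU hP hx).fderiv]
  simp [spaceCLM_single_inl]

theorem pderiv_definingFun_inr (hm : 0 ≤ m) (hms : 2 * m * s₀ ≤ 1) (hU : IsOpen U)
    (hP : SmoothUpToBoundary 1 U s₀ P) {p : Idx → ℝ} (hx : space p ∈ exteriorCone U s₀)
    (i : Fin 3) :
    CoordGeometry.pderiv (definingFun m P) (Sum.inr i) p =
      fderiv ℝ (height m P) (space p) (EuclideanSpace.single i 1) := by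
  rw [CoordGeometry.pderiv, (hasFDerivAt_definingFun hm hms hU hP hx).fderiv]
  simp [spaceCLM_single_inr]

/-- `1 + s² (1 - 2ms) P_s`, which is `⟨∇s, ∇(v̄ + P)⟩` for the unphysical metric. -/
def radialFactor (m : ℝ) (P : S2 → ℝ → ℝ) (y : S2) (s : ℝ) : ℝ :=
  1 + s ^ 2 * (1 - 2 * m * s) * sDeriv 1 P y s

theorem sum_unit_mul_xDeriv (φ : S2 → ℝ → ℝ) (x : E3) (s : ℝ) :
    ∑ i : Fin 3, (x i / ‖x‖) * xDeriv (EuclideanSpace.single i 1) (radialLift φ) (x, s) = 0 := by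
  have := sum_coord_mul_xDeriv φ x s
  rw [Fin.sum_univ_three] at this ⊢
  linear_combination ‖x‖⁻¹ * this

theorem sphGradSq_radialProj {x : E3} (hx : x ≠ 0) (φ : S2 → ℝ → ℝ) (s : ℝ) :
    sphGradSq (fun z => φ z s) (radialProj x) =
      ‖x‖ ^ 2 * ∑ i : Fin 3, xDeriv (EuclideanSpace.single i 1) (radialLift φ) (x, s) ^ 2 := by
  rw [sphGradSq, sphInner_eq_sum, Finset.mul_sum]
  refine Finset.sum_congr rfl fun i _ => ?_
  rw [sphPartial_radialProj φ i hx]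
  ring

theorem lapse_mul_inv_sq {x : E3} : ‖x‖⁻¹ ^ 2 * (1 - 2 * m * ‖x‖⁻¹) =
    ‖x‖⁻¹ ^ 2 * lapse m ‖x‖ := by
  rw [lapse]
  ring

/-- The spatial components of the gradient of the defining function. -/
theorem grad_definingFun_inr (hm : 0 ≤ m) (hms : 2 * m * s₀ ≤ 1) (hU : IsOpen U)
    (hP : SmoothUpToBoundary 1 U s₀ P) {p : Idx → ℝ} (hx : space p ∈ exteriorCone U s₀)
    (i : Fin 3) :
    CoordGeometry.grad (metric m) (definingFun m P) p (Sum.inr i) =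
      (space p i / ‖space p‖) * radialFactor m P (radialProj (space p)) ‖space p‖⁻¹ -
        xDeriv (EuclideanSpace.single i 1) (radialLift P) (space p, ‖space p‖⁻¹) := by
  have hh := lapse_norm_pos hm hms hx
  rw [CoordGeometry.grad, inv_metric hx.1.1 hh.ne', inverseMetric, radialFactor, lapse_mul_inv_sq]
  simp only [Fintype.sum_sum_type, Matrix.fromBlocks_apply₂₁, Matrix.fromBlocks_apply₂₂,
    Matrix.zero_apply, zero_mul, Finset.sum_const_zero, zero_add, Matrix.of_apply, add_mul,
    pderiv_definingFun_inr hm hms hU hP hx, fderiv_height_single hm hms hU hP hx,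
    Finset.sum_add_distrib, ite_mul, one_mul, Finset.sum_ite_eq, Finset.mem_univ, if_true]
  have h1 := sum_unit_mul_xDeriv P (space p) ‖space p‖⁻¹
  have h2 := sum_unit_sq hx.1.1
  set h := lapse m ‖space p‖
  rw [Fin.sum_univ_three] at h1 h2 ⊢
  have e : h * h⁻¹ = 1 := mul_inv_cancel₀ hh.ne'
  set Q := sDeriv 1 P (radialProj (space p)) ‖space p‖⁻¹
  linear_combination (-(h - 1) * (space p i / ‖space p‖)) * h1 +
    ((h - 1) * (space p i / ‖space p‖) * (h⁻¹ + ‖space p‖⁻¹ ^ 2 * Q)) * h2 +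
    (space p i / ‖space p‖) * e

theorem grad_definingFun_inl (hm : 0 ≤ m) (hms : 2 * m * s₀ ≤ 1) (hU : IsOpen U)
    (hP : SmoothUpToBoundary 1 U s₀ P) {p : Idx → ℝ} (hx : space p ∈ exteriorCone U s₀) :
    CoordGeometry.grad (metric m) (definingFun m P) p (Sum.inl ()) =
      (lapse m ‖space p‖)⁻¹ := by
  rw [CoordGeometry.grad, inv_metric hx.1.1 (lapse_norm_pos hm hms hx).ne', inverseMetric]
  simp [pderiv_definingFun_inl hm hms hU hP hx]

/-- The conformal rescaling `s² g` divides the squared length of a differential by `s²`. -/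
theorem gradSq_definingFun (hm : 0 ≤ m) (hms : 2 * m * s₀ ≤ 1) (hU : IsOpen U)
    (hP : SmoothUpToBoundary 1 U s₀ P) {p : Idx → ℝ} (hx : space p ∈ exteriorCone U s₀) :
    -CoordGeometry.gradSq (metric m) (definingFun m P) p =
      ‖space p‖⁻¹ ^ 2 * L m P (radialProj (space p)) ‖space p‖⁻¹ := by
  have hh := lapse_norm_pos hm hms hx
  have hn : ‖space p‖ ≠ 0 := norm_ne_zero_iff.2 hx.1.1
  have hgrad : CoordGeometry.gradSq (metric m) (definingFun m P) p = ∑ a,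
      CoordGeometry.pderiv (definingFun m P) a p *
        CoordGeometry.grad (metric m) (definingFun m P) p a := by
    simp only [CoordGeometry.gradSq, CoordGeometry.grad, Finset.mul_sum]
    refine Finset.sum_congr rfl fun a _ => Finset.sum_congr rfl fun b _ => ?_
    ring
  have hinl := grad_definingFun_inl hm hms hU hP hx
  rw [hgrad, L_eq, sphGradSq_radialProj hx.1.1]
  simp only [Fintype.sum_sum_type, Finset.univ_unique, Finset.sum_singleton]
  rw [show (default : Unit) = () from rfl, hinl, pderiv_definingFun_inl hm hms hU hP hx]
  simp only [pderiv_definingFun_inr hm hms hU hP hx, fderiv_height_single hm hms hU hP hx,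
    grad_definingFun_inr hm hms hU hP hx, radialFactor]
  rw [mul_neg, lapse_mul_inv_sq]
  have h1 := sum_unit_mul_xDeriv P (space p) ‖space p‖⁻¹
  have h2 := sum_unit_sq hx.1.1
  set h := lapse m ‖space p‖
  rw [Fin.sum_univ_three] at h1 h2 ⊢
  rw [Fin.sum_univ_three]
  have e : h * h⁻¹ = 1 := mul_inv_cancel₀ hh.ne'
  have e2 : ‖space p‖⁻¹ ^ 2 * ‖space p‖ ^ 2 = 1 := by field_simp
  set Q := sDeriv 1 P (radialProj (space p)) ‖space p‖⁻¹
  set D0 := xDeriv (EuclideanSpace.single 0 1) (radialLift P) (space p, ‖space p‖⁻¹)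
  set D1 := xDeriv (EuclideanSpace.single 1 1) (radialLift P) (space p, ‖space p‖⁻¹)
  set D2 := xDeriv (EuclideanSpace.single 2 1) (radialLift P) (space p, ‖space p‖⁻¹)
  linear_combination (1 + ‖space p‖⁻¹ ^ 2 * h * Q + h⁻¹ + ‖space p‖⁻¹ ^ 2 * Q) * h1 -
    (1 + ‖space p‖⁻¹ ^ 2 * h * Q) * (h⁻¹ + ‖space p‖⁻¹ ^ 2 * Q) * h2 +
    (D0 ^ 2 + D1 ^ 2 + D2 ^ 2) * e2 - (‖space p‖⁻¹ ^ 2 * Q) * e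

end Schwarzschild

/-! ### Spacelike graphs have `L > 0` -/

namespace Schwarzschild

variable {U : Set S2} {s₀ : ℝ} {m : ℝ} {P : S2 → ℝ → ℝ}

theorem point_dotProduct_metric (T : ℝ) (w : E3) (p : Idx → ℝ) :
    point T w ⬝ᵥ (metric m p).mulVec (point T w) = -lapse m ‖space p‖ * T ^ 2 + ∑ i, w i ^ 2 +
      ((lapse m ‖space p‖)⁻¹ - 1) * (∑ i, space p i / ‖space p‖ * w i) ^ 2 := by
  simp only [metric, dotProduct, Matrix.mulVec, Fintype.sum_sum_type, point, Sum.elim_inl,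
    Sum.elim_inr, Matrix.fromBlocks_apply₁₁, Matrix.fromBlocks_apply₁₂,
    Matrix.fromBlocks_apply₂₁, Matrix.fromBlocks_apply₂₂, Matrix.of_apply, Matrix.zero_apply,
    Fin.sum_univ_three, Finset.univ_unique, Finset.sum_singleton]
  simp
  ring

theorem norm_inv_sq_mul_L (hm : 0 ≤ m) (hms : 2 * m * s₀ ≤ 1)
    {x : E3} (hx : x ∈ exteriorCone U s₀) :
    ‖x‖⁻¹ ^ 2 * L m P (radialProj x) ‖x‖⁻¹ = (lapse m ‖x‖)⁻¹ -
      (lapse m ‖x‖)⁻¹ * radialFactor m P (radialProj x) ‖x‖⁻¹ ^ 2 -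
      ∑ i : Fin 3, xDeriv (EuclideanSpace.single i 1) (radialLift P) (x, ‖x‖⁻¹) ^ 2 := by
  have hh := lapse_norm_pos hm hms hx
  have hn : ‖x‖ ≠ 0 := norm_ne_zero_iff.2 hx.1.1
  rw [L_eq, sphGradSq_radialProj hx.1.1, radialFactor, lapse_mul_inv_sq]
  set h := lapse m ‖x‖
  field_simp
  ring

/-- A spacelike graph has `L > 0`: the metric is evaluated on the tangent vector obtained by raising
the index of the differential of the height function. -/
theorem L_pos (hm : 0 ≤ m) (hms : 2 * m * s₀ ≤ 1) (hU : IsOpen U)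
    (hP : SmoothUpToBoundary 1 U s₀ P) (hspace : IsSpacelikeGraph m U s₀ P)
    {y : S2} (hy : y ∈ U) {s : ℝ} (hs : s ∈ Ioo 0 s₀) : 0 < L m P y s := by
  have hx := position_mem hy hs
  have hsp := hspace y hy s hs
  have hxn : ‖position y s‖⁻¹ = s := by rw [norm_position y hs.1, inv_inv]
  have hxr := radialProj_position y hs.1
  have hL := norm_inv_sq_mul_L (P := P) hm hms hx
  rw [hxn, hxr] at hL
  have hgp : space (graphPoint m P y s) = position y s := space_point _ _
  have hh := lapse_norm_pos hm hms hx
  have h1 := sum_unit_mul_xDeriv P (position y s) ‖position y s‖⁻¹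
  have h2 := sum_unit_sq hx.1.1
  have hfd := fderiv_height_single hm hms hU hP hx
  rw [hxr] at hfd
  set x := position y s
  set h := lapse m ‖x‖
  set A := radialFactor m P y s with hA
  have hA' : h⁻¹ + s ^ 2 * sDeriv 1 P y s = h⁻¹ * A := by
    have hq : ‖x‖⁻¹ ^ 2 * (1 - 2 * m * ‖x‖⁻¹) = ‖x‖⁻¹ ^ 2 * h := lapse_mul_inv_sq
    rw [hxn] at hq
    rw [hA, radialFactor, hq]
    field_simp
  rw [hxn] at h1
  simp only [hxn, hA'] at hfd
  set D : Fin 3 → ℝ := fun i => xDeriv (EuclideanSpace.single i 1) (radialLift P) (x, s) with hD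
  change ∑ i, x i / ‖x‖ * D i = 0 at h1
  change ∀ i, fderiv ℝ (height m P) x (EuclideanSpace.single i 1) = x i / ‖x‖ * (h⁻¹ * A) - D i
    at hfd
  change s ^ 2 * L m P y s = h⁻¹ - h⁻¹ * A ^ 2 - ∑ i, D i ^ 2 at hL
  set ξ : Fin 3 → ℝ := fun i => x i / ‖x‖ with hξ
  change ∑ i, ξ i * D i = 0 at h1
  change ∑ i, ξ i * ξ i = 1 at h2
  change ∀ i, fderiv ℝ (height m P) x (EuclideanSpace.single i 1) = ξ i * (h⁻¹ * A) - D i at hfd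
  suffices hpos : 0 < h⁻¹ - h⁻¹ * A ^ 2 - ∑ i, D i ^ 2 by
    rw [← hL] at hpos
    exact (pos_iff_pos_of_mul_pos hpos).1 (by have := hs.1; positivity)
  have hhi : 0 < h⁻¹ := inv_pos.2 hh
  have ehh : h * h⁻¹ = 1 := mul_inv_cancel₀ hh.ne'
  set w : E3 := WithLp.toLp 2 (fun i => ξ i * A - D i) with hw
  have hwi : ∀ i, w i = ξ i * A - D i := fun i => rfl
  rw [Fin.sum_univ_three] at h1 h2 ⊢
  by_cases hw0 : w = 0
  · have hD0 : ∀ i, ξ i * A - D i = 0 := by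
      intro i
      rw [← hwi, hw0]
      rfl
    have e0 := hD0 0
    have e1 := hD0 1
    have e2 := hD0 2
    have hA0 : A = 0 := by
      linear_combination (-A) * h2 + ξ 0 * e0 + ξ 1 * e1 + ξ 2 * e2 + h1
    rw [hA0] at e0 e1 e2 ⊢
    have d0 : D 0 = 0 := by linarith
    have d1 : D 1 = 0 := by linarith
    have d2 : D 2 = 0 := by linarith
    rw [d0, d1, d2]
    simpa using hh
  · have key := hsp w hw0
    have hN : fderiv ℝ (height m P) x w = h⁻¹ * A ^ 2 + (D 0 ^ 2 + D 1 ^ 2 + D 2 ^ 2) := by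
      rw [← sum_coord_mul_apply]
      simp only [hfd, hwi, Fin.sum_univ_three]
      linear_combination (h⁻¹ * A ^ 2) * h2 - (A + h⁻¹ * A) * h1
    rw [hN] at key
    set N := h⁻¹ * A ^ 2 + (D 0 ^ 2 + D 1 ^ 2 + D 2 ^ 2) with hNdef
    have hform : point N w ⬝ᵥ (metric m (graphPoint m P y s)).mulVec (point N w) =
        -h * N ^ 2 + N := by
      rw [point_dotProduct_metric, hgp]
      change -h * N ^ 2 + ∑ i, w i ^ 2 + (h⁻¹ - 1) * (∑ i, ξ i * w i) ^ 2 = _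
      simp only [hwi]
      have hsum : ∑ i, (ξ i * A - D i) ^ 2 = A ^ 2 + (D 0 ^ 2 + D 1 ^ 2 + D 2 ^ 2) := by
        rw [Fin.sum_univ_three]
        linear_combination (A ^ 2) * h2 - 2 * A * h1
      have hin : ∑ i, ξ i * (ξ i * A - D i) = A := by
        rw [Fin.sum_univ_three]
        linear_combination A * h2 - h1
      rw [hsum, hin, hNdef]
      ring
    rw [hform] at key
    have hNpos : 0 < N := by
      by_contra hneg
      nlinarith [mul_nonneg hh.le (sq_nonneg N)]
    have hhN : h * N < 1 := by nlinarith
    have : N < h⁻¹ := by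
      rw [← one_div, lt_div_iff₀ hh]
      linarith
    linarith

end Schwarzschild

/-! ### The mean curvature in the unphysical variables -/

theorem hasFDerivAt_div {V : Type} [NormedAddCommGroup V] [NormedSpace ℝ V] {f g : V → ℝ}
    {f' g' : V →L[ℝ] ℝ} {x : V} (hf : HasFDerivAt f f' x) (hg : HasFDerivAt g g' x)
    (hx : g x ≠ 0) :
    HasFDerivAt (fun z => f z / g z) ((g x)⁻¹ • f' - (f x / g x ^ 2) • g') x := by
  have h := hf.mul ((hasDerivAt_inv hx).comp_hasFDerivAt x hg)
  simp only [div_eq_mul_inv]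
  convert! h using 1
  ext v
  simp
  field_simp
  ring

namespace Schwarzschild

variable {U : Set S2} {s₀ : ℝ} {m : ℝ} {P : S2 → ℝ → ℝ}

theorem smooth_L {n : WithTop ℕ∞} (hU : IsOpen U) (hP : SmoothUpToBoundary (n + 1) U s₀ P) :
    SmoothUpToBoundary n U s₀ (L m P) := by
  have h : L m P = fun y s => -(2 * sDeriv 1 P y s +
      s ^ 2 * (1 - 2 * m * s) * sDeriv 1 P y s ^ 2 + sphGradSq (fun z => P z s) y) :=
    funext fun y => funext fun s => L_eq m P y s
  rw [h]
  have hd := hP.sDeriv_one hU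
  exact (((SmoothUpToBoundary.const 2).mul hd).add
    ((SmoothUpToBoundary.of_contDiff (g := fun s => s ^ 2 * (1 - 2 * m * s)) (by fun_prop)).mul
      (hd.pow 2)) |>.add (hP.sphGradSq hU)).neg

/-- The radial coefficient `(1 + s² (1 - 2ms) P_s) / √L` of the unit normal. -/
def normalRadial (m : ℝ) (P : S2 → ℝ → ℝ) (y : S2) (s : ℝ) : ℝ :=
  radialFactor m P y s / Real.sqrt (L m P y s)

/-- The tangential part of the unit normal, up to the factor `-|x|`. -/
def normalTangential (m : ℝ) (P : S2 → ℝ → ℝ) (i : Fin 3) (z : E3 × ℝ) : ℝ :=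
  xDeriv (EuclideanSpace.single i 1) (radialLift P) z / Real.sqrt (radialLift (L m P) z)

theorem sqrt_neg_gradSq (hm : 0 ≤ m) (hms : 2 * m * s₀ ≤ 1) (hU : IsOpen U)
    (hP : SmoothUpToBoundary 1 U s₀ P) {p : Idx → ℝ} (hx : space p ∈ exteriorCone U s₀) :
    Real.sqrt (-CoordGeometry.gradSq (metric m) (definingFun m P) p) =
      ‖space p‖⁻¹ * Real.sqrt (L m P (radialProj (space p)) ‖space p‖⁻¹) := by
  rw [gradSq_definingFun hm hms hU hP hx, Real.sqrt_mul (by positivity), Real.sqrt_sq (by positivity)]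

theorem timelikeNormal_inr (hm : 0 ≤ m) (hms : 2 * m * s₀ ≤ 1) (hU : IsOpen U)
    (hP : SmoothUpToBoundary 1 U s₀ P) {p : Idx → ℝ} (hx : space p ∈ exteriorCone U s₀)
    (i : Fin 3) :
    CoordGeometry.timelikeNormal (metric m) (definingFun m P) p (Sum.inr i) =
      space p i * radialLift (normalRadial m P) (space p, ‖space p‖⁻¹) -
        ‖space p‖ * normalTangential m P i (space p, ‖space p‖⁻¹) := by
  have hn : ‖space p‖ ≠ 0 := norm_ne_zero_iff.2 hx.1.1
  rw [CoordGeometry.timelikeNormal, sqrt_neg_gradSq hm hms hU hP hx,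
    grad_definingFun_inr hm hms hU hP hx, radialLift, normalRadial, normalTangential, radialLift]
  rw [mul_inv, inv_inv]
  field_simp

theorem timelikeNormal_inl (hm : 0 ≤ m) (hms : 2 * m * s₀ ≤ 1) (hU : IsOpen U)
    (hP : SmoothUpToBoundary 1 U s₀ P) {p : Idx → ℝ} (hx : space p ∈ exteriorCone U s₀) :
    CoordGeometry.timelikeNormal (metric m) (definingFun m P) p (Sum.inl ()) =
      (‖space p‖⁻¹ * Real.sqrt (L m P (radialProj (space p)) ‖space p‖⁻¹))⁻¹ *
        (lapse m ‖space p‖)⁻¹ := by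
  rw [CoordGeometry.timelikeNormal, sqrt_neg_gradSq hm hms hU hP hx,
    grad_definingFun_inl hm hms hU hP hx]

theorem eventually_space_mem (hU : IsOpen U) {p : Idx → ℝ} (hx : space p ∈ exteriorCone U s₀) :
    ∀ᶠ q in 𝓝 p, space q ∈ exteriorCone U s₀ :=
  spaceCLM.continuous.continuousAt.eventually ((isOpen_exteriorCone hU).mem_nhds hx)

theorem sqrt_abs_det (hm : 0 ≤ m) (hms : 2 * m * s₀ ≤ 1) {p : Idx → ℝ}
    (hx : space p ∈ exteriorCone U s₀) : Real.sqrt |(metric m p).det| = 1 := by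
  rw [det_metric hx.1.1 (lapse_norm_pos hm hms hx).ne']
  simp

/-- In the coordinates `(t, x)` the volume element is that of Euclidean space and the normal does
not depend on `t`, so its divergence is a divergence in Euclidean three-space. -/
theorem divergence_timelikeNormal (hm : 0 ≤ m) (hms : 2 * m * s₀ ≤ 1) (hU : IsOpen U)
    (hP : SmoothUpToBoundary 1 U s₀ P) {p : Idx → ℝ} (hx : space p ∈ exteriorCone U s₀)
    (hd : ∀ i : Fin 3, DifferentiableAt ℝ (fun x : E3 =>
      x i * radialLift (normalRadial m P) (x, ‖x‖⁻¹) -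
        ‖x‖ * normalTangential m P i (x, ‖x‖⁻¹)) (space p)) :
    CoordGeometry.divergence (metric m)
      (CoordGeometry.timelikeNormal (metric m) (definingFun m P)) p =
    ∑ i : Fin 3, fderiv ℝ (fun x : E3 => x i * radialLift (normalRadial m P) (x, ‖x‖⁻¹) -
        ‖x‖ * normalTangential m P i (x, ‖x‖⁻¹)) (space p) (EuclideanSpace.single i 1) := by
  have hev := eventually_space_mem hU hx
  rw [CoordGeometry.divergence, sqrt_abs_det hm hms hx, inv_one, one_mul, Fintype.sum_sum_type]
  have h0 : ∑ a : Unit, CoordGeometry.pderiv (fun q => Real.sqrt |(metric m q).det| *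
      CoordGeometry.timelikeNormal (metric m) (definingFun m P) q (Sum.inl a)) (Sum.inl a) p = 0 := by
    refine Finset.sum_eq_zero fun a _ => ?_
    apply fderiv_apply_eq_zero_of_line
    refine Eventually.of_forall fun t => ?_
    have hsp : space (p + t • Pi.single (Sum.inl a) 1) = space p := by
      rw [← spaceCLM_apply, map_add, map_smul, spaceCLM_single_inl]
      simp [spaceCLM_apply]
    have hx' : space (p + t • Pi.single (Sum.inl a) 1) ∈ exteriorCone U s₀ := by rwa [hsp]
    simp only
    rw [sqrt_abs_det hm hms hx, sqrt_abs_det hm hms hx', timelikeNormal_inl hm hms hU hP hx,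
      timelikeNormal_inl hm hms hU hP hx', hsp]
  rw [h0, zero_add]
  refine Finset.sum_congr rfl fun i _ => ?_
  have hcongr : (fun q => Real.sqrt |(metric m q).det| *
      CoordGeometry.timelikeNormal (metric m) (definingFun m P) q (Sum.inr i)) =ᶠ[𝓝 p]
      (fun x : E3 => x i * radialLift (normalRadial m P) (x, ‖x‖⁻¹) -
        ‖x‖ * normalTangential m P i (x, ‖x‖⁻¹)) ∘ spaceCLM := by
    filter_upwards [hev] with q hq
    rw [sqrt_abs_det hm hms hq, one_mul, timelikeNormal_inr hm hms hU hP hq]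
    rfl
  rw [CoordGeometry.pderiv, hcongr.fderiv_eq]
  have hcomp := HasFDerivAt.comp (f := spaceCLM) p (hd i).hasFDerivAt spaceCLM.hasFDerivAt
  rw [hcomp.fderiv, ContinuousLinearMap.comp_apply, spaceCLM_single_inr]

/-- The `s`-derivative of `s² (1 - 2ms) P_s`, plus the Laplacian of `P` on the sphere. -/
def boxTerm (m : ℝ) (P : S2 → ℝ → ℝ) (y : S2) (s : ℝ) : ℝ :=
  (2 * s - 6 * m * s ^ 2) * sDeriv 1 P y s + (s ^ 2 - 2 * m * s ^ 3) * sDeriv 2 P y s +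
    sphLap (fun z => P z s) y

/-- The derivative of `L` along the unphysical gradient of `v̄ + P`. -/
def transportL (m : ℝ) (P : S2 → ℝ → ℝ) (y : S2) (s : ℝ) : ℝ :=
  radialFactor m P y s * sDeriv 1 (L m P) y s +
    sphInner (fun z => P z s) (fun z => L m P z s) y

/-- The mean curvature equation in the unphysical variables. Unlike the defining expression of the
mean curvature, its terms are defined and differentiable up to `s = 0`. -/
theorem meanCurv_formula (hm : 0 ≤ m) (hms : 2 * m * s₀ ≤ 1) (hU : IsOpen U)
    (hP : SmoothUpToBoundary 4 U s₀ P) {y : S2} (hy : y ∈ U) {s : ℝ} (hs : s ∈ Ioo 0 s₀)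
    (hL : 0 < L m P y s) :
    6 * meanCurv m P y s * Real.sqrt (L m P y s) ^ 3 =
      6 * radialFactor m P y s * L m P y s - 2 * s * L m P y s * boxTerm m P y s +
        s * transportL m P y s := by
  have hx := position_mem hy hs
  have hP1 : SmoothUpToBoundary 1 U s₀ P := hP.of_le (by norm_num)
  have hsL : SmoothUpToBoundary 3 U s₀ (L m P) := smooth_L hU (hP.of_le (by norm_num))
  have hdP : SmoothUpToBoundary 3 U s₀ (sDeriv 1 P) := SmoothUpToBoundary.sDeriv_one hU (hP.of_le (by norm_num))
  have hgp : space (graphPoint m P y s) = position y s := space_point _ _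
  have hxn : ‖position y s‖⁻¹ = s := by rw [norm_position y hs.1, inv_inv]
  have hxr := radialProj_position y hs.1
  have hs0 : s ≠ 0 := hs.1.ne'
  have hdef : position y s = s⁻¹ • (y : E3) := rfl
  set x := position y s with hxdef
  have hz : ((x, s) : E3 × ℝ).1 ∈ cone U := hx.1
  have hμ : 0 < Real.sqrt (L m P y s) := Real.sqrt_pos.2 hL
  have hLx : radialLift (L m P) (x, s) = L m P y s := by simp only [radialLift, hxr]
  -- differentiability at the point
  have dL : DifferentiableAt ℝ (radialLift (L m P)) (x, s) :=
    (hsL.contDiffAt hU hz hs).differentiableAt (by norm_num)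
  have dD : ∀ i : Fin 3, DifferentiableAt ℝ
      (xDeriv (EuclideanSpace.single i 1) (radialLift P)) (x, s) := by
    intro i
    have h1 := contDiffOn_xDeriv (isOpen_cone hU) (n := 3)
      (hP.of_le (by norm_num)).contDiffOn (EuclideanSpace.single i 1)
    refine (h1.contDiffAt ?_).differentiableAt (by norm_num)
    exact mem_of_superset (((isOpen_cone hU).prod isOpen_Ioo).mem_nhds ⟨hz, hs⟩)
      (prod_mono subset_rfl Ioo_subset_Ico_self)
  have dA : DifferentiableAt ℝ (radialLift (radialFactor m P)) (x, s) := by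
    have h1 : SmoothUpToBoundary 3 U s₀ (radialFactor m P) :=
      (SmoothUpToBoundary.const 1).add ((SmoothUpToBoundary.of_contDiff
        (g := fun s => s ^ 2 * (1 - 2 * m * s)) (by fun_prop)).mul hdP)
    exact (h1.contDiffAt hU hz hs).differentiableAt (by norm_num)
  have dS := dL.hasFDerivAt.sqrt (by rw [hLx]; exact hL.ne')
  have hS : Real.sqrt (radialLift (L m P) (x, s)) ≠ 0 := by rw [hLx]; exact hμ.ne'
  have dα : DifferentiableAt ℝ (radialLift (normalRadial m P)) (x, s) :=
    (hasFDerivAt_div dA.hasFDerivAt dS hS).differentiableAt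
  have dV : ∀ i, DifferentiableAt ℝ (normalTangential m P i) (x, s) := fun i =>
    (hasFDerivAt_div (dD i).hasFDerivAt dS hS).differentiableAt
  have hdiv := sum_fderiv_radial_sub_tangential (x := x) (α := radialLift (normalRadial m P))
    (V := normalTangential m P) hx.1.1 (by rw [hxn]; exact dα) (by rw [hxn]; exact dV)
    (fun c hc x s => radialLift_smul _ hc x s)
    (by
      intro s
      have h1 : ∀ i, x i * normalTangential m P i (x, s) = (x i * xDeriv (EuclideanSpace.single i 1)
        (radialLift P) (x, s)) * (Real.sqrt (radialLift (L m P) (x, s)))⁻¹ := by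
        intro i
        rw [normalTangential]
        ring
      simp only [h1]
      rw [← Finset.sum_mul, sum_coord_mul_xDeriv, zero_mul])
  have hmc : 3 * meanCurv m P y s = ∑ i : Fin 3, fderiv ℝ (fun x : E3 =>
      x i * radialLift (normalRadial m P) (x, ‖x‖⁻¹) -
        ‖x‖ * normalTangential m P i (x, ‖x‖⁻¹)) x (EuclideanSpace.single i 1) := by
    rw [meanCurv, CoordGeometry.levelMeanCurvature, divergence_timelikeNormal hm hms hU hP1
      (by rw [hgp]; exact hx) (by rw [hgp]; exact hdiv.1), hgp]
    ring
  rw [hdiv.2, hxn] at hmc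
  -- the radial derivative of the radial coefficient
  have hαs : HasDerivAt (fun s => radialLift (normalRadial m P) (x, s))
      (((2 * s - 6 * m * s ^ 2) * sDeriv 1 P y s + (s ^ 2 - 2 * m * s ^ 3) * sDeriv 2 P y s) /
        Real.sqrt (L m P y s) - radialFactor m P y s * sDeriv 1 (L m P) y s /
          (2 * Real.sqrt (L m P y s) ^ 3)) s := by
    have e : (fun s => radialLift (normalRadial m P) (x, s)) = normalRadial m P y := by
      funext s
      simp only [radialLift, hxr]
    rw [e]
    have d1 := (hsL.of_le (by norm_num)).hasDerivAt hy hs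
    have d2 := (hdP.of_le (by norm_num)).hasDerivAt hy hs
    rw [← sDeriv_succ] at d2
    have dq : HasDerivAt (fun s : ℝ => s ^ 2 * (1 - 2 * m * s)) (2 * s - 6 * m * s ^ 2) s := by
      have h := ((hasDerivAt_id s).pow 2).mul (((hasDerivAt_id s).const_mul (2 * m)).const_sub 1)
      convert! h using 1
      simp
      ring
    have h := ((dq.mul d2).const_add 1).div (d1.sqrt hL.ne') hμ.ne'
    convert! h using 1
    have hsq := Real.sq_sqrt hL.le
    have hcu : Real.sqrt (L m P y s) ^ 3 = L m P y s * Real.sqrt (L m P y s) := by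
      rw [pow_succ, hsq]
    rw [hsq, hcu, radialFactor]
    simp only [Pi.mul_apply]
    have hne := hμ.ne'
    field_simp
    rw [hsq]
  -- the tangential divergence
  have hVi : ∀ i : Fin 3, xDeriv (EuclideanSpace.single i 1) (normalTangential m P i) (x, s) =
      s ^ 2 * (xDeriv (EuclideanSpace.single i 1)
        (xDeriv (EuclideanSpace.single i 1) (radialLift P)) ((y : E3), s) /
          Real.sqrt (L m P y s) -
        sphPartial i (fun z => P z s) y * sphPartial i (fun z => L m P z s) y /
          (2 * Real.sqrt (L m P y s) ^ 3)) := by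
    intro i
    set e := (EuclideanSpace.single i 1 : E3)
    have hs' : 0 < s⁻¹ := inv_pos.2 hs.1
    have d1 : DifferentiableAt ℝ (fun x' => xDeriv e (radialLift P) (x', s)) x :=
      (dD i).comp (f := fun x' : E3 => (x', s)) x (by fun_prop)
    have d2 : DifferentiableAt ℝ (fun x' => radialLift (L m P) (x', s)) x :=
      dL.comp (f := fun x' : E3 => (x', s)) x (by fun_prop)
    have h := hasFDerivAt_div d1.hasFDerivAt
      (d2.hasFDerivAt.sqrt (by rw [hLx]; exact hL.ne')) hS
    have h' := congrArg (fun l : E3 →L[ℝ] ℝ => l e) h.fderiv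
    have hD : xDeriv e (radialLift P) (x, s) = s * sphPartial i (fun z => P z s) y := by
      rw [hdef, xDeriv_radialLift_smul _ _ hs', inv_inv]
      rfl
    have hDL : fderiv ℝ (fun x' => radialLift (L m P) (x', s)) x e =
        s * sphPartial i (fun z => L m P z s) y := by
      have := xDeriv_radialLift_smul (L m P) e hs' y s
      rw [inv_inv] at this
      exact this
    have hDD : fderiv ℝ (fun x' => xDeriv e (radialLift P) (x', s)) x e =
        s ^ 2 * xDeriv e (xDeriv e (radialLift P)) ((y : E3), s) := by
      have := xDeriv_xDeriv_radialLift_smul P e e hs' y s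
      rw [inv_pow, inv_inv] at this
      exact this
    refine h'.trans ?_
    simp only [_root_.smul_apply, _root_.sub_apply, smul_eq_mul]
    rw [hDD, hDL, hLx, hD]
    have hne := hμ.ne'
    have hsq := Real.sq_sqrt hL.le
    field_simp
  have hlap : sphLap (fun z => P z s) y = ∑ i : Fin 3, xDeriv (EuclideanSpace.single i 1)
        (xDeriv (EuclideanSpace.single i 1) (radialLift P)) ((y : E3), s) :=
    sphLap_eq_sum ((hP.contDiffAt_radialExt hU (Ioo_subset_Ico_self hs) hy).of_le (by norm_num))
  rw [hαs.deriv] at hmc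
  simp only [hVi, ← Finset.mul_sum, Finset.sum_sub_distrib, ← Finset.sum_div, ← hlap,
    ← sphInner_eq_sum] at hmc
  have hnx : ‖x‖ = s⁻¹ := norm_position y hs.1
  have hα : radialLift (normalRadial m P) (x, s) = radialFactor m P y s / Real.sqrt (L m P y s) := by
    simp only [radialLift, hxr, normalRadial]
  rw [hnx, hα] at hmc
  have hsq := Real.sq_sqrt hL.le
  rw [boxTerm, transportL]
  set μ := Real.sqrt (L m P y s) with hμdef
  rw [← hsq]
  have hne := hμ.ne'
  have h6 : 6 * meanCurv m P y s * μ ^ 3 = 2 * μ ^ 3 * (3 * meanCurv m P y s) := by ring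
  rw [h6, hmc]
  field_simp
  ring

end Schwarzschild

/-! ### Linearity and locality of the operators on the sphere -/

section SphereCalculus

variable {f k : S2 → ℝ} {y : S2}

theorem radialExt_eventuallyEq {U : Set S2} (hU : IsOpen U) (h : ∀ z ∈ U, f z = k z)
    (hy : y ∈ U) : radialExt f =ᶠ[𝓝 (y : E3)] radialExt k := by
  filter_upwards [(isOpen_cone hU).mem_nhds (coe_mem_cone hy)] with x hx
  exact h _ hx.2

theorem sphPartial_congr {U : Set S2} (hU : IsOpen U) (h : ∀ z ∈ U, f z = k z) (hy : y ∈ U)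
    (i : Fin 3) : sphPartial i f y = sphPartial i k y := by
  rw [sphPartial, (radialExt_eventuallyEq hU h hy).fderiv_eq, sphPartial]

theorem sphLap_congr {U : Set S2} (hU : IsOpen U) (h : ∀ z ∈ U, f z = k z) (hy : y ∈ U) :
    sphLap f y = sphLap k y :=
  (InnerProductSpace.laplacian_congr_nhds (radialExt_eventuallyEq hU h hy)).eq_of_nhds

theorem sphPartial_const (c : ℝ) (i : Fin 3) : sphPartial i (fun _ => c) y = 0 := by
  change fderiv ℝ (fun _ : E3 => c) (y : E3) _ = 0
  simp

theorem sphPartial_add (hf : DifferentiableAt ℝ (radialExt f) (y : E3))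
    (hk : DifferentiableAt ℝ (radialExt k) (y : E3)) (i : Fin 3) :
    sphPartial i (fun z => f z + k z) y = sphPartial i f y + sphPartial i k y := by
  change fderiv ℝ (fun x => radialExt f x + radialExt k x) (y : E3) _ = _
  rw [fderiv_fun_add hf hk]
  rfl

theorem sphPartial_mul (hf : DifferentiableAt ℝ (radialExt f) (y : E3))
    (hk : DifferentiableAt ℝ (radialExt k) (y : E3)) (i : Fin 3) :
    sphPartial i (fun z => f z * k z) y = f y * sphPartial i k y + k y * sphPartial i f y := by
  change fderiv ℝ (fun x => radialExt f x * radialExt k x) (y : E3) _ = _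
  rw [fderiv_fun_mul hf hk]
  simp [sphPartial, radialExt, radialProj_coe]

theorem sphPartial_const_mul (c : ℝ) (hf : DifferentiableAt ℝ (radialExt f) (y : E3))
    (i : Fin 3) : sphPartial i (fun z => c * f z) y = c * sphPartial i f y := by
  change fderiv ℝ (fun x => c * radialExt f x) (y : E3) _ = _
  rw [fderiv_const_mul hf]
  rfl

theorem sphLap_add (hf : ContDiffAt ℝ 2 (radialExt f) (y : E3))
    (hk : ContDiffAt ℝ 2 (radialExt k) (y : E3)) :
    sphLap (fun z => f z + k z) y = sphLap f y + sphLap k y :=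
  hf.laplacian_add hk

theorem sphLap_const_mul (c : ℝ) (hf : ContDiffAt ℝ 2 (radialExt f) (y : E3)) :
    sphLap (fun z => c * f z) y = c * sphLap f y :=
  InnerProductSpace.laplacian_smul c hf

theorem sphLap_const (c : ℝ) : sphLap (fun _ => c) y = 0 := by
  have h : (radialExt fun _ => c) = fun _ : E3 => c := rfl
  rw [sphLap, h]
  simp

theorem sphPartial_eq_zero_of_isLocalMax (h : IsLocalMax f y) (i : Fin 3) :
    sphPartial i f y = 0 := by
  have h1 : IsLocalMax (radialExt f) (y : E3) := by
    have hc : ContinuousAt radialProj (y : E3) :=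
      (contMDiffAt_radialProj (n := 0) (coe_S2_ne_zero y)).continuousAt
    rw [ContinuousAt, radialProj_coe] at hc
    filter_upwards [hc.eventually h] with x hx
    simpa [radialExt, radialProj_coe] using hx
  rw [sphPartial, h1.fderiv_eq_zero]
  rfl

end SphereCalculus

/-! ### Positivity of `L` at the boundary -/

theorem SmoothUpToBoundary.continuousOn {n : WithTop ℕ∞} {U : Set S2} {s₀ : ℝ} {φ : S2 → ℝ → ℝ}
    (h : SmoothUpToBoundary n U s₀ φ) :
    ContinuousOn (fun z : S2 × ℝ => φ z.1 z.2) (U ×ˢ Ico 0 s₀) :=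
  ContMDiffOn.continuousOn h

namespace Schwarzschild

variable {U : Set S2} {s₀ : ℝ} {m : ℝ} {P : S2 → ℝ → ℝ}

theorem smooth_radialFactor {n : WithTop ℕ∞} (hU : IsOpen U)
    (hP : SmoothUpToBoundary (n + 1) U s₀ P) : SmoothUpToBoundary n U s₀ (radialFactor m P) :=
  (SmoothUpToBoundary.const 1).add ((SmoothUpToBoundary.of_contDiff
    (g := fun s => s ^ 2 * (1 - 2 * m * s)) (by fun_prop)).mul (hP.sDeriv_one hU))

theorem smooth_boxTerm {n : WithTop ℕ∞} (hU : IsOpen U)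
    (hP : SmoothUpToBoundary (n + 2) U s₀ P) : SmoothUpToBoundary n U s₀ (boxTerm m P) := by
  have h1 : SmoothUpToBoundary (n + 1) U s₀ (sDeriv 1 P) := by
    apply SmoothUpToBoundary.sDeriv_one hU
    rwa [add_assoc, one_add_one_eq_two]
  have h2 : SmoothUpToBoundary n U s₀ (sDeriv 2 P) := by
    have h : sDeriv 2 P = sDeriv 1 (sDeriv 1 P) := funext fun y => funext fun s => sDeriv_succ 1 P y s
    rw [h]
    exact h1.sDeriv_one hU
  exact (((SmoothUpToBoundary.of_contDiff (g := fun s => 2 * s - 6 * m * s ^ 2) (by fun_prop)).mul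
    (h1.of_le (by simp))).add ((SmoothUpToBoundary.of_contDiff
      (g := fun s => s ^ 2 - 2 * m * s ^ 3) (by fun_prop)).mul h2)).add (hP.sphLap hU)

theorem smooth_transportL {n : WithTop ℕ∞} (hU : IsOpen U)
    (hP : SmoothUpToBoundary (n + 2) U s₀ P) : SmoothUpToBoundary n U s₀ (transportL m P) := by
  have hP' : SmoothUpToBoundary ((n + 1) + 1) U s₀ P := by rwa [add_assoc, one_add_one_eq_two]
  have h1 : SmoothUpToBoundary (n + 1) U s₀ (L m P) := smooth_L hU hP'
  exact ((smooth_radialFactor hU (hP'.of_le le_self_add)).mul (h1.sDeriv_one hU)).add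
    ((hP'.of_le le_self_add).sphInner hU h1)

/-- If the mean curvature stays bounded then `L` does not vanish at the boundary. If `L` vanished at
`(y₀, 0)` one could look at the maximum of `s L χ`, where `χ = ρ² - |y - y₀|² - K s`, over the region
where `s ≥ 0` and `χ ≥ 0`. It lies in the interior, so the derivative of `s L χ` along
`(1 + s² (1 - 2ms) P_s) ∂_s + ∇P` vanishes there; but near `(y₀, 0)` the mean curvature equation
makes this derivative negative. -/
theorem L_pos_boundary (hm : 0 ≤ m) (hms : 2 * m * s₀ ≤ 1) (hs₀ : 0 < s₀) (hU : IsOpen U)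
    (hP : SmoothUpToBoundary 4 U s₀ P) (hspace : IsSpacelikeGraph m U s₀ P)
    {ψ : S2 → ℝ → ℝ} (hψ : SmoothUpToBoundary 0 U s₀ ψ)
    (hH : ∀ y ∈ U, ∀ s ∈ Ioo 0 s₀, meanCurv m P y s = ψ y s) {y₀ : S2} (hy₀ : y₀ ∈ U) :
    0 < L m P y₀ 0 := by
  have hP1 : SmoothUpToBoundary 1 U s₀ P := hP.of_le (by norm_num)
  have hLs : SmoothUpToBoundary 3 U s₀ (L m P) := smooth_L hU (hP.of_le (by norm_num))
  have hLpos : ∀ y ∈ U, ∀ s ∈ Ioo 0 s₀, 0 < L m P y s := fun y hy s hs =>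
    L_pos hm hms hU hP1 hspace hy hs
  have h0mem : ∀ y ∈ U, (y, (0 : ℝ)) ∈ U ×ˢ Ico 0 s₀ := fun y hy => ⟨hy, le_rfl, hs₀⟩
  -- `L ≥ 0` at the boundary by continuity
  have hLnn : ∀ y ∈ U, 0 ≤ L m P y 0 := by
    intro y hy
    have hc : ContinuousWithinAt (L m P y) (Ico 0 s₀) 0 :=
      (hLs.contDiffOn_fiber hy).continuousOn 0 ⟨le_rfl, hs₀⟩
    have h1 : Tendsto (L m P y) (𝓝[>] 0) (𝓝 (L m P y 0)) := by
      rw [← nhdsWithin_Ioo_eq_nhdsGT hs₀]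
      exact hc.mono_left (nhdsWithin_mono _ Ioo_subset_Ico_self)
    refine ge_of_tendsto h1 ?_
    filter_upwards [Ioo_mem_nhdsGT hs₀] with s hs using (hLpos y hy s hs).le
  refine lt_of_le_of_ne (hLnn y₀ hy₀) fun hL0 => ?_
  -- up to an additive constant, `η = -|y - y₀|²`
  let η : S2 → ℝ → ℝ := fun y _ => 2 * inner ℝ (y : E3) (y₀ : E3)
  have hη : SmoothUpToBoundary 4 U s₀ η :=
    smoothUpToBoundary_of_contDiffOn (Ψ := fun z : E3 × ℝ => 2 * inner ℝ z.1 (y₀ : E3))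
      (contDiff_const.mul (contDiff_fst.inner ℝ contDiff_const)).contDiffOn
  let g : S2 → ℝ → ℝ := fun y s => sphInner (fun z => P z s) (fun z => η z s) y
  have hg : SmoothUpToBoundary 3 U s₀ g := SmoothUpToBoundary.sphInner hU hP hη
  set K : ℝ := 2 * (|g y₀ 0| + 1) with hK
  have hK1 : 1 ≤ K := by
    have := abs_nonneg (g y₀ 0)
    linarith
  have hA := (smooth_radialFactor (n := 3) (m := m) hU (hP.of_le (by norm_num)))
  have hB := (smooth_boxTerm (n := 2) (m := m) hU (hP.of_le (by norm_num)))
  -- near `(y₀, 0)` the term `-5 A` dominates the other terms of order zero in the equation, and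
  -- `K` is chosen so that `-K A` dominates `⟨∇P, ∇η⟩`
  have hev : ∀ᶠ z in 𝓝[U ×ˢ Ico 0 s₀] (y₀, (0 : ℝ)), 1 / 2 < radialFactor m P z.1 z.2 ∧
      6 * ψ z.1 z.2 * Real.sqrt (L m P z.1 z.2) < 1 ∧ 2 * z.2 * boxTerm m P z.1 z.2 < 1 ∧
      g z.1 z.2 < K / 2 := by
    have cA := hA.continuousOn (y₀, 0) (h0mem y₀ hy₀)
    have cL : Tendsto (fun z : S2 × ℝ => 6 * ψ z.1 z.2 * Real.sqrt (L m P z.1 z.2))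
        (𝓝[U ×ˢ Ico 0 s₀] (y₀, 0)) (𝓝 (6 * ψ y₀ 0 * Real.sqrt (L m P y₀ 0))) :=
      ((continuousOn_const (c := (6 : ℝ))).mul hψ.continuousOn).mul
        hLs.continuousOn.sqrt (y₀, 0) (h0mem y₀ hy₀)
    have cB : Tendsto (fun z : S2 × ℝ => 2 * z.2 * boxTerm m P z.1 z.2)
        (𝓝[U ×ˢ Ico 0 s₀] (y₀, 0)) (𝓝 (2 * 0 * boxTerm m P y₀ 0)) :=
      (((SmoothUpToBoundary.of_contDiff (n := 0) (U := U) (s₀ := s₀)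
        (g := fun s => 2 * s) (by fun_prop)).continuousOn).mul hB.continuousOn)
        (y₀, 0) (h0mem y₀ hy₀)
    have cg := hg.continuousOn (y₀, 0) (h0mem y₀ hy₀)
    have v1 : 1 / 2 < radialFactor m P y₀ 0 := by
      simp [radialFactor]
      norm_num
    have v2 : 6 * ψ y₀ 0 * Real.sqrt (L m P y₀ 0) < 1 := by simp [← hL0]
    have v3 : 2 * 0 * boxTerm m P y₀ 0 < 1 := by simp
    have v4 : g y₀ 0 < K / 2 := by
      have := le_abs_self (g y₀ 0)
      linarith
    filter_upwards [cA.eventually_const_lt v1, cL.eventually_lt_const v2,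
      cB.eventually_lt_const v3, cg.eventually_lt_const v4] with z h1 h2 h3 h4
    exact ⟨h1, h2, h3, h4⟩
  obtain ⟨ε, hε, hεs⟩ : ∃ ε > 0, ∀ y s, dist y y₀ < ε → 0 ≤ s → s < ε → y ∈ U ∧ s < s₀ ∧
      (1 / 2 < radialFactor m P y s ∧
      6 * ψ y s * Real.sqrt (L m P y s) < 1 ∧ 2 * s * boxTerm m P y s < 1 ∧ g y s < K / 2) := by
    obtain ⟨ε₁, hε₁, h1⟩ := Metric.mem_nhdsWithin_iff.1 hev
    obtain ⟨ε₂, hε₂, h2⟩ := Metric.isOpen_iff.1 hU y₀ hy₀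
    refine ⟨min ε₁ (min ε₂ s₀), by positivity, fun y s hd hs0 hs => ?_⟩
    have hyU : y ∈ U := h2 (lt_of_lt_of_le hd ((min_le_right _ _).trans (min_le_left _ _)))
    have hss : s < s₀ := lt_of_lt_of_le hs ((min_le_right _ _).trans (min_le_right _ _))
    refine ⟨hyU, hss, h1 (a := (y, s)) ⟨?_, hyU, hs0, hss⟩⟩
    rw [Metric.mem_ball, Prod.dist_eq, max_lt_iff]
    refine ⟨lt_of_lt_of_le hd (min_le_left _ _), ?_⟩
    rw [Real.dist_eq, sub_zero, abs_of_nonneg hs0]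
    exact lt_of_lt_of_le hs (min_le_left _ _)
  set ρ : ℝ := min (ε / 2) (1 / 2) with hρ
  have hρ0 : 0 < ρ := by positivity
  have hρε : ρ < ε := lt_of_le_of_lt (min_le_left _ _) (by linarith)
  have hρ1 : ρ ≤ 1 / 2 := min_le_right _ _
  let χ : S2 → ℝ → ℝ := fun y s => (ρ ^ 2 - 2) + η y s - K * s
  have hdist : ∀ y : S2, dist y y₀ ^ 2 = 2 - 2 * inner ℝ (y : E3) (y₀ : E3) := by
    intro y
    rw [Subtype.dist_eq, dist_eq_norm, norm_sub_sq_real, norm_coe_S2, norm_coe_S2]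
    ring
  have hχ : ∀ y s, χ y s = ρ ^ 2 - dist y y₀ ^ 2 - K * s := by
    intro y s
    simp only [χ, η, hdist]
    ring
  have hχc : Continuous fun z : S2 × ℝ => χ z.1 z.2 := by
    simp only [hχ]
    fun_prop
  let D : Set (S2 × ℝ) := (univ ×ˢ Icc 0 1) ∩ {z | 0 ≤ χ z.1 z.2}
  have hDc : IsCompact D :=
    (isCompact_univ.prod isCompact_Icc).inter_right (isClosed_le continuous_const hχc)
  have hDε : ∀ y s, 0 ≤ s → 0 ≤ χ y s → dist y y₀ < ε ∧ s < ε ∧ s ≤ 1 := by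
    intro y s hs0 hc
    rw [hχ] at hc
    have h1 : s ≤ K * s := le_mul_of_one_le_left hs0 hK1
    have h2 : dist y y₀ ^ 2 ≤ ρ ^ 2 := by linarith
    have h3 : dist y y₀ ≤ ρ := by
      exact (le_abs_self _).trans (abs_le_of_sq_le_sq h2 hρ0.le)
    have h4 : s ≤ ρ := by nlinarith [sq_nonneg (dist y y₀)]
    exact ⟨h3.trans_lt hρε, h4.trans_lt hρε, by linarith⟩
  let F : S2 → ℝ → ℝ := fun y s => s * L m P y s * χ y s
  have hχs : SmoothUpToBoundary 3 U s₀ χ :=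
    ((SmoothUpToBoundary.const (ρ ^ 2 - 2)).add (hη.of_le (by norm_num))).sub
      (SmoothUpToBoundary.of_contDiff (g := fun s => K * s) (by fun_prop))
  have hsLs : SmoothUpToBoundary 3 U s₀ (fun y s => s * L m P y s) :=
    (SmoothUpToBoundary.of_contDiff (g := fun s => s) (by fun_prop)).mul hLs
  have hFs : SmoothUpToBoundary 3 U s₀ F := hsLs.mul hχs
  have hDsub : D ⊆ U ×ˢ Ico 0 s₀ := by
    rintro ⟨y, s⟩ ⟨⟨-, hs⟩, hc⟩
    obtain ⟨h1, h2, -⟩ := hDε y s hs.1 hc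
    obtain ⟨h3, h4, -⟩ := hεs y s h1 hs.1 h2
    exact ⟨h3, hs.1, h4⟩
  have hbase : (y₀, ρ ^ 2 / (2 * K)) ∈ D ∧ 0 < ρ ^ 2 / (2 * K) ∧ 0 < χ y₀ (ρ ^ 2 / (2 * K)) := by
    have hK0 : 0 < K := by linarith
    have h1 : χ y₀ (ρ ^ 2 / (2 * K)) = ρ ^ 2 / 2 := by
      rw [hχ, dist_self]
      field_simp
      ring
    have h2 : 0 < ρ ^ 2 / (2 * K) := by positivity
    have h3 : 0 < χ y₀ (ρ ^ 2 / (2 * K)) := by rw [h1]; positivity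
    exact ⟨⟨⟨mem_univ _, h2.le, (hDε _ _ h2.le h3.le).2.2⟩, h3.le⟩, h2, h3⟩
  obtain ⟨⟨y, s⟩, hzD, hmax⟩ := hDc.exists_isMaxOn ⟨_, hbase.1⟩ (hFs.continuousOn.mono hDsub)
  have hmem := hDsub hzD
  have hyU : y ∈ U := hmem.1
  have hFpos : 0 < F y s := by
    have h1 : 0 < F y₀ (ρ ^ 2 / (2 * K)) :=
      mul_pos (mul_pos hbase.2.1 (hLpos y₀ hy₀ _ ⟨hbase.2.1, (hDsub hbase.1).2.2⟩)) hbase.2.2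
    exact lt_of_lt_of_le h1 (hmax hbase.1)
  have hs : 0 < s := by
    rcases hmem.2.1.eq_or_lt with h | h
    · exfalso
      have h' : s = 0 := h.symm
      have : F y s = 0 := by simp only [F, h', zero_mul]
      linarith
    · exact h
  have hsI : s ∈ Ioo 0 s₀ := ⟨hs, hmem.2.2⟩
  have hLp := hLpos y hyU s hsI
  have hχp : 0 < χ y s := (pos_iff_pos_of_mul_pos hFpos).1 (mul_pos hs hLp)
  obtain ⟨hd1, hd2, -⟩ := hDε y s hs.le hχp.le
  obtain ⟨-, -, hAy, hψy, hBy, hgy⟩ := hεs y s hd1 hs.le hd2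
  -- the first order conditions at the maximum
  have hevD : ∀ᶠ z : S2 × ℝ in 𝓝 (y, s), z ∈ D := by
    have h1 : ∀ᶠ z : S2 × ℝ in 𝓝 (y, s), 0 < χ z.1 z.2 :=
      hχc.continuousAt.eventually (lt_mem_nhds hχp)
    have h2 : ∀ᶠ z : S2 × ℝ in 𝓝 (y, s), 0 < z.2 :=
      continuous_snd.continuousAt.eventually (lt_mem_nhds hs)
    filter_upwards [h1, h2] with z h1 h2
    exact ⟨⟨mem_univ _, h2.le, (hDε _ _ h2.le h1.le).2.2⟩, h1.le⟩
  have hmax_y : IsLocalMax (fun z => F z s) y := by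
    have : ∀ᶠ z in 𝓝 y, (z, s) ∈ D :=
      (Continuous.continuousAt (f := fun z : S2 => (z, s)) (by fun_prop)).eventually hevD
    filter_upwards [this] with z hz using hmax hz
  have hmax_s : IsLocalMax (F y) s := by
    have : ∀ᶠ u in 𝓝 s, (y, u) ∈ D :=
      (Continuous.continuousAt (f := fun u : ℝ => (y, u)) (by fun_prop)).eventually hevD
    filter_upwards [this] with z hz using hmax hz
  have dL := (hLs.of_le (by norm_num)).hasDerivAt hyU hsI
  have es : (L m P y s + s * sDeriv 1 (L m P) y s) * χ y s + s * L m P y s * (-K) = 0 := by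
    have d1 := ((hasDerivAt_id s).mul dL).mul
      ((((hasDerivAt_id s).const_mul K).const_sub ((ρ ^ 2 - 2) + η y s)))
    have d2 : HasDerivAt (F y) _ s := d1
    have := hmax_s.hasDerivAt_eq_zero d2
    simp only [Pi.mul_apply, id, one_mul, mul_one] at this
    exact this
  have hsI' := Ioo_subset_Ico_self hsI
  have ey : ∀ i, s * (χ y s * sphPartial i (fun z => L m P z s) y +
      L m P y s * sphPartial i (fun z => η z s) y) = 0 := by
    intro i
    have d0 := (hLs.contDiffAt_radialExt hU hsI' hyU).differentiableAt (by norm_num)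
    have d1 := (hsLs.contDiffAt_radialExt hU hsI' hyU).differentiableAt (by norm_num)
    have d2 := (hχs.contDiffAt_radialExt hU hsI' hyU).differentiableAt (by norm_num)
    have d3 := (hη.contDiffAt_radialExt hU hsI' hyU).differentiableAt (by norm_num)
    have h1 := sphPartial_eq_zero_of_isLocalMax hmax_y i
    simp only [F] at h1
    rw [sphPartial_mul d1 d2, sphPartial_const_mul s d0] at h1
    have h2 : sphPartial i (fun z => χ z s) y = sphPartial i (fun z => η z s) y := by
      have h3 : (fun z => χ z s) = fun z => (ρ ^ 2 - 2 - K * s) + η z s := by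
        funext z
        simp only [χ]
        ring
      rw [h3, sphPartial_add (differentiableAt_const _) d3, sphPartial_const, zero_add]
    rw [h2] at h1
    linear_combination h1
  have esum : s * (χ y s * sphInner (fun z => P z s) (fun z => L m P z s) y +
      L m P y s * g y s) = 0 := by
    simp only [g, sphInner_eq_sum, Finset.mul_sum, ← Finset.sum_add_distrib]
    refine Finset.sum_eq_zero fun i _ => ?_
    linear_combination sphPartial i (fun z => P z s) y * ey i
  -- the equation eliminates the derivatives of `L` from the first order conditions
  have hform := meanCurv_formula hm hms hU hP hyU hsI hLp
  rw [hH y hyU s hsI, pow_succ, Real.sq_sqrt hLp.le, transportL] at hform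
  set μ := Real.sqrt (L m P y s)
  set A := radialFactor m P y s
  set B := boxTerm m P y s
  set Lv := L m P y s
  have hzero : Lv * (χ y s * (-5 * A + 6 * ψ y s * μ + 2 * s * B) + s * (-K * A + g y s)) = 0 := by
    linear_combination A * es + esum + χ y s * hform
  have hbr := (mul_eq_zero.1 hzero).resolve_left hLp.ne'
  have n1 : χ y s * (-5 * A + 6 * ψ y s * μ + 2 * s * B) < 0 :=
    mul_neg_of_pos_of_neg hχp (by linarith)
  have n2 : s * (-K * A + g y s) < 0 := mul_neg_of_pos_of_neg hs (by nlinarith)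
  linarith

end Schwarzschild

/-! ### Finite expansions at `s = 0` -/

/-- `φ(s) = a + b s + c s² + o(s²)` as `s → 0⁺`. -/
def Jet2 (φ : ℝ → ℝ) (a b c : ℝ) : Prop :=
  ∃ R : ℝ → ℝ, Tendsto R (𝓝[>] 0) (𝓝 c) ∧ ∀ᶠ s in 𝓝[>] 0, φ s = a + b * s + s ^ 2 * R s

/-- `φ(s) = a + b s + c s² + d s³ + o(s³)` as `s → 0⁺`. -/
def Jet3 (φ : ℝ → ℝ) (a b c d : ℝ) : Prop :=
  ∃ R : ℝ → ℝ, Tendsto R (𝓝[>] 0) (𝓝 d) ∧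
    ∀ᶠ s in 𝓝[>] 0, φ s = a + b * s + c * s ^ 2 + s ^ 3 * R s

theorem tendsto_id_nhdsGT_zero : Tendsto (fun s : ℝ => s) (𝓝[>] 0) (𝓝 0) :=
  tendsto_id.mono_left nhdsWithin_le_nhds

section Jets

variable {φ ψ : ℝ → ℝ} {a b c d a' b' c' d' : ℝ}

theorem Jet3.jet2 (h : Jet3 φ a b c d) : Jet2 φ a b c := by
  obtain ⟨R, hR, h⟩ := h
  refine ⟨fun s => c + s * R s, ?_, ?_⟩
  · simpa using (tendsto_id_nhdsGT_zero.mul hR).const_add c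
  · filter_upwards [h] with s hs
    rw [hs]
    ring

theorem Jet2.add (h : Jet2 φ a b c) (h' : Jet2 ψ a' b' c') :
    Jet2 (fun s => φ s + ψ s) (a + a') (b + b') (c + c') := by
  obtain ⟨R, hR, h⟩ := h
  obtain ⟨R', hR', h'⟩ := h'
  refine ⟨fun s => R s + R' s, hR.add hR', ?_⟩
  filter_upwards [h, h'] with s hs hs'
  rw [hs, hs']
  ring

theorem Jet3.add (h : Jet3 φ a b c d) (h' : Jet3 ψ a' b' c' d') :
    Jet3 (fun s => φ s + ψ s) (a + a') (b + b') (c + c') (d + d') := by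
  obtain ⟨R, hR, h⟩ := h
  obtain ⟨R', hR', h'⟩ := h'
  refine ⟨fun s => R s + R' s, hR.add hR', ?_⟩
  filter_upwards [h, h'] with s hs hs'
  rw [hs, hs']
  ring

theorem Jet2.mul (h : Jet2 φ a b c) (h' : Jet2 ψ a' b' c') :
    Jet2 (fun s => φ s * ψ s) (a * a') (a * b' + b * a') (a * c' + b * b' + c * a') := by
  obtain ⟨R, hR, h⟩ := h
  obtain ⟨R', hR', h'⟩ := h'
  have hs0 := tendsto_id_nhdsGT_zero
  refine ⟨fun s => a * R' s + b * b' + R s * a' + s * (b * R' s + R s * b' + s * (R s * R' s)),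
    ?_, ?_⟩
  · have h1 := (((hR'.const_mul a).add_const (b * b')).add (hR.mul_const a')).add
      (hs0.mul (((hR'.const_mul b).add (hR.mul_const b')).add (hs0.mul (hR.mul hR'))))
    simpa using h1
  · filter_upwards [h, h'] with s hs hs'
    rw [hs, hs']
    ring

theorem Jet3.mul (h : Jet3 φ a b c d) (h' : Jet3 ψ a' b' c' d') :
    Jet3 (fun s => φ s * ψ s) (a * a') (a * b' + b * a') (a * c' + b * b' + c * a')
      (a * d' + b * c' + c * b' + d * a') := by
  obtain ⟨R, hR, h⟩ := h
  obtain ⟨R', hR', h'⟩ := h'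
  have hs0 := tendsto_id_nhdsGT_zero
  refine ⟨fun s => a * R' s + (b * c' + c * b') + R s * a' +
    s * (b * R' s + c * c' + R s * b' + s * (c * R' s + R s * c' + s * (R s * R' s))), ?_, ?_⟩
  · have h1 := (((hR'.const_mul a).add_const (b * c' + c * b')).add (hR.mul_const a')).add
      (hs0.mul ((((hR'.const_mul b).add_const (c * c')).add (hR.mul_const b')).add
        (hs0.mul (((hR'.const_mul c).add (hR.mul_const c')).add (hs0.mul (hR.mul hR'))))))
    convert! h1 using 2
    ring
  · filter_upwards [h, h'] with s hs hs'
    rw [hs, hs']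
    ring

theorem Jet2.const_mul (k : ℝ) (h : Jet2 φ a b c) :
    Jet2 (fun s => k * φ s) (k * a) (k * b) (k * c) := by
  obtain ⟨R, hR, h⟩ := h
  refine ⟨fun s => k * R s, hR.const_mul k, ?_⟩
  filter_upwards [h] with s hs
  rw [hs]
  ring

theorem Jet3.const_mul (k : ℝ) (h : Jet3 φ a b c d) :
    Jet3 (fun s => k * φ s) (k * a) (k * b) (k * c) (k * d) := by
  obtain ⟨R, hR, h⟩ := h
  refine ⟨fun s => k * R s, hR.const_mul k, ?_⟩
  filter_upwards [h] with s hs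
  rw [hs]
  ring

theorem jet2_const (k : ℝ) : Jet2 (fun _ => k) k 0 0 :=
  ⟨fun _ => 0, tendsto_const_nhds, Eventually.of_forall fun s => by ring⟩

theorem Jet2.sum {ι : Type} (t : Finset ι) {φ : ι → ℝ → ℝ} {a b c : ι → ℝ}
    (h : ∀ i ∈ t, Jet2 (φ i) (a i) (b i) (c i)) :
    Jet2 (fun s => ∑ i ∈ t, φ i s) (∑ i ∈ t, a i) (∑ i ∈ t, b i) (∑ i ∈ t, c i) := by
  classical
  induction t using Finset.induction_on with
  | empty => simpa using jet2_const 0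
  | insert i t hi ih =>
    simp only [Finset.sum_insert hi]
    exact (h i (Finset.mem_insert_self i t)).add
      (ih fun j hj => h j (Finset.mem_insert_of_mem hj))

theorem Jet3.polynomial (a b c d : ℝ) :
    Jet3 (fun s => a + b * s + c * s ^ 2 + d * s ^ 3) a b c d :=
  ⟨fun _ => d, tendsto_const_nhds, Eventually.of_forall fun s => by ring⟩

theorem Jet2.id_mul (h : Jet2 φ a b c) : Jet3 (fun s => s * φ s) 0 a b c := by
  obtain ⟨R, hR, h⟩ := h
  refine ⟨R, hR, ?_⟩
  filter_upwards [h] with s hs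
  rw [hs]
  ring

theorem Jet3.congr (h : Jet3 φ a b c d) (h' : ∀ᶠ s in 𝓝[>] 0, ψ s = φ s) : Jet3 ψ a b c d := by
  obtain ⟨R, hR, h⟩ := h
  refine ⟨R, hR, ?_⟩
  filter_upwards [h, h'] with s hs hs'
  rw [hs', hs]

theorem Jet2.congr (h : Jet2 φ a b c) (h' : ∀ᶠ s in 𝓝[>] 0, ψ s = φ s) : Jet2 ψ a b c := by
  obtain ⟨R, hR, h⟩ := h
  refine ⟨R, hR, ?_⟩
  filter_upwards [h, h'] with s hs hs'
  rw [hs', hs]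

/-- Two expansions of the same function have the same constant term, and their remainders
agree. -/
theorem eq_of_add_id_mul {R R' : ℝ → ℝ} {r r' : ℝ} (hR : Tendsto R (𝓝[>] 0) (𝓝 r))
    (hR' : Tendsto R' (𝓝[>] 0) (𝓝 r')) (h : ∀ᶠ s in 𝓝[>] 0, a + s * R s = a' + s * R' s) :
    a = a' ∧ ∀ᶠ s in 𝓝[>] 0, R s = R' s := by
  have hs0 := tendsto_id_nhdsGT_zero
  have h1 : Tendsto (fun s => a + s * R s) (𝓝[>] 0) (𝓝 a) := by
    simpa using (hs0.mul hR).const_add a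
  have h2 : Tendsto (fun s => a' + s * R' s) (𝓝[>] 0) (𝓝 a') := by
    simpa using (hs0.mul hR').const_add a'
  have ha : a = a' := tendsto_nhds_unique (h1.congr' h) h2
  refine ⟨ha, ?_⟩
  filter_upwards [h, self_mem_nhdsWithin] with s hs hs0
  have : s * R s = s * R' s := by linarith
  exact mul_left_cancel₀ (ne_of_gt hs0) this

theorem Jet2.unique (h : Jet2 φ a b c) (h' : Jet2 φ a' b' c') : a = a' ∧ b = b' ∧ c = c' := by
  obtain ⟨R, hR, h⟩ := h
  obtain ⟨R', hR', h'⟩ := h'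
  have hs0 := tendsto_id_nhdsGT_zero
  obtain ⟨e0, h1⟩ := eq_of_add_id_mul (a := a) (a' := a') (R := fun s => b + s * R s)
    (R' := fun s => b' + s * R' s) ((hs0.mul hR).const_add b) ((hs0.mul hR').const_add b') (by
      filter_upwards [h, h'] with s hs hs'
      linarith)
  obtain ⟨e1, h2⟩ := eq_of_add_id_mul hR hR' h1
  exact ⟨e0, e1, tendsto_nhds_unique (hR.congr' h2) hR'⟩

theorem Jet3.unique (h : Jet3 φ a b c d) (h' : Jet3 φ a' b' c' d') :
    a = a' ∧ b = b' ∧ c = c' ∧ d = d' := by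
  obtain ⟨e0, e1, e2⟩ := h.jet2.unique h'.jet2
  subst e0 e1 e2
  obtain ⟨R, hR, h⟩ := h
  obtain ⟨R', hR', h'⟩ := h'
  refine ⟨rfl, rfl, rfl, tendsto_nhds_unique (hR.congr' ?_) hR'⟩
  filter_upwards [h, h', self_mem_nhdsWithin] with s hs hs' hs0
  have h3 : s ^ 3 * R s = s ^ 3 * R' s := by linarith
  exact mul_left_cancel₀ (pow_ne_zero 3 (ne_of_gt hs0)) h3

end Jets

section SmoothJets

variable {U : Set S2} {s₀ : ℝ} {φ ψ : S2 → ℝ → ℝ} {y : S2}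

theorem SmoothUpToBoundary.tendsto {n : WithTop ℕ∞} (hs₀ : 0 < s₀)
    (h : SmoothUpToBoundary n U s₀ φ) (hy : y ∈ U) : Tendsto (φ y) (𝓝[>] 0) (𝓝 (φ y 0)) := by
  rw [← nhdsWithin_Ioo_eq_nhdsGT hs₀]
  exact ((h.contDiffOn_fiber hy).continuousOn 0 ⟨le_rfl, hs₀⟩).mono_left
    (nhdsWithin_mono _ Ioo_subset_Ico_self)

theorem sDeriv_eq_Ico (hs₀ : 0 < s₀) (k : ℕ) :
    iteratedDerivWithin k (φ y) (Ico 0 s₀) 0 = sDeriv k φ y 0 := by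
  rw [sDeriv, iteratedDerivWithin, iteratedDerivWithin,
    iteratedFDerivWithin_congr_set (Ico_eventuallyEq_Ici hs₀)]

theorem sDeriv_zero (φ : S2 → ℝ → ℝ) (y : S2) (s : ℝ) : sDeriv 0 φ y s = φ y s := by
  simp [sDeriv]

theorem SmoothUpToBoundary.jet2 (hs₀ : 0 < s₀) (h : SmoothUpToBoundary 2 U s₀ φ) (hy : y ∈ U) :
    Jet2 (φ y) (φ y 0) (sDeriv 1 φ y 0) (sDeriv 2 φ y 0 / 2) := by
  have h1 := Real.taylor_tendsto (n := 2) (convex_Ico 0 s₀) ⟨le_rfl, hs₀⟩ (h.contDiffOn_fiber hy)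
  have h2 := (h1.mono_left (nhdsWithin_mono _ Ioo_subset_Ico_self)).add_const (sDeriv 2 φ y 0 / 2)
  rw [nhdsWithin_Ioo_eq_nhdsGT hs₀, zero_add] at h2
  refine ⟨_, h2, ?_⟩
  filter_upwards [self_mem_nhdsWithin] with s hs
  have hs' : s ≠ 0 := ne_of_gt hs
  simp only [taylor_within_apply, Finset.sum_range_succ, Finset.sum_range_zero, sDeriv_eq_Ico hs₀,
    sDeriv_zero]
  simp
  field_simp
  ring

theorem SmoothUpToBoundary.jet3 (hs₀ : 0 < s₀) (h : SmoothUpToBoundary 3 U s₀ φ) (hy : y ∈ U) :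
    Jet3 (φ y) (φ y 0) (sDeriv 1 φ y 0) (sDeriv 2 φ y 0 / 2) (sDeriv 3 φ y 0 / 6) := by
  have h1 := Real.taylor_tendsto (n := 3) (convex_Ico 0 s₀) ⟨le_rfl, hs₀⟩ (h.contDiffOn_fiber hy)
  have h2 := (h1.mono_left (nhdsWithin_mono _ Ioo_subset_Ico_self)).add_const (sDeriv 3 φ y 0 / 6)
  rw [nhdsWithin_Ioo_eq_nhdsGT hs₀, zero_add] at h2
  refine ⟨_, h2, ?_⟩
  filter_upwards [self_mem_nhdsWithin] with s hs
  have hs' : s ≠ 0 := ne_of_gt hs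
  simp only [taylor_within_apply, Finset.sum_range_succ, Finset.sum_range_zero, sDeriv_eq_Ico hs₀,
    sDeriv_zero]
  simp [Nat.factorial]
  field_simp
  ring

/-- Expansion to second order in `s`, with a remainder that is differentiable in all variables. -/
theorem exists_second_order_remainder (hU : IsOpen U) (hs₀ : 0 < s₀) {n : ℕ∞}
    (h : SmoothUpToBoundary (n + 2) U s₀ φ) :
    ∃ ψ, SmoothUpToBoundary n U s₀ ψ ∧ (∀ y ∈ U, ψ y 0 = sDeriv 2 φ y 0 / 2) ∧
      ∀ y ∈ U, ∀ s ∈ Ico 0 s₀, φ y s = φ y 0 + s * sDeriv 1 φ y 0 + s ^ 2 * ψ y s := by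
  have h1 : SmoothUpToBoundary ((n + 1 : ℕ∞) : WithTop ℕ∞) U s₀ (sQuot U s₀ φ) := by
    apply SmoothUpToBoundary.sQuot hU
    push_cast
    rwa [add_assoc, one_add_one_eq_two]
  have h2 : SmoothUpToBoundary n U s₀ (sQuot U s₀ (sQuot U s₀ φ)) := by
    apply SmoothUpToBoundary.sQuot hU
    exact_mod_cast h1
  have e : ∀ y ∈ U, ∀ s ∈ Ico 0 s₀, φ y s = φ y 0 + s * sQuot U s₀ φ y 0 +
      s ^ 2 * sQuot U s₀ (sQuot U s₀ φ) y s := by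
    intro y hy s hs
    have e1 := eq_add_mul_sQuot hU (h.of_le (by
      have : (1 : WithTop ℕ∞) ≤ 2 := by norm_num
      exact this.trans le_add_self)) hy hs
    have e2 := eq_add_mul_sQuot hU (h1.of_le (by push_cast; exact le_add_self)) hy hs
    rw [e1, e2]
    ring
  have key : ∀ y ∈ U, sQuot U s₀ φ y 0 = sDeriv 1 φ y 0 ∧
      sQuot U s₀ (sQuot U s₀ φ) y 0 = sDeriv 2 φ y 0 / 2 := by
    intro y hy
    have j1 := (h.of_le (le_add_self)).jet2 hs₀ hy
    have j2 : Jet2 (φ y) (φ y 0) (sQuot U s₀ φ y 0) (sQuot U s₀ (sQuot U s₀ φ) y 0) := by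
      refine ⟨_, h2.tendsto hs₀ hy, ?_⟩
      filter_upwards [Ioo_mem_nhdsGT hs₀] with s hs
      rw [e y hy s (Ioo_subset_Ico_self hs)]
      ring
    exact (j2.unique j1).2
  refine ⟨_, h2, fun y hy => (key y hy).2, fun y hy s hs => ?_⟩
  rw [e y hy s hs, (key y hy).1]

theorem SmoothUpToBoundary.sDeriv_two {n : WithTop ℕ∞} (hU : IsOpen U)
    (h : SmoothUpToBoundary (n + 2) U s₀ φ) : SmoothUpToBoundary n U s₀ (sDeriv 2 φ) := by
  have e : sDeriv 2 φ = sDeriv 1 (sDeriv 1 φ) := funext fun y => funext fun s => sDeriv_succ 1 φ y s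
  rw [e]
  refine SmoothUpToBoundary.sDeriv_one hU (SmoothUpToBoundary.sDeriv_one hU ?_)
  rwa [add_assoc, one_add_one_eq_two]

theorem SmoothUpToBoundary.jet2_sphPartial (hU : IsOpen U) (hs₀ : 0 < s₀)
    (h : SmoothUpToBoundary 3 U s₀ φ) (hy : y ∈ U) (i : Fin 3) :
    Jet2 (fun s => _root_.sphPartial i (fun z => φ z s) y) (_root_.sphPartial i (fun z => φ z 0) y)
      (_root_.sphPartial i (fun z => sDeriv 1 φ z 0) y)
      ((1 / 2) * _root_.sphPartial i (fun z => sDeriv 2 φ z 0) y) := by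
  obtain ⟨ψ, hψ, hψ0, e⟩ := exists_second_order_remainder hU hs₀ (n := 1)
    (φ := φ) (by exact_mod_cast h)
  have h0 : (0 : ℝ) ∈ Ico 0 s₀ := ⟨le_rfl, hs₀⟩
  have d0 := (h.contDiffAt_radialExt hU h0 hy).differentiableAt (by norm_num)
  have hd1 : SmoothUpToBoundary 2 U s₀ (sDeriv 1 φ) :=
    SmoothUpToBoundary.sDeriv_one hU (h.of_le (by norm_num))
  have d1 := (hd1.contDiffAt_radialExt hU h0 hy).differentiableAt (by norm_num)
  have hd2 : SmoothUpToBoundary 1 U s₀ (sDeriv 2 φ) :=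
    SmoothUpToBoundary.sDeriv_two hU (h.of_le (by norm_num))
  have d2 := (hd2.contDiffAt_radialExt hU h0 hy).differentiableAt (by norm_num)
  have hlim : _root_.sphPartial i (fun z => ψ z 0) y =
      (1 / 2) * _root_.sphPartial i (fun z => sDeriv 2 φ z 0) y := by
    rw [← sphPartial_const_mul _ d2]
    exact sphPartial_congr hU (fun z hz => by rw [hψ0 z hz]; ring) hy i
  rw [← hlim]
  refine ⟨fun s => _root_.sphPartial i (fun z => ψ z s) y,
    (SmoothUpToBoundary.sphPartial (n := 0) hU (by exact_mod_cast hψ) i).tendsto hs₀ hy, ?_⟩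
  filter_upwards [Ioo_mem_nhdsGT hs₀] with s hs
  have hs' := Ioo_subset_Ico_self hs
  have d3 := (hψ.contDiffAt_radialExt hU hs' hy).differentiableAt (by norm_num)
  rw [sphPartial_congr hU (fun z hz => e z hz s hs') hy i,
    sphPartial_add (f := fun z => φ z 0 + s * sDeriv 1 φ z 0) (k := fun z => s ^ 2 * ψ z s)
      (d0.add (d1.const_mul s)) (d3.const_mul (s ^ 2)),
    sphPartial_add (f := fun z => φ z 0) (k := fun z => s * sDeriv 1 φ z 0) d0 (d1.const_mul s),
    sphPartial_const_mul s d1, sphPartial_const_mul _ d3]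
  ring

theorem SmoothUpToBoundary.jet2_sphLap (hU : IsOpen U) (hs₀ : 0 < s₀)
    (h : SmoothUpToBoundary 4 U s₀ φ) (hy : y ∈ U) :
    Jet2 (fun s => _root_.sphLap (fun z => φ z s) y) (_root_.sphLap (fun z => φ z 0) y)
      (_root_.sphLap (fun z => sDeriv 1 φ z 0) y)
      ((1 / 2) * _root_.sphLap (fun z => sDeriv 2 φ z 0) y) := by
  obtain ⟨ψ, hψ, hψ0, e⟩ := exists_second_order_remainder hU hs₀ (n := 2)
    (φ := φ) (by exact_mod_cast h)
  have h0 : (0 : ℝ) ∈ Ico 0 s₀ := ⟨le_rfl, hs₀⟩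
  have d0 := (h.contDiffAt_radialExt hU h0 hy).of_le (show (2 : WithTop ℕ∞) ≤ 4 by norm_num)
  have hd1 : SmoothUpToBoundary 3 U s₀ (sDeriv 1 φ) :=
    SmoothUpToBoundary.sDeriv_one hU (h.of_le (by norm_num))
  have d1 := (hd1.contDiffAt_radialExt hU h0 hy).of_le (show (2 : WithTop ℕ∞) ≤ 3 by norm_num)
  have hd2 : SmoothUpToBoundary 2 U s₀ (sDeriv 2 φ) :=
    SmoothUpToBoundary.sDeriv_two hU (h.of_le (by norm_num))
  have d2 := hd2.contDiffAt_radialExt hU h0 hy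
  have hlim : _root_.sphLap (fun z => ψ z 0) y =
      (1 / 2) * _root_.sphLap (fun z => sDeriv 2 φ z 0) y := by
    rw [← sphLap_const_mul _ d2]
    exact sphLap_congr hU (fun z hz => by rw [hψ0 z hz]; ring) hy
  rw [← hlim]
  refine ⟨fun s => _root_.sphLap (fun z => ψ z s) y,
    (SmoothUpToBoundary.sphLap (n := 0) hU (by exact_mod_cast hψ)).tendsto hs₀ hy, ?_⟩
  filter_upwards [Ioo_mem_nhdsGT hs₀] with s hs
  have hs' := Ioo_subset_Ico_self hs
  have d3 : ContDiffAt ℝ 2 _ (y : E3) := hψ.contDiffAt_radialExt hU hs' hy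
  rw [sphLap_congr hU (fun z hz => e z hz s hs') hy,
    sphLap_add (f := fun z => φ z 0 + s * sDeriv 1 φ z 0) (k := fun z => s ^ 2 * ψ z s)
      (d0.add (contDiffAt_const.mul d1)) (contDiffAt_const.mul d3),
    sphLap_add (f := fun z => φ z 0) (k := fun z => s * sDeriv 1 φ z 0) d0
      (contDiffAt_const.mul d1), sphLap_const_mul s d1, sphLap_const_mul _ d3]
  ring

theorem jet2_sphInner (hU : IsOpen U) (hs₀ : 0 < s₀) (hφ : SmoothUpToBoundary 3 U s₀ φ)
    (hψ : SmoothUpToBoundary 3 U s₀ ψ) (hy : y ∈ U) :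
    Jet2 (fun s => sphInner (fun z => φ z s) (fun z => ψ z s) y)
      (sphInner (fun z => φ z 0) (fun z => ψ z 0) y)
      (sphInner (fun z => φ z 0) (fun z => sDeriv 1 ψ z 0) y +
        sphInner (fun z => sDeriv 1 φ z 0) (fun z => ψ z 0) y)
      ((1 / 2) * sphInner (fun z => φ z 0) (fun z => sDeriv 2 ψ z 0) y +
        sphInner (fun z => sDeriv 1 φ z 0) (fun z => sDeriv 1 ψ z 0) y +
        (1 / 2) * sphInner (fun z => sDeriv 2 φ z 0) (fun z => ψ z 0) y) := by
  have h := Jet2.sum Finset.univ fun i _ =>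
    (hφ.jet2_sphPartial hU hs₀ hy i).mul (hψ.jet2_sphPartial hU hs₀ hy i)
  simp only [sphInner_eq_sum]
  convert! h using 1
  · rw [← Finset.sum_add_distrib]
  · rw [Finset.mul_sum, Finset.mul_sum, ← Finset.sum_add_distrib, ← Finset.sum_add_distrib]
    refine Finset.sum_congr rfl fun i _ => ?_
    ring

end SmoothJets

/-! ### The expansion of the mean curvature equation -/

section SphereInner

variable {U : Set S2} {f f' k k' : S2 → ℝ} {y : S2}

theorem sphInner_comm (f k : S2 → ℝ) (y : S2) : sphInner f k y = sphInner k f y :=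
  real_inner_comm _ _

theorem sphInner_congr (hU : IsOpen U) (hf : ∀ z ∈ U, f z = f' z) (hk : ∀ z ∈ U, k z = k' z)
    (hy : y ∈ U) : sphInner f k y = sphInner f' k' y := by
  simp only [sphInner_eq_sum, sphPartial_congr hU hf hy, sphPartial_congr hU hk hy]

theorem sphInner_const_right (f : S2 → ℝ) (c : ℝ) (y : S2) : sphInner f (fun _ => c) y = 0 := by
  simp [sphInner_eq_sum, sphPartial_const]

theorem sphInner_const_mul_right (f : S2 → ℝ) (c : ℝ)
    (hk : DifferentiableAt ℝ (radialExt k) (y : E3)) :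
    sphInner f (fun z => c * k z) y = c * sphInner f k y := by
  simp only [sphInner_eq_sum, sphPartial_const_mul c hk, Finset.mul_sum]
  exact Finset.sum_congr rfl fun i _ => by ring

end SphereInner

theorem Jet3.congr_coeff {φ : ℝ → ℝ} {a b c d a' b' c' d' : ℝ} (h : Jet3 φ a b c d) (ha : a' = a)
    (hb : b' = b) (hc : c' = c) (hd : d' = d) : Jet3 φ a' b' c' d' := by
  rwa [ha, hb, hc, hd]

namespace Schwarzschild

variable {U : Set S2} {s₀ : ℝ} {m : ℝ} {P : S2 → ℝ → ℝ}

theorem L_zero (m : ℝ) (P : S2 → ℝ → ℝ) (y : S2) :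
    L m P y 0 = -(2 * sDeriv 1 P y 0 + sphGradSq (fun z => P z 0) y) := by
  rw [L_eq]
  ring

/-- The `s`-derivatives of `L` at the boundary, in terms of those of `P`. -/
theorem sDeriv_L (hU : IsOpen U) (hs₀ : 0 < s₀) (hP : SmoothUpToBoundary 4 U s₀ P) {y : S2}
    (hy : y ∈ U) :
    sDeriv 1 (L m P) y 0 =
      -(2 * sDeriv 2 P y 0 + 2 * sphInner (fun z => P z 0) (fun z => sDeriv 1 P z 0) y) ∧
    sDeriv 2 (L m P) y 0 = -2 * (sDeriv 3 P y 0 + sDeriv 1 P y 0 ^ 2 +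
      sphInner (fun z => P z 0) (fun z => sDeriv 2 P z 0) y +
      sphGradSq (fun z => sDeriv 1 P z 0) y) := by
  have hP3 : SmoothUpToBoundary 3 U s₀ P := hP.of_le (by norm_num)
  have hd1 : SmoothUpToBoundary 3 U s₀ (sDeriv 1 P) :=
    SmoothUpToBoundary.sDeriv_one hU (hP.of_le (by norm_num))
  have hL : SmoothUpToBoundary 3 U s₀ (L m P) := smooth_L hU (hP.of_le (by norm_num))
  have j1 := (hd1.of_le (show (2 : WithTop ℕ∞) ≤ 3 by norm_num)).jet2 hs₀ hy
  have jq := (Jet3.polynomial 0 0 1 (-2 * m)).jet2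
  have jI := jet2_sphInner hU hs₀ hP3 hP3 hy
  have jL := (hL.of_le (show (2 : WithTop ℕ∞) ≤ 3 by norm_num)).jet2 hs₀ hy
  have j := (((j1.const_mul 2).add (jq.mul (j1.mul j1))).add jI).const_mul (-1)
  have j' := jL.unique (j.congr (Eventually.of_forall fun s => by
    rw [L_eq, sphGradSq]
    ring))
  rw [← sDeriv_succ, ← sDeriv_succ] at j'
  obtain ⟨-, h1, h2⟩ := j'
  rw [sphInner_comm (fun z => sDeriv 1 P z 0)] at h1
  rw [sphInner_comm (fun z => sDeriv 2 P z 0)] at h2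
  refine ⟨by linear_combination h1, ?_⟩
  rw [sphGradSq]
  linear_combination 2 * h2

/-- `6 (√L)³ (H - H₀)`, as an expression that makes sense up to the boundary. -/
def defect (m H₀ : ℝ) (P : S2 → ℝ → ℝ) (y : S2) (s : ℝ) : ℝ :=
  6 * (radialFactor m P y s * L m P y s) - 6 * H₀ * Real.sqrt (L m P y s) ^ 3 +
    s * (transportL m P y s - 2 * (L m P y s * boxTerm m P y s))

theorem meanCurv_sub_eq (hm : 0 ≤ m) (hms : 2 * m * s₀ ≤ 1) (hU : IsOpen U)
    (hP : SmoothUpToBoundary 4 U s₀ P) (H₀ : ℝ) {y : S2} (hy : y ∈ U) {s : ℝ} (hs : s ∈ Ioo 0 s₀)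
    (hL : 0 < L m P y s) :
    defect m H₀ P y s = 6 * Real.sqrt (L m P y s) ^ 3 * (meanCurv m P y s - H₀) := by
  rw [defect]
  linear_combination -meanCurv_formula hm hms hU hP hy hs hL

/-- If the mean curvature tends to `H₀` and `L` is positive at the boundary, then `L = H₀⁻²`
there. -/
theorem L_zero_of_tendsto (hm : 0 ≤ m) (hms : 2 * m * s₀ ≤ 1) (hs₀ : 0 < s₀) (hU : IsOpen U)
    (hP : SmoothUpToBoundary 4 U s₀ P) {H₀ : ℝ} (hH₀ : 0 < H₀)
    (hL : ∀ y ∈ U, ∀ s ∈ Ico 0 s₀, 0 < L m P y s) {y : S2} (hy : y ∈ U)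
    (hH : Tendsto (fun s => meanCurv m P y s) (𝓝[>] 0) (𝓝 H₀)) :
    L m P y 0 = (H₀ ^ 2)⁻¹ := by
  have hLs : SmoothUpToBoundary 3 U s₀ (L m P) := smooth_L hU (hP.of_le (by norm_num))
  have hA := (smooth_radialFactor (n := 3) (m := m) hU (hP.of_le (by norm_num))).tendsto hs₀ hy
  have hB := (smooth_boxTerm (n := 2) (m := m) hU (hP.of_le (by norm_num))).tendsto hs₀ hy
  have hT := (smooth_transportL (n := 2) (m := m) hU (hP.of_le (by norm_num))).tendsto hs₀ hy
  have hl := hLs.tendsto hs₀ hy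
  have h1 : Tendsto (defect m H₀ P y) (𝓝[>] 0) (𝓝 (defect m H₀ P y 0)) :=
    (((hA.mul hl).const_mul 6).sub ((hl.sqrt.pow 3).const_mul (6 * H₀))).add
      (tendsto_id_nhdsGT_zero.mul (hT.sub ((hl.mul hB).const_mul 2)))
  have h2 := ((hl.sqrt.pow 3).const_mul 6).mul (hH.sub_const H₀)
  have h3 : defect m H₀ P y 0 = _ := tendsto_nhds_unique (h1.congr' (by
    filter_upwards [Ioo_mem_nhdsGT hs₀] with s hs
    exact meanCurv_sub_eq hm hms hU hP H₀ hy hs (hL y hy s (Ioo_subset_Ico_self hs)))) h2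
  have hpos := Real.sqrt_pos.2 (hL y hy 0 ⟨le_rfl, hs₀⟩)
  have hsq := Real.sq_sqrt (hL y hy 0 ⟨le_rfl, hs₀⟩).le
  have hA0 : radialFactor m P y 0 = 1 := by simp [radialFactor]
  rw [defect, hA0] at h3
  set μ := Real.sqrt (L m P y 0)
  have h4 : μ ^ 2 * (1 - H₀ * μ) = 0 := by
    rw [← hsq] at h3
    linear_combination h3 / 6
  have h5 : H₀ * μ = 1 := by
    rcases mul_eq_zero.1 h4 with h | h
    · exact absurd h (by positivity)
    · linarith
  rw [← hsq]
  field_simp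
  linear_combination (H₀ * μ + 1) * h5

/-- The expansion at the boundary of the mean curvature equation, when `L = H₀⁻²` there. The third
`s`-derivative of `L` drops out. -/
theorem jet3_defect (hs₀ : 0 < s₀) (hU : IsOpen U)
    (hP : SmoothUpToBoundary 4 U s₀ P) {H₀ : ℝ} (hH₀ : 0 < H₀)
    (hL : ∀ y ∈ U, ∀ s ∈ Ico 0 s₀, 0 < L m P y s) (hL0 : ∀ y ∈ U, L m P y 0 = (H₀ ^ 2)⁻¹)
    {y : S2} (hy : y ∈ U) {p₁ p₂ l₁ l₂ Δ₀ Δ₁ Δ₂ I₁ I₂ I₁₁ : ℝ}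
    (hp₁ : sDeriv 1 P y 0 = p₁) (hp₂ : sDeriv 2 P y 0 = p₂)
    (hl₁ : sDeriv 1 (L m P) y 0 = l₁) (hl₂ : sDeriv 2 (L m P) y 0 = l₂)
    (hΔ₀ : sphLap (fun z => P z 0) y = Δ₀) (hΔ₁ : sphLap (fun z => sDeriv 1 P z 0) y = Δ₁)
    (hΔ₂ : sphLap (fun z => sDeriv 2 P z 0) y = Δ₂)
    (hI₁ : sphInner (fun z => P z 0) (fun z => sDeriv 1 (L m P) z 0) y = I₁)
    (hI₂ : sphInner (fun z => P z 0) (fun z => sDeriv 2 (L m P) z 0) y = I₂)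
    (hI₁₁ : sphInner (fun z => sDeriv 1 P z 0) (fun z => sDeriv 1 (L m P) z 0) y = I₁₁) :
    Jet3 (defect m H₀ P y) 0 (-2 * l₁ - 2 * (H₀ ^ 2)⁻¹ * Δ₀)
      (-(1 / 2) * l₂ + 2 * (H₀ ^ 2)⁻¹ * p₁ - 9 / 4 * H₀ ^ 2 * l₁ ^ 2 + I₁ -
        2 * (H₀ ^ 2)⁻¹ * Δ₁ - 2 * l₁ * Δ₀)
      (-(9 / 4) * H₀ ^ 2 * l₁ * l₂ + 3 / 8 * H₀ ^ 4 * l₁ ^ 3 + 3 * p₁ * l₁ + 1 / 2 * I₂ + I₁₁ -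
        (H₀ ^ 2)⁻¹ * Δ₂ - 2 * l₁ * Δ₁ - l₂ * Δ₀) := by
  have hLs : SmoothUpToBoundary 3 U s₀ (L m P) := smooth_L hU (hP.of_le (by norm_num))
  have hP3 : SmoothUpToBoundary 3 U s₀ P := hP.of_le (by norm_num)
  have hd1 : SmoothUpToBoundary 3 U s₀ (sDeriv 1 P) :=
    SmoothUpToBoundary.sDeriv_one hU (hP.of_le (by norm_num))
  have hd2 : SmoothUpToBoundary 2 U s₀ (sDeriv 2 P) :=
    SmoothUpToBoundary.sDeriv_two hU (hP.of_le (by norm_num))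
  have hdL : SmoothUpToBoundary 2 U s₀ (sDeriv 1 (L m P)) :=
    SmoothUpToBoundary.sDeriv_one hU (hLs.of_le (by norm_num))
  have j1 := hd1.jet3 hs₀ hy
  have j2 := hd2.jet2 hs₀ hy
  have jL := hLs.jet3 hs₀ hy
  have jdL := hdL.jet2 hs₀ hy
  rw [hp₁, (sDeriv_succ 1 P y 0).symm.trans hp₂] at j1
  rw [hp₂] at j2
  rw [hl₁, (sDeriv_succ 1 (L m P) y 0).symm.trans hl₂,
    show sDeriv 2 (sDeriv 1 (L m P)) y 0 = sDeriv 3 (L m P) y 0 from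
      (sDeriv_succ 2 (L m P) y 0).symm] at jdL
  have jμ := (hLs.sqrt fun y hy s hs => (hL y hy s hs).ne').jet3 hs₀ hy
  have jLap := hP.jet2_sphLap hU hs₀ hy
  have jI := jet2_sphInner hU hs₀ hP3 hLs hy
  have hz : ∀ k : S2 → ℝ, sphInner k (fun z => L m P z 0) y = 0 := fun k => by
    rw [sphInner_congr hU (fun _ _ => rfl) hL0 hy, sphInner_const_right]
  rw [hz, hz, hz, hI₁, hI₂, hI₁₁] at jI
  rw [hΔ₀, hΔ₁, hΔ₂] at jLap
  rw [hl₁, hl₂] at jL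
  have jA := (Jet3.polynomial 1 0 0 0).add ((Jet3.polynomial 0 0 1 (-2 * m)).mul j1)
  have jB := (((Jet3.polynomial 0 2 (-6 * m) 0).jet2.mul j1.jet2).add
    ((Jet3.polynomial 0 0 1 (-2 * m)).jet2.mul j2)).add jLap
  have hμ0 : Real.sqrt (L m P y 0) = H₀⁻¹ := by
    rw [hL0 y hy, ← inv_pow, Real.sqrt_sq (inv_nonneg.2 hH₀.le)]
  rw [hμ0] at jμ
  rw [hL0 y hy] at jL
  -- the coefficients of `L` are those of the square of `√L`
  obtain ⟨-, r₁, r₂, r₃⟩ := jL.unique ((jμ.mul jμ).congr (by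
    filter_upwards [Ioo_mem_nhdsGT hs₀] with s hs
    exact (Real.mul_self_sqrt (hL y hy s (Ioo_subset_Ico_self hs)).le).symm))
  have jT := ((jA.jet2.mul jdL).add jI).add ((jL.jet2.mul jB).const_mul (-2))
  have j := (((jA.mul jL).const_mul 6).add
    (((jμ.mul jμ).mul jμ).const_mul (-6 * H₀))).add jT.id_mul
  generalize sDeriv 1 (fun y s => Real.sqrt (L m P y s)) y 0 = μ₁ at *
  generalize sDeriv 2 (fun y s => Real.sqrt (L m P y s)) y 0 / 2 = μ₂ at *
  generalize sDeriv 3 (fun y s => Real.sqrt (L m P y s)) y 0 / 6 = μ₃ at *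
  generalize hl₃ : sDeriv 3 (L m P) y 0 = l₃ at *
  have h₃ : l₃ = 6 * (H₀⁻¹ * μ₃ + μ₁ * μ₂ + μ₂ * μ₁ + μ₃ * H₀⁻¹) := by linear_combination 6 * r₃
  have h₂ : l₂ = 2 * (H₀⁻¹ * μ₂ + μ₁ * μ₁ + μ₂ * H₀⁻¹) := by linear_combination 2 * r₂
  refine (j.congr (Eventually.of_forall fun s => ?_)).congr_coeff ?_ ?_ ?_ ?_
  · rw [defect, transportL, boxTerm, radialFactor]
    ring
  · field_simp
    ring
  · rw [r₁]
    field_simp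
    ring
  · rw [h₂, r₁]
    field_simp
    ring
  · rw [h₃, h₂, r₁]
    field_simp
    ring

end Schwarzschild

/-! ### The boundary formulas -/

section Remainders

variable {U : Set S2} {s₀ : ℝ} {y : S2}

/-- A function of the form `s³ R` with `R` convergent as `s → 0⁺` has no terms of order below
three. -/
theorem jet3_of_pow_three {φ R : ℝ → ℝ} {r : ℝ} (hR : Tendsto R (𝓝[>] 0) (𝓝 r))
    (h : ∀ᶠ s in 𝓝[>] 0, φ s = s ^ 3 * R s) : Jet3 φ 0 0 0 r := by
  refine ⟨R, hR, h.mono fun s hs => ?_⟩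
  rw [hs]
  ring

/-- The extra factor `s` is absorbed into the extension, which then vanishes at the boundary. -/
theorem IsBoundaryO.exists_eq_pow_mul {k : ℕ} {φ : S2 → ℝ → ℝ} (h : IsBoundaryO 0 (k + 1) U s₀ φ) :
    ∃ ψ : S2 → ℝ → ℝ, SmoothUpToBoundary 0 U s₀ ψ ∧ (∀ y, ψ y 0 = 0) ∧
      ∀ y ∈ U, ∀ s ∈ Ioo 0 s₀, φ y s = s ^ k * ψ y s := by
  obtain ⟨ψ, hψ, h⟩ := h
  refine ⟨fun y s => s * ψ y s, (SmoothUpToBoundary.of_contDiff contDiff_id).mul hψ,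
    fun y => zero_mul _, fun y hy s hs => ?_⟩
  rw [h y hy s hs]
  ring

theorem IsBoundaryO.tendsto_zero (hs₀ : 0 < s₀) {n : WithTop ℕ∞} {k : ℕ} {φ : S2 → ℝ → ℝ}
    (h : IsBoundaryO n (k + 1) U s₀ φ) (hy : y ∈ U) : Tendsto (φ y) (𝓝[>] 0) (𝓝 0) := by
  obtain ⟨ψ, hψ, h⟩ := h
  have h1 := (tendsto_id_nhdsGT_zero.pow (k + 1)).mul (hψ.tendsto hs₀ hy)
  simp only [zero_pow (Nat.succ_ne_zero k), zero_mul] at h1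
  refine h1.congr' ?_
  filter_upwards [Ioo_mem_nhdsGT hs₀] with s hs using (h y hy s hs).symm

/-- Expansion to third order in `s`, with a remainder that is differentiable in all variables. -/
theorem exists_third_order_remainder (hU : IsOpen U) {n : ℕ∞} {φ : S2 → ℝ → ℝ}
    (h : SmoothUpToBoundary ((n + 3 : ℕ∞) : WithTop ℕ∞) U s₀ φ) :
    ∃ (a b c : S2 → ℝ) (ψ : S2 → ℝ → ℝ), SmoothUpToBoundary n U s₀ ψ ∧
      ∀ y ∈ U, ∀ s ∈ Ico 0 s₀, φ y s = a y + b y * s + c y * s ^ 2 + s ^ 3 * ψ y s := by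
  have h1 : SmoothUpToBoundary ((n + 2 : ℕ∞) : WithTop ℕ∞) U s₀ (sQuot U s₀ φ) := by
    apply SmoothUpToBoundary.sQuot hU
    have e : (n + 3 : ℕ∞) = n + 2 + 1 := by rw [add_assoc]; rfl
    rw [e] at h
    exact_mod_cast h
  have h2 : SmoothUpToBoundary ((n + 1 : ℕ∞) : WithTop ℕ∞) U s₀ (sQuot U s₀ (sQuot U s₀ φ)) := by
    apply SmoothUpToBoundary.sQuot hU
    have e : (n + 2 : ℕ∞) = n + 1 + 1 := by rw [add_assoc]; rfl
    rw [e] at h1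
    exact_mod_cast h1
  have h3 : SmoothUpToBoundary n U s₀ (sQuot U s₀ (sQuot U s₀ (sQuot U s₀ φ))) := by
    apply SmoothUpToBoundary.sQuot hU
    exact_mod_cast h2
  refine ⟨fun y => φ y 0, fun y => sQuot U s₀ φ y 0, fun y => sQuot U s₀ (sQuot U s₀ φ) y 0, _, h3,
    fun y hy s hs => ?_⟩
  have e1 := eq_add_mul_sQuot hU (h.of_le (by
    exact_mod_cast (show (1 : ℕ∞) ≤ 3 by norm_num).trans le_add_self)) hy hs
  have e2 := eq_add_mul_sQuot hU (h1.of_le (by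
    exact_mod_cast (show (1 : ℕ∞) ≤ 2 by norm_num).trans le_add_self)) hy hs
  have e3 := eq_add_mul_sQuot hU (h2.of_le (by
    exact_mod_cast (le_add_self : (1 : ℕ∞) ≤ n + 1))) hy hs
  rw [e1, e2, e3]
  ring

end Remainders

namespace Schwarzschild

variable {U : Set S2} {s₀ : ℝ} {m H₀ : ℝ} {P : S2 → ℝ → ℝ} {f : S2 → ℝ} {y : S2}

theorem sphInner_bdP1 (k : S2 → ℝ)
    (hf : DifferentiableAt ℝ (radialExt (sphGradSq f)) (y : E3)) :
    sphInner k (bdP1 H₀ f) y = -(1 / 2) * sphInner k (sphGradSq f) y := by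
  have h : bdP1 H₀ f = fun z => -(1 / 2) * ((H₀ ^ 2)⁻¹ + sphGradSq f z) := rfl
  have hc : DifferentiableAt ℝ (radialExt fun _ => (H₀ ^ 2)⁻¹) (y : E3) :=
    differentiableAt_const _
  rw [h, sphInner_const_mul_right (k := fun z => (H₀ ^ 2)⁻¹ + sphGradSq f z) k _ (hc.add hf)]
  simp only [sphInner_eq_sum, sphPartial_add hc hf, sphPartial_const, zero_add]

theorem sphLap_bdP1 (hf : ContDiffAt ℝ 2 (radialExt (sphGradSq f)) (y : E3)) :
    sphLap (bdP1 H₀ f) y = -(1 / 2) * sphLap (sphGradSq f) y := by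
  have h : bdP1 H₀ f = fun z => -(1 / 2) * ((H₀ ^ 2)⁻¹ + sphGradSq f z) := rfl
  have hc : ContDiffAt ℝ 2 (radialExt fun _ => (H₀ ^ 2)⁻¹) (y : E3) := contDiffAt_const
  rw [h, sphLap_const_mul (f := fun z => (H₀ ^ 2)⁻¹ + sphGradSq f z) _ (hc.add hf),
    sphLap_add hc hf, sphLap_const, zero_add]

theorem sphInner_bdL1 (k : S2 → ℝ)
    (hf : DifferentiableAt ℝ (radialExt (sphLap f)) (y : E3)) :
    sphInner k (bdL1 H₀ f) y = -(H₀ ^ 2)⁻¹ * sphInner k (sphLap f) y :=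
  sphInner_const_mul_right k _ hf

/-- Given the formulas for `P_s` and `L_s` at the boundary, the coefficient of `s²` in the mean
curvature equation vanishes exactly if `L_ss` is as prescribed. -/
theorem second_coeff_eq (hs₀ : 0 < s₀) (hU : IsOpen U) (hP : SmoothUpToBoundary 4 U s₀ P)
    (hH₀ : 0 < H₀) (hp₁ : ∀ y ∈ U, sDeriv 1 P y 0 = bdP1 H₀ (fun z => P z 0) y)
    (hl₁ : ∀ y ∈ U, sDeriv 1 (L m P) y 0 = bdL1 H₀ (fun z => P z 0) y) (hy : y ∈ U) :
    -(1 / 2) * sDeriv 2 (L m P) y 0 + 2 * (H₀ ^ 2)⁻¹ * sDeriv 1 P y 0 -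
        9 / 4 * H₀ ^ 2 * sDeriv 1 (L m P) y 0 ^ 2 +
        sphInner (fun z => P z 0) (fun z => sDeriv 1 (L m P) z 0) y -
        2 * (H₀ ^ 2)⁻¹ * sphLap (fun z => sDeriv 1 P z 0) y -
        2 * sDeriv 1 (L m P) y 0 * sphLap (fun z => P z 0) y =
      1 / 2 * (bdL2 H₀ (fun z => P z 0) y - sDeriv 2 (L m P) y 0) := by
  have h0 : (0 : ℝ) ∈ Ico 0 s₀ := ⟨le_rfl, hs₀⟩
  have dG : ContDiffAt ℝ 2 (radialExt (sphGradSq fun z => P z 0)) (y : E3) :=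
    ((hP.of_le (show (3 : WithTop ℕ∞) ≤ 4 by norm_num)).sphGradSq (n := 2) hU
      ).contDiffAt_radialExt hU h0 hy
  have dΔ : ContDiffAt ℝ 2 (radialExt (sphLap fun z => P z 0)) (y : E3) :=
    (hP.sphLap (n := 2) hU).contDiffAt_radialExt hU h0 hy
  rw [sphInner_congr hU (fun _ _ => rfl) hl₁ hy, sphLap_congr hU hp₁ hy,
    sphInner_bdL1 _ (dΔ.differentiableAt two_ne_zero), sphLap_bdP1 dG, hp₁ y hy, hl₁ y hy,
    sphInner_comm, bdP1, bdL1, bdL2]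
  field_simp
  ring

/-- The equation `L = H₀⁻²` and the formula for `L_s` determine `P_ss` at the boundary. -/
theorem bdP2_of_bdL1 (hs₀ : 0 < s₀) (hU : IsOpen U) (hP : SmoothUpToBoundary 4 U s₀ P)
    (hp₁ : ∀ y ∈ U, sDeriv 1 P y 0 = bdP1 H₀ (fun z => P z 0) y)
    (hl₁ : sDeriv 1 (L m P) y 0 = bdL1 H₀ (fun z => P z 0) y) (hy : y ∈ U) :
    sDeriv 2 P y 0 = bdP2 H₀ (fun z => P z 0) y := by
  have h0 : (0 : ℝ) ∈ Ico 0 s₀ := ⟨le_rfl, hs₀⟩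
  have dG : ContDiffAt ℝ 2 (radialExt (sphGradSq fun z => P z 0)) (y : E3) :=
    ((hP.of_le (show (3 : WithTop ℕ∞) ≤ 4 by norm_num)).sphGradSq (n := 2) hU
      ).contDiffAt_radialExt hU h0 hy
  have h := (sDeriv_L (m := m) hU hs₀ hP hy).1
  rw [sphInner_congr hU (fun _ _ => rfl) hp₁ hy,
    sphInner_bdP1 _ (dG.differentiableAt two_ne_zero), hl₁, bdL1, sphInner_comm] at h
  rw [bdP2]
  linear_combination h / 2

/-- The formula for `L_ss` and those for `P_s` and `P_ss` determine `P_sss` at the boundary. -/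
theorem bdP3_of_bdL2 (hs₀ : 0 < s₀) (hU : IsOpen U) (hP : SmoothUpToBoundary 4 U s₀ P)
    (hp₁ : ∀ y ∈ U, sDeriv 1 P y 0 = bdP1 H₀ (fun z => P z 0) y)
    (hp₂ : ∀ y ∈ U, sDeriv 2 P y 0 = bdP2 H₀ (fun z => P z 0) y)
    (hl₂ : sDeriv 2 (L m P) y 0 = bdL2 H₀ (fun z => P z 0) y) (hy : y ∈ U) :
    sDeriv 3 P y 0 = bdP3 H₀ (fun z => P z 0) y := by
  have h := (sDeriv_L (m := m) hU hs₀ hP hy).2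
  rw [sphInner_congr hU (fun _ _ => rfl) hp₂ hy, sphGradSq, sphInner_congr hU hp₁ hp₁ hy, hl₂,
    hp₁ y hy, bdL2, sphInner_comm _ (bdP2 _ _)] at h
  have e : sphGradSq (bdP1 H₀ fun z => P z 0) y =
    sphInner (bdP1 H₀ fun z => P z 0) (bdP1 H₀ fun z => P z 0) y := rfl
  rw [bdP3, e]
  linear_combination h / 2

/-- The direct part: the expansion of the mean curvature equation determines the boundary
derivatives. -/
theorem boundaryFormulas_of_isBoundaryO (hm : 0 ≤ m) (hH₀ : 0 < H₀) (hU : IsOpen U)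
    (hs₀ : 0 < s₀) (hms : 2 * m * s₀ ≤ 1) (hP : SmoothUpToBoundary 4 U s₀ P)
    (hspace : IsSpacelikeGraph m U s₀ P) {ψ : S2 → ℝ → ℝ} (hψ : SmoothUpToBoundary 0 U s₀ ψ)
    (hψH : ∀ y ∈ U, ∀ s ∈ Ioo 0 s₀, meanCurv m P y s - H₀ = s ^ 3 * ψ y s) :
    (∀ y ∈ U, L m P y 0 = (H₀ ^ 2)⁻¹ ∧ BoundaryFormulas m H₀ P y) ∧
      ((∀ y, ψ y 0 = 0) → ∀ y ∈ U, Compatible H₀ (fun z => P z 0) y) := by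
  have hLs : SmoothUpToBoundary 3 U s₀ (L m P) := smooth_L hU (hP.of_le (by norm_num))
  have hL : ∀ y ∈ U, ∀ s ∈ Ico 0 s₀, 0 < L m P y s := by
    intro y hy s hs
    rcases hs.1.eq_or_lt with h | h
    · rw [← h]
      refine L_pos_boundary hm hms hs₀ hU hP hspace (ψ := fun y s => H₀ + s ^ 3 * ψ y s)
        ((SmoothUpToBoundary.const H₀).add ((SmoothUpToBoundary.of_contDiff
          (g := fun s => s ^ 3) (by fun_prop)).mul hψ)) (fun y hy s hs => ?_) hy
      rw [← hψH y hy s hs]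
      ring
    · exact L_pos hm hms hU (hP.of_le (by norm_num)) hspace hy ⟨h, hs.2⟩
  have hL0 : ∀ y ∈ U, L m P y 0 = (H₀ ^ 2)⁻¹ := by
    intro y hy
    refine L_zero_of_tendsto hm hms hs₀ hU hP hH₀ hL hy ?_
    have h := (IsBoundaryO.tendsto_zero hs₀ (k := 2) ⟨ψ, hψ, hψH⟩ hy).add_const H₀
    simpa using h
  have hj : ∀ y ∈ U, Jet3 (defect m H₀ P y) 0 0 0
      (6 * Real.sqrt (L m P y 0) ^ 3 * ψ y 0) := by
    intro y hy
    refine jet3_of_pow_three ((((hLs.tendsto hs₀ hy).sqrt.pow 3).const_mul 6).mul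
      (hψ.tendsto hs₀ hy)) ?_
    filter_upwards [Ioo_mem_nhdsGT hs₀] with s hs
    rw [meanCurv_sub_eq hm hms hU hP H₀ hy hs (hL y hy s (Ioo_subset_Ico_self hs)),
      hψH y hy s hs]
    ring
  have hcoeff := fun y (hy : y ∈ U) => (jet3_defect hs₀ hU hP hH₀ hL hL0 hy rfl rfl rfl rfl rfl rfl
    rfl rfl rfl rfl).unique (hj y hy)
  have hp₁ : ∀ y ∈ U, sDeriv 1 P y 0 = bdP1 H₀ (fun z => P z 0) y := by
    intro y hy
    have h := hL0 y hy
    rw [L_zero] at h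
    rw [bdP1]
    linear_combination -h / 2
  have hl₁ : ∀ y ∈ U, sDeriv 1 (L m P) y 0 = bdL1 H₀ (fun z => P z 0) y := by
    intro y hy
    rw [bdL1]
    linear_combination -(hcoeff y hy).2.1 / 2
  have hp₂ := fun y (hy : y ∈ U) => bdP2_of_bdL1 hs₀ hU hP hp₁ (hl₁ y hy) hy
  have hl₂ : ∀ y ∈ U, sDeriv 2 (L m P) y 0 = bdL2 H₀ (fun z => P z 0) y := by
    intro y hy
    have h := (hcoeff y hy).2.2.1
    rw [second_coeff_eq hs₀ hU hP hH₀ hp₁ hl₁ hy] at h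
    linear_combination -2 * h
  refine ⟨fun y hy => ⟨hL0 y hy, hp₁ y hy, hl₁ y hy, hp₂ y hy, hl₂ y hy,
    bdP3_of_bdL2 hs₀ hU hP hp₁ hp₂ (hl₂ y hy) hy⟩, fun h0 y hy => ?_⟩
  have h := (hcoeff y hy).2.2.2
  rw [h0, mul_zero, sphInner_congr hU (fun _ _ => rfl) hl₂ hy, sphInner_congr hU hp₁ hl₁ hy,
    sphLap_congr hU hp₁ hy, sphLap_congr hU hp₂ hy, hp₁ y hy, hl₁ y hy, hl₂ y hy,
    sphInner_comm _ (bdL2 _ _), sphInner_comm (bdP1 _ _)] at h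
  rw [Compatible]
  have hΔ : bdL1 H₀ (fun z => P z 0) y = -(H₀ ^ 2)⁻¹ * sphLap (fun z => P z 0) y := rfl
  have hΔ' : H₀ ^ 2 * bdL1 H₀ (fun z => P z 0) y = -sphLap (fun z => P z 0) y := by
    rw [hΔ]
    field_simp
  linear_combination -2 * h - 9 / 2 * bdL2 H₀ (fun z => P z 0) y * hΔ'

/-- The converse: the boundary formulas make the first three coefficients of the mean curvature
equation vanish, and dividing by `s³` costs three derivatives of a function of class `C^{n+3}`. -/
theorem isBoundaryO_of_boundaryFormulas (hm : 0 ≤ m) (hH₀ : 0 < H₀) (hU : IsOpen U)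
    (hs₀ : 0 < s₀) (hms : 2 * m * s₀ ≤ 1) (hspace : IsSpacelikeGraph m U s₀ P)
    (hb : ∀ y ∈ U, BoundaryFormulas m H₀ P y) {n : ℕ∞}
    (hPn : SmoothUpToBoundary ((n + 4 : ℕ∞) : WithTop ℕ∞) U s₀ P) :
    IsBoundaryO n 3 U s₀ (fun y s => meanCurv m P y s - H₀) := by
  have hP : SmoothUpToBoundary 4 U s₀ P := hPn.of_le
    (WithTop.coe_le_coe.2 (le_add_self : (4 : ℕ∞) ≤ n + 4))
  have hL0 : ∀ y ∈ U, L m P y 0 = (H₀ ^ 2)⁻¹ := by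
    intro y hy
    rw [L_zero, (hb y hy).1, bdP1]
    ring
  have hL : ∀ y ∈ U, ∀ s ∈ Ico 0 s₀, 0 < L m P y s := by
    intro y hy s hs
    rcases hs.1.eq_or_lt with h | h
    · rw [← h, hL0 y hy]
      positivity
    · exact L_pos hm hms hU (hP.of_le (by norm_num)) hspace hy ⟨h, hs.2⟩
  have e4 : ((n + 4 : ℕ∞) : WithTop ℕ∞) = ((n + 3 : ℕ∞) : WithTop ℕ∞) + 1 := by
    have e : (n + 4 : ℕ∞) = n + 3 + 1 := by rw [add_assoc]; rfl
    rw [e]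
    norm_cast
  have e4' : ((n + 4 : ℕ∞) : WithTop ℕ∞) = ((n + 2 : ℕ∞) : WithTop ℕ∞) + 2 := by
    have e : (n + 4 : ℕ∞) = n + 2 + 2 := by rw [add_assoc]; rfl
    rw [e]
    norm_cast
  have hLs : SmoothUpToBoundary ((n + 3 : ℕ∞) : WithTop ℕ∞) U s₀ (L m P) :=
    smooth_L hU (hPn.of_le e4.ge)
  have hA : SmoothUpToBoundary ((n + 3 : ℕ∞) : WithTop ℕ∞) U s₀ (radialFactor m P) :=
    smooth_radialFactor hU (hPn.of_le e4.ge)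
  have hB : SmoothUpToBoundary ((n + 2 : ℕ∞) : WithTop ℕ∞) U s₀ (boxTerm m P) :=
    smooth_boxTerm hU (hPn.of_le e4'.ge)
  have hT : SmoothUpToBoundary ((n + 2 : ℕ∞) : WithTop ℕ∞) U s₀ (transportL m P) :=
    smooth_transportL hU (hPn.of_le e4'.ge)
  have hμ := hLs.sqrt fun y hy s hs => (hL y hy s hs).ne'
  have le32 : ((n + 2 : ℕ∞) : WithTop ℕ∞) ≤ ((n + 3 : ℕ∞) : WithTop ℕ∞) := by
    exact_mod_cast add_le_add_right (show (2 : ℕ∞) ≤ 3 by norm_num) n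
  have le3 : (n : WithTop ℕ∞) ≤ ((n + 3 : ℕ∞) : WithTop ℕ∞) := by
    exact_mod_cast (le_self_add : n ≤ n + 3)
  let T : S2 → ℝ → ℝ := fun y s => transportL m P y s - 2 * (L m P y s * boxTerm m P y s)
  have hT' : SmoothUpToBoundary ((n + 2 : ℕ∞) : WithTop ℕ∞) U s₀ T :=
    hT.sub ((SmoothUpToBoundary.const 2).mul ((hLs.of_le le32).mul hB))
  obtain ⟨a, b, c, V, hV, eV⟩ := exists_third_order_remainder hU
    (((SmoothUpToBoundary.const 6).mul (hA.mul hLs)).sub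
      ((SmoothUpToBoundary.const (6 * H₀)).mul (hμ.pow 3)))
  obtain ⟨W, hW, -, eW⟩ := exists_second_order_remainder hU hs₀ (n := n)
    (hT'.of_le (by push_cast; exact le_rfl))
  have key : ∀ y ∈ U, ∀ s ∈ Ico 0 s₀, defect m H₀ P y s = s ^ 3 * (V y s + W y s) := by
    intro y hy
    obtain ⟨b₁, hl₁, b₂, hl₂, -⟩ := hb y hy
    have hj := jet3_defect hs₀ hU hP hH₀ hL hL0 hy rfl rfl rfl rfl rfl rfl rfl rfl rfl rfl
    rw [second_coeff_eq hs₀ hU hP hH₀ (fun y hy => (hb y hy).1) (fun y hy => (hb y hy).2.1) hy,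
      hl₂, hl₁, bdL1] at hj
    have e : ∀ s ∈ Ico 0 s₀, defect m H₀ P y s = a y + (b y + T y 0) * s +
        (c y + sDeriv 1 T y 0) * s ^ 2 + s ^ 3 * (V y s + W y s) := by
      intro s hs
      have e1 := eV y hy s hs
      have e2 : transportL m P y s - 2 * (L m P y s * boxTerm m P y s) = _ := eW y hy s hs
      rw [defect, e2, e1]
      ring
    have hj' : Jet3 (defect m H₀ P y) (a y) (b y + T y 0) (c y + sDeriv 1 T y 0)
        (V y 0 + W y 0) := by
      refine ⟨fun s => V y s + W y s, (hV.tendsto hs₀ hy).add (hW.tendsto hs₀ hy), ?_⟩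
      filter_upwards [Ioo_mem_nhdsGT hs₀] with s hs using e s (Ioo_subset_Ico_self hs)
    obtain ⟨h0, h1, h2, -⟩ := hj'.unique hj
    intro s hs
    rw [e s hs, h0, h1, h2]
    ring
  refine ⟨fun y s => (V y s + W y s) / (6 * Real.sqrt (L m P y s) ^ 3),
    (hV.add hW).div ((SmoothUpToBoundary.const 6).mul ((hμ.of_le le3).pow 3)) ?_, ?_⟩
  · intro y hy s hs
    have := Real.sqrt_pos.2 (hL y hy s hs)
    positivity
  · intro y hy s hs
    have hs' := Ioo_subset_Ico_self hs
    have hpos := Real.sqrt_pos.2 (hL y hy s hs')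
    have h1 := meanCurv_sub_eq hm hms hU hP H₀ hy hs (hL y hy s hs')
    rw [key y hy s hs'] at h1
    rw [← mul_div_assoc, h1]
    field_simp

end Schwarzschild

end

theorem corollary3p1 (m : ℝ) (hm : 0 ≤ m) (H₀ : ℝ) (hH₀ : 0 < H₀)
    (U : Set S2) (hU : IsOpen U) (s₀ : ℝ) (hs₀ : 0 < s₀) (hms : 2 * m * s₀ ≤ 1)
    (P : S2 → ℝ → ℝ) (hP : SmoothUpToBoundary 4 U s₀ P)
    (hspace : Schwarzschild.IsSpacelikeGraph m U s₀ P) :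
    -- the direct part; the regularity of the extensions in the hypotheses is only continuity
    (IsBoundaryO 0 3 U s₀ (fun y s => Schwarzschild.meanCurv m P y s - H₀) →
      (∀ y ∈ U, Schwarzschild.L m P y 0 = (H₀ ^ 2)⁻¹ ∧
        Schwarzschild.BoundaryFormulas m H₀ P y) ∧
      (IsBoundaryO 0 4 U s₀ (fun y s => Schwarzschild.meanCurv m P y s - H₀) →
        ∀ y ∈ U, Schwarzschild.Compatible H₀ (fun z => P z 0) y)) ∧
    -- the converse; a surface of class `C^{n+4}` gives an extension of class `C^n`
    ((∀ y ∈ U, Schwarzschild.BoundaryFormulas m H₀ P y) →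
      (∀ y ∈ U, Tendsto (fun s => Schwarzschild.meanCurv m P y s) (𝓝[>] 0) (𝓝 H₀)) →
      ∀ n : ℕ∞, SmoothUpToBoundary ((n + 4 : ℕ∞) : WithTop ℕ∞) U s₀ P →
        IsBoundaryO (n : WithTop ℕ∞) 3 U s₀
          (fun y s => Schwarzschild.meanCurv m P y s - H₀)) := by
  refine ⟨fun h3 => ?_, fun hb _ n hPn =>
    Schwarzschild.isBoundaryO_of_boundaryFormulas hm hH₀ hU hs₀ hms hspace hb hPn⟩
  obtain ⟨ψ, hψ, h⟩ := h3
  refine ⟨(Schwarzschild.boundaryFormulas_of_isBoundaryO hm hH₀ hU hs₀ hms hP hspace hψ h).1,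
    fun h4 => ?_⟩
  obtain ⟨χ, hχ, h0, h'⟩ := h4.exists_eq_pow_mul
  exact (Schwarzschild.boundaryFormulas_of_isBoundaryO hm hH₀ hU hs₀ hms hP hspace hχ h').2 h0
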